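/- Let $k\ge 1$, $n\geq 0$, and let $M$ be a smooth manifold of dimension $n+kn+k$. A \emph{$k$-contact form} on $M$ is a smooth $\mathbb{R}^k$-valued one-form $\boldsymbol\eta=(\eta^1,\dots,\eta^k)$ such that $\ker\boldsymbol\eta$ is a non-zero distribution of corank $k$, $\ker d\boldsymbol\eta=\{v : \iota_v d\boldsymbol\eta=0\}$ is a distribution of rank $k$, and $\ker\boldsymbol\eta\cap\ker d\boldsymbol\eta=0$. A \emph{polarization} is an integrable smooth subbundle $\mathcal V\subset\ker\boldsymbol\eta$ of rank $nk$; then $(M,\boldsymbol\eta,\mathcal V)$ is a \emph{polarized $k$-contact manifold}. Local coordinates $\{s^\alpha,q^i,p_i^\alpha\}$ ($1\le i\le n$, $1\le\alpha\le k$) on an open set $U\subset M$ are \emph{$k$-contact Darboux coordinates} if $\eta^\alpha|_U=ds^\alpha-\sum_{i}p_i^\alpha\,dq^i$ for all $\alpha$. A submanifold $L$ of $M$ (possibly only immersed) is \emph{Legendrian} if for every $x\in L$ one has $T_xL\subset\ker\boldsymbol\eta_x$, $d\boldsymbol\eta$ vanishes on $T_xL\times T_xL$, and $T_xL$ has a complement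 $F_x$ in $T_xM$ such that $d\boldsymbol\eta$ vanishes on $F_x\times F_x$. \textbf{Proposition.} Let $L$ be a Legendrian submanifold of a polarized $k$-contact manifold $(M,\boldsymbol\eta,\mathcal V)$ of dimension $n+kn+k$. Then there is an integer $0\le s\le n$ such that around every point of $L$ there are $k$-contact Darboux coordinates $\{s^\alpha,q^i,p_i^\alpha\}$ of $M$ for which the restrictions to $L$ of the functions $q^i$ ($1\le i\le s$) and $p_j^\alpha$ ($s<j\le n$, $1\le\alpha\le k$) form a smooth coordinate system of $L$ near that point, so that these variables parametrize $L$ locally. If $k\ge2$, the Darboux coordinates are moreover adapted to the polarization: $\mathcal V=\langle\partial/\partial p_i^\alpha\rangle$ on their domain. Consequently, if $L\neq\emptyset$, then $\dim L=s+k(n-s)$; in particular the only possible dimensions of $L$ are $n+(k-1)r$ with $r\in\{0,1,\dots,n\}$. -/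

import Mathlib

open scoped Manifold ContDiff Topology

noncomputable section

namespace KContact

section Forms

variable {E : Type*} [NormedAddCommGroup E] [NormedSpace ℝ E]
  {M : Type*} [TopologicalSpace M] [ChartedSpace E M]

/-- An `ℝ^k`-valued one-form on the manifold `M`, not yet assumed smooth. -/
abbrev OneForm (E : Type*) [NormedAddCommGroup E] [NormedSpace ℝ E]
    (M : Type*) [TopologicalSpace M] [ChartedSpace E M] (k : ℕ) : Type _ :=
  ∀ x : M, TangentSpace 𝓘(ℝ, E) x →L[ℝ] (Fin k → ℝ)

/-- Smoothness of an `ℝ^k`-valued one-form, as a section of the bundle `Hom(TM, M × ℝ^k)`. -/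
def OneForm.IsSmooth [IsManifold 𝓘(ℝ, E) ∞ M] {k : ℕ} (η : OneForm E M k) : Prop :=
  ContMDiff 𝓘(ℝ, E) (𝓘(ℝ, E).prod 𝓘(ℝ, E →L[ℝ] (Fin k → ℝ))) ∞
    (fun x : M => Bundle.TotalSpace.mk' (E →L[ℝ] (Fin k → ℝ))
      (E := fun x : M => TangentSpace 𝓘(ℝ, E) x →L[ℝ] Bundle.Trivial M (Fin k → ℝ) x) x (η x))

/-- The coordinate expression of the one-form `η` in the preferred chart around `x`: its pullback
under the inverse of that chart. -/
def OneForm.inChart {k : ℕ} (η : OneForm E M k) (x : M) (y : E) : E →L[ℝ] (Fin k → ℝ) :=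
  (η ((chartAt E x).symm y)).comp (mfderiv 𝓘(ℝ, E) 𝓘(ℝ, E) (chartAt E x).symm y)

/-- The exterior derivative `dη` at `x`, evaluated on two tangent vectors. In the chart around `x`
it is `dη (v, w) = D η (v) (w) - D η (w) (v)`. -/
def OneForm.d {k : ℕ} (η : OneForm E M k) (x : M) (v w : TangentSpace 𝓘(ℝ, E) x) : Fin k → ℝ :=
  let A : TangentSpace 𝓘(ℝ, E) x →L[ℝ] E := mfderiv 𝓘(ℝ, E) 𝓘(ℝ, E) (chartAt E x) x
  let D : E →L[ℝ] E →L[ℝ] (Fin k → ℝ) := fderiv ℝ (η.inChart x) (chartAt E x x)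
  D (A v) (A w) - D (A w) (A v)

theorem OneForm.d_zero {k : ℕ} (η : OneForm E M k) (x : M) (w : TangentSpace 𝓘(ℝ, E) x) :
    η.d x 0 w = 0 := by
  have key : ∀ (A : E →L[ℝ] E) (D : E →L[ℝ] E →L[ℝ] (Fin k → ℝ)) (w : E),
      D (A 0) (A w) - D (A w) (A 0) = 0 := by intro A D w; simp
  exact key _ _ w

theorem OneForm.d_add {k : ℕ} (η : OneForm E M k) (x : M) (a b w : TangentSpace 𝓘(ℝ, E) x) :
    η.d x (a + b) w = η.d x a w + η.d x b w := by
  have key : ∀ (A : E →L[ℝ] E) (D : E →L[ℝ] E →L[ℝ] (Fin k → ℝ)) (a b w : E),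
      D (A (a + b)) (A w) - D (A w) (A (a + b)) =
        D (A a) (A w) - D (A w) (A a) + (D (A b) (A w) - D (A w) (A b)) := by
    intro A D a b w
    simp only [map_add, add_apply]
    abel
  exact key _ _ a b w

theorem OneForm.d_smul {k : ℕ} (η : OneForm E M k) (x : M) (c : ℝ)
    (a w : TangentSpace 𝓘(ℝ, E) x) : η.d x (c • a) w = c • η.d x a w := by
  have key : ∀ (A : E →L[ℝ] E) (D : E →L[ℝ] E →L[ℝ] (Fin k → ℝ)) (c : ℝ) (a w : E),
      D (A (c • a)) (A w) - D (A w) (A (c • a)) =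
        c • (D (A a) (A w) - D (A w) (A a)) := by
    intro A D c a w
    simp only [map_smul, smul_apply, smul_sub]
  exact key _ _ c a w

/-- The fibre at `x` of the distribution `ker η`. -/
def OneForm.ker {k : ℕ} (η : OneForm E M k) (x : M) : Submodule ℝ (TangentSpace 𝓘(ℝ, E) x) :=
  LinearMap.ker (η x).toLinearMap

/-- The fibre at `x` of the Reeb distribution `ker dη = {v | ι_v dη = 0}`. -/
def OneForm.kerD {k : ℕ} (η : OneForm E M k) (x : M) :
    Submodule ℝ (TangentSpace 𝓘(ℝ, E) x) where
  carrier := {v | ∀ w, η.d x v w = 0}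
  zero_mem' := fun w => η.d_zero x w
  add_mem' := fun ha hb w => by rw [η.d_add, ha w, hb w, add_zero]
  smul_mem' := fun c a ha w => by rw [η.d_smul, ha w, smul_zero]

/-- `η` is a `k`-contact form: `ker η` is a non-zero distribution of corank `k`, `ker dη` is a
distribution of rank `k`, and the two intersect trivially. -/
structure IsKContactForm [IsManifold 𝓘(ℝ, E) ∞ M] {k : ℕ} (η : OneForm E M k) : Prop where
  smooth : η.IsSmooth
  ker_ne_bot : ∀ x, η.ker x ≠ ⊥
  corank_ker : ∀ x, Module.finrank ℝ (η.ker x) + k = Module.finrank ℝ E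
  rank_kerD : ∀ x, Module.finrank ℝ (η.kerD x) = k
  ker_inf_kerD : ∀ x, η.ker x ⊓ η.kerD x = ⊥

/-- `V` is a smooth subbundle of rank `r` of the tangent bundle: it is locally spanned by `r`
smooth, pointwise linearly independent vector fields. -/
def IsSmoothSubbundle [IsManifold 𝓘(ℝ, E) ∞ M] (r : ℕ)
    (V : ∀ x : M, Submodule ℝ (TangentSpace 𝓘(ℝ, E) x)) : Prop :=
  ∀ x : M, ∃ U : Set M, IsOpen U ∧ x ∈ U ∧ ∃ X : Fin r → ∀ y : M, TangentSpace 𝓘(ℝ, E) y,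
    (∀ i, ContMDiffOn 𝓘(ℝ, E) 𝓘(ℝ, E).tangent ∞
      (fun y => (⟨y, X i y⟩ : TangentBundle 𝓘(ℝ, E) M)) U) ∧
    ∀ y ∈ U, LinearIndependent ℝ (fun i => X i y) ∧
      Submodule.span ℝ (Set.range fun i => X i y) = V y

/-- `V` is integrable (with integral manifolds of dimension `r`): through every point of `M` there
passes an integral manifold of `V`, given by an immersion of an open subset of `ℝ^r`. -/
def IsIntegrable (r : ℕ) (V : ∀ x : M, Submodule ℝ (TangentSpace 𝓘(ℝ, E) x)) : Prop :=
  ∀ x : M, ∃ (W : Set (Fin r → ℝ)) (f : (Fin r → ℝ) → M), IsOpen W ∧ 0 ∈ W ∧ f 0 = x ∧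
    ContMDiffOn 𝓘(ℝ, Fin r → ℝ) 𝓘(ℝ, E) ∞ f W ∧
    ∀ u ∈ W, Function.Injective (mfderiv 𝓘(ℝ, Fin r → ℝ) 𝓘(ℝ, E) f u) ∧
      LinearMap.range (mfderiv 𝓘(ℝ, Fin r → ℝ) 𝓘(ℝ, E) f u).toLinearMap = V (f u)

/-- `V` is a polarization of the `k`-contact distribution `ker η` on a manifold of dimension
`n + k n + k`: an integrable subbundle of `ker η` of rank `n k`. -/
structure IsPolarization [IsManifold 𝓘(ℝ, E) ∞ M] {k : ℕ} (n : ℕ) (η : OneForm E M k)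
    (V : ∀ x : M, Submodule ℝ (TangentSpace 𝓘(ℝ, E) x)) : Prop where
  finrank_eq : Module.finrank ℝ E = n + k * n + k
  subbundle : IsSmoothSubbundle (n * k) V
  integrable : IsIntegrable (n * k) V
  le_ker : ∀ x, V x ≤ η.ker x

/-- The subspace `S` of `ker η_x` is isotropic: it lies in its `k`-contact orthogonal
`{v ∈ ker η_x | dη (v, w) = 0 for all w ∈ S}`. -/
def IsIsotropicAt {k : ℕ} (η : OneForm E M k) (x : M)
    (S : Submodule ℝ (TangentSpace 𝓘(ℝ, E) x)) : Prop :=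
  ∀ v ∈ S, v ∈ η.ker x ∧ ∀ w ∈ S, η.d x v w = 0

/-- The subspace `S` of `ker η_x` is Legendrian: it is isotropic and has a complement `F` in the
tangent space on which `dη` vanishes. -/
def IsLegendrianAt {k : ℕ} (η : OneForm E M k) (x : M)
    (S : Submodule ℝ (TangentSpace 𝓘(ℝ, E) x)) : Prop :=
  IsIsotropicAt η x S ∧ ∃ F : Submodule ℝ (TangentSpace 𝓘(ℝ, E) x), IsCompl F S ∧
    ∀ v ∈ F, ∀ w ∈ F, η.d x v w = 0

/-- `ι : L → M` presents the manifold `L` as an (immersed) Legendrian submanifold of `(M, η)`: it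
is an injective immersion and every tangent space of `L` is mapped to a Legendrian subspace.
Embedded submanifolds are the case where `ι` is the inclusion. -/
structure IsLegendrianSubmanifold {E' : Type*} [NormedAddCommGroup E'] [NormedSpace ℝ E']
    {L : Type*} [TopologicalSpace L] [ChartedSpace E' L] {k : ℕ} (η : OneForm E M k)
    (ι : L → M) : Prop where
  smooth : ContMDiff 𝓘(ℝ, E') 𝓘(ℝ, E) ∞ ι
  injective : Function.Injective ι
  immersion : ∀ z, Function.Injective (mfderiv 𝓘(ℝ, E') 𝓘(ℝ, E) ι z)
  legendrian : ∀ z, IsLegendrianAt η (ι z)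
    (LinearMap.range (mfderiv 𝓘(ℝ, E') 𝓘(ℝ, E) ι z).toLinearMap)

/-- The space of coordinates `(s^α, q^i, p_i^α)`, with `p i α` standing for `p_i^α`. -/
abbrev DarbouxSpace (k n : ℕ) : Type :=
  (Fin k → ℝ) × (Fin n → ℝ) × (Fin n → Fin k → ℝ)

/-- The local chart `φ = (s, q, p)` of `M` is a smooth system of `k`-contact Darboux coordinates:
`η^α = ds^α - ∑ i, p_i^α dq^i` on its domain. -/
structure IsDarbouxChart {k n : ℕ} (η : OneForm E M k)
    (φ : OpenPartialHomeomorph M (DarbouxSpace k n)) : Prop where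
  smooth : ContMDiffOn 𝓘(ℝ, E) 𝓘(ℝ, DarbouxSpace k n) ∞ φ φ.source
  smooth_symm : ContMDiffOn 𝓘(ℝ, DarbouxSpace k n) 𝓘(ℝ, E) ∞ φ.symm φ.target
  form_eq : ∀ x ∈ φ.source, ∀ (v : TangentSpace 𝓘(ℝ, E) x) (α : Fin k),
    let v' : DarbouxSpace k n := mfderiv 𝓘(ℝ, E) 𝓘(ℝ, DarbouxSpace k n) φ x v
    η x v α = v'.1 α - ∑ i, (φ x).2.2 i α * v'.2.1 i

/-- On the domain of the chart `φ = (s, q, p)`, the distribution `V` is spanned by the coordinate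
vector fields `∂/∂p_i^α`, that is, it is the common kernel of all `ds^α` and `dq^i`. -/
def IsSpannedByMomenta {k n : ℕ} (V : ∀ x : M, Submodule ℝ (TangentSpace 𝓘(ℝ, E) x))
    (φ : OpenPartialHomeomorph M (DarbouxSpace k n)) : Prop :=
  ∀ x ∈ φ.source, ∀ v : TangentSpace 𝓘(ℝ, E) x,
    let v' : DarbouxSpace k n := mfderiv 𝓘(ℝ, E) 𝓘(ℝ, DarbouxSpace k n) φ x v
    v ∈ V x ↔ v'.1 = 0 ∧ v'.2.1 = 0

/-- The space of variables `(q^i, p_j^α)`, where `i` runs through the first `s` indices and `j`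
through the remaining `n - s` ones. -/
abbrev MixedSpace (k n s : ℕ) : Type :=
  ({i : Fin n // i.val < s} → ℝ) × ({j : Fin n // s ≤ j.val} → Fin k → ℝ)

/-- The projection `(s^α, q^i, p_i^α) ↦ (q^i, p_j^α)` with `i` among the first `s` indices and `j`
among the remaining ones. -/
def mixedCoords {k n : ℕ} (s : ℕ) (c : DarbouxSpace k n) : MixedSpace k n s :=
  (fun i => c.2.1 i.1, fun j α => c.2.2 j.1 α)

end Forms

end KContact

end

/-! In Darboux coordinates the claim is linear algebra in a single tangent space, so the main task
is to find `n` independent functions `q` whose common fibres are isotropic for `dη`. Along such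
fibres `η` is closed, hence equal to `ds` for an `ℝ^k`-valued `s` (`exists_leafwise_potential`).
Then `ds - η` kills `ker dq`, so it is a combination `∑ p_i dq^i`, and `ker η ∩ ker dη = 0` together
with a dimension count makes `(s, q, p)` a chart (`exists_darboux_chart`).

For `k ≥ 2`, `q` consists of first integrals of the `dη`-orthogonal `V^⊥` of the polarization. By
dimension, `V^⊥ = V ⊕ ker dη`, and contraction with `dη` maps `V` onto all `ℝ^k`-valued forms that
vanish on `V^⊥` (`polarization_orth`). For a Reeb field `Z` and frame fields `X_a` of `V`, the
pairing `dη (X_a, [Z, X_b])` is symmetric in `a, b`. Since forms on `E/V^⊥` can be moved freely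
between the `k` components, such a symmetric pairing vanishes when `k ≥ 2`
(`mem_orth_of_symmetric`). Hence `V^⊥` is involutive and Frobenius' theorem applies; a dimension
count then gives `V = ⟨∂/∂p⟩`.

For `k = 1` the symmetry argument gives nothing, but no adaptation to `V` is asked for. There `q` is
built one function at a time: as long as the fibres of `m < n` functions are coisotropic, their
characteristic distribution is involutive and has a first integral independent of these functions,
and adjoining it keeps the fibres coisotropic (`CoisotropicNear.exists_succ`). For `m = n` the
fibres are isotropic.

At a point of `L`, the tangent space and its complement project to isotropic subspaces that together
span the `(q, p)`-space. An isotropic subspace whose `q`-projection has dimension `a` has dimension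
at most `a + k (n - a)`. The two bounds add up to at most the total dimension `n + k n`, so both are
equalities, and `T_xL` has as coordinates some `q^i` and the complementary `p_j`
(`exists_mixed_coordinates`). A permutation makes these indices an initial segment. The dimension of
`L` determines `s` if `k ≥ 2`; for `k = 1` a partial Legendre transformation gives `s = n`
everywhere.

Frobenius' theorem itself rests on solving total differential equations along rays, with smooth
dependence on the data from the inverse function theorem in `C([0,1], Y)`. -/

noncomputable section
namespace KContact

/-! ### Smoothness of composition with a fixed map on spaces of continuous paths -/

section Superposition

variable {I : Type*} [TopologicalSpace I] [CompactSpace I]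

/-- Pointwise application of a continuous family of continuous linear maps. -/
def pointwiseApply (I : Type*) [TopologicalSpace I] [CompactSpace I]
    (E F : Type*) [NormedAddCommGroup E] [NormedSpace ℝ E] [NormedAddCommGroup F]
    [NormedSpace ℝ F] : C(I, E →L[ℝ] F) →L[ℝ] C(I, E) →L[ℝ] C(I, F) :=
  LinearMap.mkContinuous₂
    (LinearMap.mk₂ ℝ (fun (A : C(I, E →L[ℝ] F)) (h : C(I, E)) =>
        (⟨fun t => A t (h t), by fun_prop⟩ : C(I, F)))
      (by intros; ext; simp) (by intros; ext; simp) (by intros; ext; simp) (by intros; ext; simp))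
    1 (by
      intro A h
      rw [ContinuousMap.norm_le _ (by positivity)]
      intro t
      simp only [LinearMap.mk₂_apply, ContinuousMap.coe_mk, one_mul]
      exact (A t).le_of_opNorm_le_of_le (A.norm_coe_le_norm t) (h.norm_coe_le_norm t))

@[simp] theorem pointwiseApply_apply {E F : Type*} [NormedAddCommGroup E] [NormedSpace ℝ E]
    [NormedAddCommGroup F] [NormedSpace ℝ F] (A : C(I, E →L[ℝ] F)) (h : C(I, E)) (t : I) :
    pointwiseApply I E F A h t = A t (h t) := rfl

/-- The mean value inequality at each `t` bounds the remainder by `ε ‖h t‖`. Uniformity in `t` comes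
from the continuity of `γ ↦ f' ∘ γ` in the uniform norm. -/
theorem hasFDerivAt_superposition {E F : Type*} [NormedAddCommGroup E] [NormedSpace ℝ E]
    [NormedAddCommGroup F] [NormedSpace ℝ F] (f : C(E, F)) (f' : C(E, E →L[ℝ] F))
    (hf : ∀ x, HasFDerivAt f (f' x) x) (γ : C(I, E)) :
    HasFDerivAt (fun γ : C(I, E) => f.comp γ) (pointwiseApply I E F (f'.comp γ)) γ := by
  rw [hasFDerivAt_iff_isLittleO_nhds_zero, Asymptotics.isLittleO_iff]
  intro ε hε
  have hc : ContinuousAt (fun γ : C(I, E) => f'.comp γ) γ :=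
    (ContinuousMap.continuous_postcomp f').continuousAt
  obtain ⟨δ, hδ, hδ'⟩ :=
    (Metric.continuousAt_iff (f := fun γ : C(I, E) => f'.comp γ) (a := γ)).1 hc ε hε
  filter_upwards [Metric.ball_mem_nhds (0 : C(I, E)) hδ] with h hh
  rw [ContinuousMap.norm_le _ (by positivity)]
  intro t
  simp only [ContinuousMap.sub_apply, ContinuousMap.comp_apply, ContinuousMap.add_apply,
    pointwiseApply_apply]
  have key := (convex_ball (γ t) δ).norm_image_sub_le_of_norm_hasFDerivWithin_le'
    (f := f) (f' := f') (φ := f' (γ t)) (C := ε) (x := γ t) (y := γ t + h t)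
    (fun x _ => (hf x).hasFDerivWithinAt) ?_ (Metric.mem_ball_self hδ) ?_
  · rw [add_sub_cancel_left] at key
    exact key.trans (by gcongr; exact h.norm_coe_le_norm t)
  · intro y hy
    -- Shifting the whole path by the constant `y - γ t` turns closeness of two points into
    -- closeness of two paths, so that `hδ'` applies.
    have h1 : dist (γ + ContinuousMap.const I (y - γ t)) γ < δ := by
      rw [dist_eq_norm, add_sub_cancel_left, ContinuousMap.norm_lt_iff _ hδ]
      intro s
      simpa [dist_eq_norm] using hy
    have h2 := (ContinuousMap.dist_apply_le_dist t).trans (hδ' h1).le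
    simpa [dist_eq_norm] using h2
  · have := (h.norm_coe_le_norm t).trans_lt (mem_ball_zero_iff.1 hh)
    simpa [Metric.mem_ball, dist_eq_norm] using this

universe u

/-- Induction on the order: the derivative is `pointwiseApply` after superposition with `f'`, which
is one order less smooth. The induction replaces `F` by `E →L[ℝ] F`, hence the common universe. -/
theorem contDiff_superposition {E : Type u} [NormedAddCommGroup E] [NormedSpace ℝ E] (m : ℕ) :
    ∀ {F : Type u} [NormedAddCommGroup F] [NormedSpace ℝ F] (f : C(E, F)), ContDiff ℝ m f →
      ContDiff ℝ m (fun γ : C(I, E) => f.comp γ) := by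
  induction m with
  | zero =>
    intro F _ _ f _
    exact contDiff_zero.2 (ContinuousMap.continuous_postcomp f)
  | succ m ih =>
    intro F _ _ f hf
    have hf' := hf
    push_cast at hf' ⊢
    rw [contDiff_succ_iff_hasFDerivAt] at hf' ⊢
    obtain ⟨f', hf', hd⟩ := hf'
    exact ⟨_, (pointwiseApply I E F).contDiff.comp (ih ⟨f', hf'.continuous⟩ hf'),
      hasFDerivAt_superposition f ⟨f', hf'.continuous⟩ hd⟩

end Superposition

/-! ### The integration operator, and the smooth inverse function theorem -/

section Primitive

open MeasureTheory intervalIntegral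

variable {F : Type*} [NormedAddCommGroup F] [NormedSpace ℝ F]

/-- The primitive `t ↦ ∫ τ in 0..t, g τ` of a continuous function on the unit interval. -/
def primitive (F : Type*) [NormedAddCommGroup F] [NormedSpace ℝ F] :
    C(unitInterval, F) →L[ℝ] C(unitInterval, F) :=
  LinearMap.mkContinuous
    { toFun := fun g => ⟨fun t => ∫ τ in (0 : ℝ)..t, Set.IccExtend zero_le_one g τ, by
        have h : Continuous (Set.IccExtend (zero_le_one : (0 : ℝ) ≤ 1) g) :=
          g.continuous.Icc_extend'
        exact (intervalIntegral.continuous_primitive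
          (fun a b => h.intervalIntegrable a b) 0).comp continuous_subtype_val⟩
      map_add' := by
        intro f g
        ext t
        have h : ∀ g : C(unitInterval, F),
            Continuous (Set.IccExtend (zero_le_one : (0 : ℝ) ≤ 1) g) :=
          fun g => g.continuous.Icc_extend'
        exact intervalIntegral.integral_add ((h f).intervalIntegrable _ _)
          ((h g).intervalIntegrable _ _)
      map_smul' := by
        intro c g
        ext t
        exact intervalIntegral.integral_smul c _ }
    1 (by
      intro g
      rw [ContinuousMap.norm_le _ (by positivity)]
      intro t
      refine (intervalIntegral.norm_integral_le_of_norm_le_const (C := ‖g‖) ?_).trans ?_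
      · intro τ _
        exact g.norm_coe_le_norm _
      · rw [sub_zero, abs_of_nonneg t.2.1, one_mul]
        exact mul_le_of_le_one_right (norm_nonneg _) t.2.2)

theorem hasDerivAt_primitive [CompleteSpace F] (g : C(unitInterval, F)) (t : ℝ) :
    HasDerivAt (fun t : ℝ => ∫ τ in (0 : ℝ)..t, Set.IccExtend zero_le_one g τ)
      (Set.IccExtend zero_le_one g t) t := by
  have h : Continuous (Set.IccExtend (zero_le_one : (0 : ℝ) ≤ 1) g) := g.continuous.Icc_extend'
  exact intervalIntegral.integral_hasDerivAt_right (h.intervalIntegrable _ _)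
    h.aestronglyMeasurable.stronglyMeasurableAtFilter h.continuousAt

end Primitive

/-- The inverse function theorem, in the form of a local diffeomorphism on whose domain a given
local property holds. -/
theorem exists_smooth_openPartialHomeomorph {E F : Type*} [NormedAddCommGroup E] [NormedSpace ℝ E]
    [CompleteSpace E] [NormedAddCommGroup F] [NormedSpace ℝ F] {f : E → F} {a : E} {f' : E ≃L[ℝ] F}
    (hf : ∀ᶠ x in 𝓝 a, ContDiffAt ℝ ∞ f x) (hf' : HasFDerivAt f (f' : E →L[ℝ] F) a)
    {p : E → Prop} (hp : ∀ᶠ x in 𝓝 a, p x) :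
    ∃ φ : OpenPartialHomeomorph E F, ⇑φ = f ∧ a ∈ φ.source ∧
      (∀ x ∈ φ.source, ContDiffAt ℝ ∞ f x ∧ p x) ∧ ∀ y ∈ φ.target, ContDiffAt ℝ ∞ φ.symm y := by
  have hfa : ContDiffAt ℝ ∞ f a := hf.self_of_nhds
  -- Invertibility of the derivative is an open condition. Shrinking the domain to where it holds
  -- makes the inverse smooth on the whole target, not only at `f a`.
  have hinv : ∀ᶠ x in 𝓝 a, fderiv ℝ f x ∈ Set.range ((↑) : (E ≃L[ℝ] F) → E →L[ℝ] F) := by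
    have hc : ContinuousAt (fderiv ℝ f) a :=
      (hfa.fderiv_right (m := 0) (by simp)).continuousAt
    refine hc.eventually_mem ((ContinuousLinearEquiv.isOpen).mem_nhds ?_)
    rw [hf'.fderiv]
    exact ⟨f', rfl⟩
  obtain ⟨U, hU, hUo, haU⟩ := eventually_nhds_iff.1 (hf.and (hp.and hinv))
  let φ := (hfa.toOpenPartialHomeomorph f hf' (by simp)).restrOpen U hUo
  have hsrc : ∀ x ∈ φ.source, x ∈ U := fun x hx => hx.2
  refine ⟨φ, rfl, ⟨hfa.mem_toOpenPartialHomeomorph_source hf' (by simp), haU⟩,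
    fun x hx => ⟨(hU x (hsrc x hx)).1, (hU x (hsrc x hx)).2.1⟩, fun y hy => ?_⟩
  have hx := hU _ (hsrc _ (φ.map_target hy))
  obtain ⟨A, hA⟩ := hx.2.2
  refine φ.contDiffAt_symm (f₀' := A) hy ?_ hx.1
  rw [hA]
  exact (hx.1.differentiableAt (by simp)).hasFDerivAt

/-! ### Differential equations along rays, with smooth dependence on the data -/

section RayFlow

universe u

variable {X Y : Type u} [NormedAddCommGroup X] [NormedSpace ℝ X] [NormedAddCommGroup Y]
  [NormedSpace ℝ Y]

/-- The path `t ↦ (t x, (x, γ t))`, as a linear function of `(x, γ)`. -/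
def rayPath (X Y : Type*) [NormedAddCommGroup X] [NormedSpace ℝ X] [NormedAddCommGroup Y]
    [NormedSpace ℝ Y] : X × C(unitInterval, Y) →L[ℝ] C(unitInterval, X × X × Y) :=
  LinearMap.mkContinuous
    { toFun := fun p => ⟨fun t => ((t : ℝ) • p.1, p.1, p.2 t), by fun_prop⟩
      map_add' := by intros; ext <;> simp
      map_smul' := by intro c p; ext <;> simp [smul_comm c] }
    1 (by
      intro p
      rw [ContinuousMap.norm_le _ (by positivity), one_mul]
      intro t
      simp only [LinearMap.coe_mk, AddHom.coe_mk, ContinuousMap.coe_mk]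
      have h1 : ‖p.1‖ ≤ ‖p‖ := norm_fst_le p
      have h2 : ‖p.2 t‖ ≤ ‖p‖ := (p.2.norm_coe_le_norm t).trans (norm_snd_le p)
      refine max_le ?_ (max_le h1 h2)
      rw [norm_smul, Real.norm_of_nonneg t.2.1]
      exact (mul_le_of_le_one_left (norm_nonneg _) t.2.2).trans h1)

@[simp] theorem rayPath_apply (p : X × C(unitInterval, Y)) (t : unitInterval) :
    rayPath X Y p t = ((t : ℝ) • p.1, p.1, p.2 t) := rfl

/-- The function `(u, x, y) ↦ f (u, y) x`. -/
def rayField (f : C(X × Y, X →L[ℝ] Y)) : C(X × X × Y, Y) :=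
  ⟨fun a => f (a.1, a.2.2) a.2.1, by fun_prop⟩

@[simp] theorem rayField_apply (f : C(X × Y, X →L[ℝ] Y)) (a : X × X × Y) :
    rayField f a = f (a.1, a.2.2) a.2.1 := rfl

/-- The solutions of `γ' (t) = f (t x, γ t) x`, `γ 0 = y`, on the unit interval exist for small `x`
and depend smoothly on `(x, y)`. -/
theorem exists_rayFlow [CompleteSpace X] [CompleteSpace Y] (f : C(X × Y, X →L[ℝ] Y))
    (hf : ContDiff ℝ ∞ f) (y₀ : Y) :
    ∃ Γ : X × Y → C(unitInterval, Y), (∀ᶠ p in 𝓝 ((0 : X), y₀), ContDiffAt ℝ ∞ Γ p) ∧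
      Γ (0, y₀) = ContinuousMap.const _ y₀ ∧
      ∀ᶠ p in 𝓝 ((0 : X), y₀), Γ p = ContinuousMap.const _ p.2 +
        primitive Y ((rayField f).comp (rayPath X Y (p.1, Γ p))) := by
  let C := C(unitInterval, Y)
  let cst : Y →L[ℝ] C := ContinuousLinearMap.const ℝ unitInterval
  let H : X × C → C := fun p => primitive Y ((rayField f).comp (rayPath X Y p))
  have hfield : ContDiff ℝ ∞ (rayField f) := by
    have : (rayField f : X × X × Y → Y) = fun a => f (a.1, a.2.2) a.2.1 := rfl
    rw [this]
    fun_prop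
  have hH : ContDiff ℝ ∞ H := by
    have h1 : ContDiff ℝ ∞ (fun γ : C(unitInterval, X × X × Y) => (rayField f).comp γ) :=
      contDiff_infty.2 fun m => contDiff_superposition m _ (hfield.of_le (by exact_mod_cast le_top))
    exact (primitive Y).contDiff.comp (h1.comp (rayPath X Y).contDiff)
  -- The zeros of `G` are the solutions of the integral equation. Inverting `(id, G)` is the
  -- implicit function theorem for them.
  let G : (X × Y) × C → C := fun p => p.2 - cst p.1.2 - H (p.1.1, p.2)
  have hG : ContDiff ℝ ∞ G := by fun_prop
  let Φ : (X × Y) × C → (X × Y) × C := fun p => (p.1, G p)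
  have hΦ : ContDiff ℝ ∞ Φ := by fun_prop
  let a : (X × Y) × C := ((0, y₀), cst y₀)
  -- At `x = 0` the equation is `γ = const y`, so the partial derivative of `G` in `γ` is the
  -- identity. Solutions reach time 1 because `x` is small, not the time.
  have hH0 : ∀ γ : C, H (0, γ) = 0 := by
    intro γ
    have : (rayField f).comp (rayPath X Y (0, γ)) = 0 := by ext t; simp
    simp only [H, this, map_zero]
  have hGd : HasFDerivAt G (fderiv ℝ G a) a := (hG.differentiable (by simp) a).hasFDerivAt
  have hGinr : ∀ κ : C, fderiv ℝ G a (0, κ) = κ := by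
    intro κ
    have h1 : HasFDerivAt (fun γ : C => G ((0, y₀), γ))
        ((fderiv ℝ G a).comp (ContinuousLinearMap.inr ℝ (X × Y) C)) (cst y₀) :=
      HasFDerivAt.comp (cst y₀) hGd (hasFDerivAt_prodMk_right (0, y₀) (cst y₀))
    have h2 : HasFDerivAt (fun γ : C => G ((0, y₀), γ)) (ContinuousLinearMap.id ℝ C) (cst y₀) := by
      have : (fun γ : C => G ((0, y₀), γ)) = fun γ => γ - cst y₀ := by
        ext1 γ
        simp only [G, hH0, sub_zero]
      rw [this]
      exact (hasFDerivAt_id _).sub_const _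
    have := congrArg (fun A => A κ) (h1.unique h2)
    simpa using this
  let e : ((X × Y) × C) ≃L[ℝ] ((X × Y) × C) :=
    (ContinuousLinearEquiv.refl ℝ (X × Y)).skewProd (ContinuousLinearEquiv.refl ℝ C)
      ((fderiv ℝ G a).comp (ContinuousLinearMap.inl ℝ (X × Y) C))
  have he : HasFDerivAt Φ (e : ((X × Y) × C) →L[ℝ] ((X × Y) × C)) a := by
    have h := hasFDerivAt_fst.prodMk hGd
    refine h.congr_fderiv (ContinuousLinearMap.ext fun p => ?_)
    have hp : p = (p.1, 0) + (0, p.2) := by ext <;> simp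
    refine Prod.ext rfl ?_
    change fderiv ℝ G a p = p.2 + fderiv ℝ G a (p.1, 0)
    conv_lhs => rw [hp, map_add, hGinr]
    exact add_comm _ _
  obtain ⟨φ, hφ, haφ, -, hs⟩ := exists_smooth_openPartialHomeomorph (p := fun _ => True)
    (Filter.Eventually.of_forall fun x => hΦ.contDiffAt) he (by simp)
  have hΦa : Φ a = ((0, y₀), 0) := by
    simp only [Φ, G, a, hH0, sub_self]
  have hc : ContinuousAt (fun p : X × Y => (p, (0 : C))) (0, y₀) := by fun_prop
  have hev : ∀ᶠ p in 𝓝 ((0 : X), y₀), (p, (0 : C)) ∈ φ.target := by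
    refine hc.eventually_mem (φ.open_target.mem_nhds ?_)
    rw [← hΦa, ← hφ]
    exact φ.map_source haφ
  refine ⟨fun p => (φ.symm (p, 0)).2, ?_, ?_, ?_⟩
  · filter_upwards [hev] with p hp
    exact contDiffAt_snd.comp p (ContDiffAt.comp p (hs _ hp) (by fun_prop))
  · have : φ.symm ((0, y₀), 0) = a := by rw [← hΦa, ← hφ, φ.left_inv haφ]
    simp only [this]
    rfl
  · filter_upwards [hev] with p hp
    have h := φ.right_inv hp
    rw [hφ] at h
    have h1 : (φ.symm (p, 0)).1 = p := congrArg Prod.fst h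
    have h2 : G (φ.symm (p, 0)) = 0 := congrArg Prod.snd h
    simp only [G, h1, sub_eq_zero] at h2
    rw [sub_eq_iff_eq_add] at h2
    exact h2.trans (add_comm _ _)

end RayFlow
/-- A function that is smooth near a point agrees near that point with a globally smooth one. -/
theorem exists_contDiff_eventuallyEq {E F : Type*} [NormedAddCommGroup E] [NormedSpace ℝ E]
    [FiniteDimensional ℝ E] [NormedAddCommGroup F] [NormedSpace ℝ F] {f : E → F} {a : E}
    (hf : ∀ᶠ x in 𝓝 a, ContDiffAt ℝ ∞ f x) : ∃ g : E → F, ContDiff ℝ ∞ g ∧ g =ᶠ[𝓝 a] f := by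
  obtain ⟨r, hr, hball⟩ := Metric.eventually_nhds_iff_ball.1 hf
  let b : ContDiffBump a := ⟨r / 4, r / 2, by positivity, by linarith⟩
  refine ⟨fun x => b x • f x, contDiff_iff_contDiffAt.2 fun x => ?_, ?_⟩
  · by_cases hx : x ∈ Metric.ball a r
    · exact b.contDiffAt.smul (hball x hx)
    · have hx' : x ∈ (Metric.closedBall a (r / 2))ᶜ := fun h =>
        hx (Metric.closedBall_subset_ball (by linarith) h)
      have : (fun x => b x • f x) =ᶠ[𝓝 x] fun _ => 0 := by
        filter_upwards [Metric.isClosed_closedBall.isOpen_compl.mem_nhds hx'] with y hy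
        rw [Set.mem_compl_iff, Metric.mem_closedBall, not_le] at hy
        rw [b.zero_of_le_dist hy.le, zero_smul]
      exact contDiffAt_const.congr_of_eventuallyEq this
  · filter_upwards [b.eventuallyEq_one] with x hx
    simp only [hx, Pi.one_apply, one_smul]

/-! ### Total differential equations under the integrability condition -/

section TotalDifferential

universe u

variable {X Y : Type u} [NormedAddCommGroup X] [NormedSpace ℝ X] [NormedAddCommGroup Y]
  [NormedSpace ℝ Y]

/-- If `c' = f (t x, c) x` and `K` solves the linearised equation in the direction `v`, where `f`
satisfies the integrability condition along `c`, then `K (1) = f (x, c (1)) v`. -/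
theorem linearised_ray_eq (f : X × Y → X →L[ℝ] Y) (hf : ContDiff ℝ ∞ f) (x v : X) (c K : ℝ → Y)
    (hint : ∀ t ∈ Set.Icc (0 : ℝ) 1, fderiv ℝ f (t • x, c t) (v, f (t • x, c t) v) x =
      fderiv ℝ f (t • x, c t) (x, f (t • x, c t) x) v)
    (hc : ∀ t ∈ Set.Icc (0 : ℝ) 1, HasDerivAt c (f (t • x, c t) x) t)
    (hK : ∀ t ∈ Set.Icc (0 : ℝ) 1, HasDerivAt K
      (fderiv ℝ f (t • x, c t) (t • v, K t) x + f (t • x, c t) v) t)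
    (hK0 : K 0 = 0) : K 1 = f (x, c 1) v := by
  have hcc : ContinuousOn c (Set.Icc 0 1) := fun t ht => (hc t ht).continuousAt.continuousWithinAt
  have hfd : Continuous (fderiv ℝ f) := hf.continuous_fderiv (by simp)
  have hA : ContinuousOn (fun t : ℝ => fderiv ℝ f (t • x, c t)) (Set.Icc 0 1) :=
    hfd.comp_continuousOn (ContinuousOn.prodMk (by fun_prop) hcc)
  obtain ⟨B, hB⟩ := isCompact_Icc.exists_bound_of_continuousOn
    (f := fun t : ℝ => fderiv ℝ f (t • x, c t)) hA
  -- The expected solution is `K t = t f (t x, c t) v`. By integrability the difference `h` solves a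
  -- homogeneous linear equation with `h 0 = 0`, so Grönwall's inequality gives `h = 0`.
  let h : ℝ → Y := fun t => K t - t • f (t • x, c t) v
  have hpath : ∀ t ∈ Set.Icc (0 : ℝ) 1, HasDerivAt (fun t : ℝ => (t • x, c t))
      (x, f (t • x, c t) x) t := by
    intro t ht
    have := (hasDerivAt_id t).smul_const x
    simp only [id, one_smul] at this
    exact this.prodMk (hc t ht)
  have hh : ∀ t ∈ Set.Icc (0 : ℝ) 1, HasDerivAt h (fderiv ℝ f (t • x, c t) (0, h t) x) t := by
    intro t ht
    have hfp : HasDerivAt (fun t : ℝ => f (t • x, c t))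
        (fderiv ℝ f (t • x, c t) (x, f (t • x, c t) x)) t :=
      HasFDerivAt.comp_hasDerivAt t (hf.differentiable (by simp) _).hasFDerivAt (hpath t ht)
    have hfv : HasDerivAt (fun t : ℝ => f (t • x, c t) v)
        (fderiv ℝ f (t • x, c t) (x, f (t • x, c t) x) v) t := by
      simpa using hfp.clm_apply (hasDerivAt_const t v)
    have hd := (hK t ht).sub ((hasDerivAt_id t).smul hfv)
    refine hd.congr_deriv ?_
    rw [← hint t ht]
    have e1 : ((0 : X), h t) = (t • v, K t) - t • (v, f (t • x, c t) v) := by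
      simp [h]
    rw [e1, map_sub, map_smul]
    simp only [id, one_smul, sub_apply, smul_apply]
    abel
  have hz := eq_zero_of_abs_deriv_le_mul_abs_self_of_eq_zero_right (f := h) (K := B * ‖x‖)
    (fun t ht => (hh t ht).continuousAt.continuousWithinAt)
    (fun t ht => (hh t (Set.Ico_subset_Icc_self ht)).hasDerivWithinAt) (by simp [h, hK0])
    (fun t ht => by
      have h1 := (fderiv ℝ f (t • x, c t) (0, h t)).le_opNorm x
      have h2 := (fderiv ℝ f (t • x, c t)).le_opNorm (0, h t)
      have h3 : ‖((0 : X), h t)‖ = ‖h t‖ := by simp [Prod.norm_def]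
      rw [h3] at h2
      have h4 := hB t (Set.Ico_subset_Icc_self ht)
      calc _ ≤ _ := h1
        _ ≤ (B * ‖h t‖) * ‖x‖ := by gcongr; exact h2.trans (by gcongr)
        _ = _ := by ring) 1 (by simp)
  simpa [h, sub_eq_zero] using hz

/-- A total differential equation `D y = f (x, y)` whose right-hand side satisfies the integrability
condition has local solutions depending smoothly on the initial value at `x = 0`. -/
theorem exists_total_solution [FiniteDimensional ℝ X] [FiniteDimensional ℝ Y] (f : X × Y → X →L[ℝ] Y) (y₀ : Y)
    (hf : ∀ᶠ p in 𝓝 ((0 : X), y₀), ContDiffAt ℝ ∞ f p)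
    (hint : ∀ᶠ p in 𝓝 ((0 : X), y₀), ∀ v w,
      fderiv ℝ f p (v, f p v) w = fderiv ℝ f p (w, f p w) v) :
    ∃ Z : X × Y → Y, (∀ᶠ p in 𝓝 ((0 : X), y₀), ContDiffAt ℝ ∞ Z p) ∧
      (∀ᶠ p in 𝓝 ((0 : X), y₀), p.1 = 0 → Z p = p.2) ∧ Z (0, y₀) = y₀ ∧
      ∀ᶠ p in 𝓝 ((0 : X), y₀), ∀ v, fderiv ℝ Z p (v, 0) = f (p.1, Z p) v := by
  -- The ray flow needs a globally smooth field. `g` agrees with `f` on a ball that contains the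
  -- paths used below (`hnear`).
  obtain ⟨g, hg, hgf⟩ := exists_contDiff_eventuallyEq hf
  let gc : C(X × Y, X →L[ℝ] Y) := ⟨g, hg.continuous⟩
  obtain ⟨Γ, hΓs, hΓ0, hΓ⟩ := exists_rayFlow gc hg y₀
  have hgood : ∀ᶠ p in 𝓝 ((0 : X), y₀), g p = f p ∧ ∀ v w,
      fderiv ℝ g p (v, g p v) w = fderiv ℝ g p (w, g p w) v := by
    filter_upwards [hgf, hgf.fderiv (𝕜 := ℝ), hint] with p h1 h2 h3
    rw [h1, h2]
    exact ⟨rfl, h3⟩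
  obtain ⟨ε, hε, hεgood⟩ := Metric.eventually_nhds_iff_ball.1 hgood
  have hnear : ∀ᶠ p in 𝓝 ((0 : X), y₀), ∀ t : unitInterval,
      ((t : ℝ) • p.1, Γ p t) ∈ Metric.ball ((0 : X), y₀) ε := by
    have hc : ContinuousAt Γ (0, y₀) := hΓs.self_of_nhds.continuousAt
    filter_upwards [hc.eventually_mem (Metric.ball_mem_nhds _ hε),
      Metric.ball_mem_nhds _ hε] with p hp hp' t
    rw [hΓ0] at hp
    rw [Metric.mem_ball, Prod.dist_eq, max_lt_iff] at hp' ⊢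
    constructor
    · rw [dist_zero_right] at hp' ⊢
      rw [norm_smul, Real.norm_of_nonneg t.2.1]
      exact (mul_le_of_le_one_left (norm_nonneg _) t.2.2).trans_lt hp'.1
    · exact (ContinuousMap.dist_apply_le_dist (f := Γ p) (g := ContinuousMap.const _ y₀)
        t).trans_lt hp
  let one : unitInterval := 1
  refine ⟨fun p => Γ p one, ?_, ?_, ?_, ?_⟩
  · filter_upwards [hΓs] with p hp
    exact ((ContinuousMap.evalCLM ℝ one).contDiff.contDiffAt (x := Γ p)).comp p hp
  · filter_upwards [hΓ] with p hp h0
    have : (rayField gc).comp (rayPath X Y (p.1, Γ p)) = 0 := by ext t; simp [h0]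
    rw [this, map_zero, add_zero] at hp
    simp [hp]
  · simp [hΓ0]
  · filter_upwards [hΓs, hΓ.eventually_nhds, hnear] with p hs heq hn v
    have hΓd : HasFDerivAt Γ (fderiv ℝ Γ p) p := (hs.differentiableAt (by simp)).hasFDerivAt
    set κ : C(unitInterval, Y) := fderiv ℝ Γ p (v, 0) with hκ
    have hgd : ∀ q, HasFDerivAt g (fderiv ℝ g q) q := fun q =>
      (hg.differentiable (by simp) q).hasFDerivAt
    -- The derivative of `rayField gc`: the first summand comes from its linear argument, the second
    -- from the argument of `g`.
    let D : X × X × Y → X × X × Y →L[ℝ] Y := fun a =>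
      ((gc (a.1, a.2.2)).comp ((ContinuousLinearMap.fst ℝ X Y).comp
        (ContinuousLinearMap.snd ℝ X (X × Y)))) +
      (((fderiv ℝ g (a.1, a.2.2)).comp ((ContinuousLinearMap.fst ℝ X (X × Y)).prod
        ((ContinuousLinearMap.snd ℝ X Y).comp (ContinuousLinearMap.snd ℝ X (X × Y))))).flip a.2.1)
    have hfd : Continuous (fderiv ℝ g) := hg.continuous_fderiv (by simp)
    have hD : Continuous D := by
      have : Continuous fun a : X × X × Y => gc (a.1, a.2.2) := by fun_prop
      have h2 : Continuous fun a : X × X × Y => fderiv ℝ g (a.1, a.2.2) := by fun_prop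
      have h3 : ∀ T : X × X × Y → X × X × Y →L[ℝ] X →L[ℝ] Y, Continuous T →
          Continuous fun a => (T a).flip a.2.1 := by
        intro T hT
        have := (ContinuousLinearMap.flipₗᵢ ℝ (X × X × Y) X Y).continuous.comp hT
        exact this.clm_apply (by fun_prop)
      exact (this.clm_comp continuous_const).add (h3 _ (h2.clm_comp continuous_const))
    have hrf : ∀ a, HasFDerivAt (rayField gc) (D a) a := by
      intro a
      have h1 := ((ContinuousLinearMap.fst ℝ X (X × Y)).prod
        ((ContinuousLinearMap.snd ℝ X Y).comp
          (ContinuousLinearMap.snd ℝ X (X × Y)))).hasFDerivAt (x := a)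
      have h2 := HasFDerivAt.comp a (hgd (a.1, a.2.2)) h1
      have h3 := ((ContinuousLinearMap.fst ℝ X Y).comp
        (ContinuousLinearMap.snd ℝ X (X × Y))).hasFDerivAt (x := a)
      exact h2.clm_apply h3
    have hsup := hasFDerivAt_superposition (rayField gc) ⟨D, hD⟩ hrf (rayPath X Y (p.1, Γ p))
    have hrp : HasFDerivAt (fun p => rayPath X Y (p.1, Γ p))
        ((rayPath X Y).comp ((ContinuousLinearMap.fst ℝ X Y).prod (fderiv ℝ Γ p))) p :=
      (rayPath X Y).hasFDerivAt.comp p (hasFDerivAt_fst.prodMk hΓd)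
    have htot := ((ContinuousLinearMap.const ℝ unitInterval).hasFDerivAt.comp p
      (hasFDerivAt_snd (𝕜 := ℝ) (E := X) (F := Y))).add
      ((primitive Y).hasFDerivAt.comp p (HasFDerivAt.comp p hsup hrp))
    have hun := hΓd.unique (htot.congr_of_eventuallyEq heq)
    -- Differentiating the integral equation shows that `κ`, the variation of the path in the
    -- direction `(v, 0)`, solves the linearised integral equation.
    have hκeq : κ = primitive Y (pointwiseApply unitInterval _ _
        ((⟨D, hD⟩ : C(X × X × Y, X × X × Y →L[ℝ] Y)).comp (rayPath X Y (p.1, Γ p)))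
        (rayPath X Y (v, κ))) := by
      have := congrArg (fun A => A (v, (0 : Y))) hun
      refine this.trans ?_
      simp only [ContinuousLinearMap.comp_apply, add_apply, ContinuousLinearMap.prod_apply,
        ContinuousLinearMap.coe_fst', ContinuousLinearMap.coe_snd', map_zero, zero_add, ← hκ]
    have heqp := heq.self_of_nhds
    let g1 : C(unitInterval, Y) := (rayField gc).comp (rayPath X Y (p.1, Γ p))
    let g2 : C(unitInterval, Y) := pointwiseApply unitInterval _ _
        ((⟨D, hD⟩ : C(X × X × Y, X × X × Y →L[ℝ] Y)).comp (rayPath X Y (p.1, Γ p)))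
        (rayPath X Y (v, κ))
    -- Integrating the extended integrands defines both paths on all of `ℝ`, which provides
    -- two-sided derivatives at the end points 0 and 1.
    let c : ℝ → Y := fun t => p.2 + ∫ τ in (0 : ℝ)..t, Set.IccExtend zero_le_one g1 τ
    let K : ℝ → Y := fun t => ∫ τ in (0 : ℝ)..t, Set.IccExtend zero_le_one g2 τ
    have hcΓ : ∀ (t : ℝ) (ht : t ∈ Set.Icc (0 : ℝ) 1), c t = Γ p ⟨t, ht⟩ := by
      intro t ht
      rw [heqp]
      rfl
    have hKκ : ∀ (t : ℝ) (ht : t ∈ Set.Icc (0 : ℝ) 1), K t = κ ⟨t, ht⟩ := by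
      intro t ht
      rw [hκeq]
      rfl
    have hmem : ∀ t ∈ Set.Icc (0 : ℝ) 1, (t • p.1, c t) ∈ Metric.ball ((0 : X), y₀) ε := by
      intro t ht
      rw [hcΓ t ht]
      exact hn ⟨t, ht⟩
    have key := linearised_ray_eq g hg p.1 v c K
      (fun t ht => (hεgood _ (hmem t ht)).2 v p.1)
      (fun t ht => by
        refine ((hasDerivAt_primitive g1 t).const_add p.2).congr_deriv ?_
        rw [Set.IccExtend_of_mem _ _ ht, hcΓ t ht]
        rfl)
      (fun t ht => by
        refine (hasDerivAt_primitive g2 t).congr_deriv ?_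
        rw [Set.IccExtend_of_mem _ _ ht, hcΓ t ht, hKκ t ht, add_comm]
        rfl)
      (by simp [K])
    have h1 : (1 : ℝ) ∈ Set.Icc (0 : ℝ) 1 := by simp
    have hev : fderiv ℝ (fun p => Γ p one) p (v, 0) = κ one := by
      have := ((ContinuousMap.evalCLM ℝ one).hasFDerivAt (x := Γ p)).comp p hΓd
      exact congrArg (fun A => A (v, (0 : Y))) this.fderiv
    rw [hev]
    have h2 := hmem 1 h1
    rw [hKκ 1 h1, hcΓ 1 h1] at key
    rw [one_smul, hcΓ 1 h1] at h2
    rw [(hεgood _ h2).1] at key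
    exact key

end TotalDifferential
-- Frobenius' theorem
section Frobenius

universe u

/-- First integrals of the distribution of graphs of the linear maps `f (x, y)`. -/
theorem exists_firstIntegrals_of_graph {X Y : Type u} [NormedAddCommGroup X] [NormedSpace ℝ X]
    [FiniteDimensional ℝ X] [NormedAddCommGroup Y] [NormedSpace ℝ Y] [FiniteDimensional ℝ Y]
    (f : X × Y → X →L[ℝ] Y) (y₀ : Y)
    (hf : ∀ᶠ p in 𝓝 ((0 : X), y₀), ContDiffAt ℝ ∞ f p)
    (hint : ∀ᶠ p in 𝓝 ((0 : X), y₀), ∀ v w,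
      fderiv ℝ f p (v, f p v) w = fderiv ℝ f p (w, f p w) v) :
    ∃ q : X × Y → Y, (∀ᶠ p in 𝓝 ((0 : X), y₀), ContDiffAt ℝ ∞ q p) ∧
      ∀ᶠ p in 𝓝 ((0 : X), y₀), Function.Surjective (fderiv ℝ q p) ∧
        ∀ v w, fderiv ℝ q p (v, w) = 0 ↔ w = f p v := by
  obtain ⟨Z, hZ, hZ0, hZa, hZd⟩ := exists_total_solution f y₀ hf hint
  let a : X × Y := (0, y₀)
  -- `Ψ` straightens the leaves: the first integral reads off the value at `x = 0` of the leaf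
  -- through a given point.
  let Ψ : X × Y → X × Y := fun p => (p.1, Z p)
  have hΨ : ∀ᶠ p in 𝓝 a, ContDiffAt ℝ ∞ Ψ p := by
    filter_upwards [hZ] with p hp
    exact contDiffAt_fst.prodMk hp
  have hΨa : Ψ a = a := Prod.ext rfl hZa
  have hΨd : ∀ p, ContDiffAt ℝ ∞ Z p →
      HasFDerivAt Ψ ((ContinuousLinearMap.fst ℝ X Y).prod (fderiv ℝ Z p)) p := fun p hp =>
    hasFDerivAt_fst.prodMk (hp.differentiableAt (by simp)).hasFDerivAt
  have hZinr : ∀ w, fderiv ℝ Z a (0, w) = w := by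
    intro w
    have h1 : HasFDerivAt (fun y : Y => Z (0, y))
        ((fderiv ℝ Z a).comp (ContinuousLinearMap.inr ℝ X Y)) y₀ :=
      HasFDerivAt.comp y₀ (hZ.self_of_nhds.differentiableAt (by simp)).hasFDerivAt
        (hasFDerivAt_prodMk_right 0 y₀)
    have h2 : HasFDerivAt (fun y : Y => Z (0, y)) (ContinuousLinearMap.id ℝ Y) y₀ := by
      refine (hasFDerivAt_id y₀).congr_of_eventuallyEq ?_
      have hc : ContinuousAt (fun y : Y => ((0 : X), y)) y₀ := by fun_prop
      filter_upwards [hc.eventually hZ0] with y hy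
      exact hy rfl
    simpa using congrArg (fun A => A w) (h1.unique h2)
  let e : (X × Y) ≃L[ℝ] (X × Y) :=
    (ContinuousLinearEquiv.refl ℝ X).skewProd (ContinuousLinearEquiv.refl ℝ Y)
      ((fderiv ℝ Z a).comp (ContinuousLinearMap.inl ℝ X Y))
  have he : HasFDerivAt Ψ (e : (X × Y) →L[ℝ] (X × Y)) a := by
    refine (hΨd a hZ.self_of_nhds).congr_fderiv (ContinuousLinearMap.ext fun p => ?_)
    have hp : p = (p.1, 0) + (0, p.2) := by ext <;> simp
    refine Prod.ext rfl ?_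
    change fderiv ℝ Z a p = p.2 + fderiv ℝ Z a (p.1, 0)
    conv_lhs => rw [hp, map_add, hZinr]
    exact add_comm _ _
  obtain ⟨φ, hφ, haφ, hsrc, hs⟩ := exists_smooth_openPartialHomeomorph
    (p := fun p => ContDiffAt ℝ ∞ Z p ∧ ∀ v, fderiv ℝ Z p (v, 0) = f (p.1, Z p) v)
    hΨ he (hZ.and hZd)
  have haT : a ∈ φ.target := by
    have := φ.map_source haφ
    rwa [hφ, hΨa] at this
  have hT : ∀ᶠ p in 𝓝 a, p ∈ φ.target := φ.open_target.mem_nhds haT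
  refine ⟨fun p => (φ.symm p).2, ?_, ?_⟩
  · filter_upwards [hT] with p hp
    exact contDiffAt_snd.comp p (hs p hp)
  · filter_upwards [hT] with p hp
    set q : X × Y → Y := fun p => (φ.symm p).2
    have hqd : HasFDerivAt q (fderiv ℝ q p) p :=
      ((contDiffAt_snd.comp p (hs p hp)).differentiableAt (by simp)).hasFDerivAt
    have hp' := φ.map_target hp
    have hpp : Ψ (φ.symm p) = p := by rw [← hφ]; exact φ.right_inv hp
    obtain ⟨-, hsm, hder⟩ := hsrc _ hp'
    have hcomp : HasFDerivAt (fun x => q (Ψ x)) ((fderiv ℝ q p).comp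
        ((ContinuousLinearMap.fst ℝ X Y).prod (fderiv ℝ Z (φ.symm p)))) (φ.symm p) := by
      have h := hΨd _ hsm
      exact HasFDerivAt.comp (g := q) (φ.symm p) (by rw [hpp]; exact hqd) h
    have hsnd : HasFDerivAt (fun x => q (Ψ x)) (ContinuousLinearMap.snd ℝ X Y) (φ.symm p) := by
      refine hasFDerivAt_snd.congr_of_eventuallyEq ?_
      filter_upwards [φ.open_source.mem_nhds hp'] with x hx
      simp only [q, ← hφ, φ.left_inv hx]
    have key : ∀ u : X × Y, fderiv ℝ q p (u.1, fderiv ℝ Z (φ.symm p) u) = u.2 := fun u => by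
      simpa using congrArg (fun A => A u) (hcomp.unique hsnd)
    have hker : ∀ v, fderiv ℝ q p (v, f p v) = 0 := fun v => by
      have := key (v, 0)
      rw [hder] at this
      have h2 : ((φ.symm p).1, Z (φ.symm p)) = p := hpp
      rwa [h2] at this
    have hsurj : Function.Surjective (fderiv ℝ q p) := fun w => ⟨_, key (0, w)⟩
    have hsplit : ∀ v w, fderiv ℝ q p (v, w) = fderiv ℝ q p (0, w - f p v) := fun v w => by
      have : (v, w) = (v, f p v) + (0, w - f p v) := by simp
      rw [this, map_add, hker, zero_add]
    -- The leaf directions are killed, so vertical vectors alone reach all of `Y`. The vertical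
    -- derivative is a surjective endomorphism of `Y`, hence injective.
    have hsurj' : Function.Surjective
        ((fderiv ℝ q p).comp (ContinuousLinearMap.inr ℝ X Y)).toLinearMap := fun w => by
      obtain ⟨u, hu⟩ := hsurj w
      exact ⟨u.2 - f p u.1, by rw [← hu]; exact (hsplit u.1 u.2).symm⟩
    have hinj := LinearMap.injective_iff_surjective.2 hsurj'
    refine ⟨hsurj, fun v w => ⟨fun h => ?_, fun h => by rw [h, hker]⟩⟩
    rw [hsplit] at h
    exact sub_eq_zero.1 (hinj (h.trans (map_zero _).symm))

/-- A surjective linear map becomes the second projection in suitable linear coordinates. -/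
theorem exists_equiv_prod_of_surjective {E Y : Type*} [NormedAddCommGroup E] [NormedSpace ℝ E]
    [FiniteDimensional ℝ E] [NormedAddCommGroup Y] [NormedSpace ℝ Y] [FiniteDimensional ℝ Y]
    (θ : E →L[ℝ] Y) (hθ : Function.Surjective θ) :
    ∃ Λ : ((Fin (Module.finrank ℝ (LinearMap.ker θ.toLinearMap)) → ℝ) × Y) ≃L[ℝ] E,
      ∀ p, θ (Λ p) = p.2 := by
  obtain ⟨J, hJ⟩ := θ.toLinearMap.exists_rightInverse_of_surjective (LinearMap.range_eq_top.2 hθ)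
  have hJ' : ∀ y, θ (J y) = y := fun y => congrArg (fun A => A y) hJ
  let b := (Module.finBasis ℝ (LinearMap.ker θ.toLinearMap)).equivFun.symm
  let Λ := LinearMap.coprod ((LinearMap.ker θ.toLinearMap).subtype ∘ₗ b.toLinearMap) J
  have hb : ∀ p, θ (b p : E) = 0 := fun p => (b p).2
  have hΛ : ∀ p, θ (Λ p) = p.2 := by
    intro p
    simp [Λ, hJ', hb]
  have hbij : Function.Bijective Λ := by
    constructor
    · rw [injective_iff_map_eq_zero]
      intro p hp
      have h2 : p.2 = 0 := by rw [← hΛ, hp, map_zero]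
      have h1 : (b p.1 : E) = 0 := by simpa [Λ, h2] using hp
      have h1' : p.1 = 0 := by simpa using h1
      exact Prod.ext h1' h2
    · intro e
      refine ⟨(b.symm ⟨e - J (θ e), ?_⟩, θ e), ?_⟩
      · simp [hJ']
      · simp [Λ]
  exact ⟨(LinearEquiv.ofBijective Λ hbij).toContinuousLinearEquiv, hΛ⟩

/-- **Frobenius' theorem**: the kernel of a smooth surjective form `θ` with `dθ = 0` on `ker θ` is
locally the common kernel of the differentials of as many functions as `θ` has components. -/
theorem frobenius {E : Type*} {Y : Type} [NormedAddCommGroup E] [NormedSpace ℝ E]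
    [FiniteDimensional ℝ E] [NormedAddCommGroup Y] [NormedSpace ℝ Y] [FiniteDimensional ℝ Y]
    (θ : E → E →L[ℝ] Y) (x₀ : E) (hθ : ∀ᶠ x in 𝓝 x₀, ContDiffAt ℝ ∞ θ x)
    (hsurj : Function.Surjective (θ x₀))
    (hint : ∀ᶠ x in 𝓝 x₀, ∀ v w, θ x v = 0 → θ x w = 0 → fderiv ℝ θ x v w = fderiv ℝ θ x w v) :
    ∃ q : E → Y, (∀ᶠ x in 𝓝 x₀, ContDiffAt ℝ ∞ q x) ∧
      ∀ᶠ x in 𝓝 x₀, Function.Surjective (fderiv ℝ q x) ∧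
        ∀ v, fderiv ℝ q x v = 0 ↔ θ x v = 0 := by
  obtain ⟨Λ, hΛ⟩ := exists_equiv_prod_of_surjective (θ x₀) hsurj
  set X := Fin (Module.finrank ℝ (LinearMap.ker (θ x₀).toLinearMap)) → ℝ
  let c : X × Y → E := fun p => x₀ + Λ p
  have hc0 : c (0, 0) = x₀ := by simp [c]
  have hcs : ContDiff ℝ ∞ c := by fun_prop
  have hcd : ∀ p, HasFDerivAt c (Λ : X × Y →L[ℝ] E) p := fun p => Λ.hasFDerivAt.const_add x₀
  have hct : Filter.Tendsto c (𝓝 (0, 0)) (𝓝 x₀) := by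
    have := hcs.continuous.tendsto (0, 0)
    rwa [hc0] at this
  let Θ : X × Y → X × Y →L[ℝ] Y := fun p => (θ (c p)).comp (Λ : X × Y →L[ℝ] E)
  have hΘs : ∀ᶠ p in 𝓝 ((0 : X), (0 : Y)), ContDiffAt ℝ ∞ Θ p := by
    filter_upwards [hct.eventually hθ] with p hp
    exact (ContDiffAt.comp p hp hcs.contDiffAt).clm_comp contDiffAt_const
  have hΘd : ∀ᶠ p in 𝓝 ((0 : X), (0 : Y)), ∀ u w,
      fderiv ℝ Θ p u w = fderiv ℝ θ (c p) (Λ u) (Λ w) := by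
    filter_upwards [hct.eventually hθ] with p hp u w
    have h1 := HasFDerivAt.comp p (hp.differentiableAt (by simp)).hasFDerivAt (hcd p)
    have h2 : HasFDerivAt Θ _ p := h1.clm_comp (hasFDerivAt_const (Λ : X × Y →L[ℝ] E) p)
    rw [h2.fderiv]
    simp
  -- In coordinates with `M = id` at the origin, `M` stays invertible nearby and `ker Θ` is the
  -- graph of `-M⁻¹ A`.
  let A : X × Y → X →L[ℝ] Y := fun p => (Θ p).comp (ContinuousLinearMap.inl ℝ X Y)
  let M : X × Y → Y →L[ℝ] Y := fun p => (Θ p).comp (ContinuousLinearMap.inr ℝ X Y)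
  have hAM : ∀ p v w, Θ p (v, w) = A p v + M p w := by
    intro p v w
    have : (v, w) = (v, 0) + (0, w) := by simp
    rw [this, map_add]
    rfl
  have hM0 : M (0, 0) = ContinuousLinearMap.id ℝ Y := by
    ext1 y
    simp only [M, Θ, hc0]
    exact hΛ (0, y)
  have hMs : ∀ᶠ p in 𝓝 ((0 : X), (0 : Y)), ContDiffAt ℝ ∞ M p := by
    filter_upwards [hΘs] with p hp
    exact hp.clm_comp contDiffAt_const
  have hMinv : ∀ᶠ p in 𝓝 ((0 : X), (0 : Y)), (M p).IsInvertible := by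
    refine hMs.self_of_nhds.continuousAt.eventually_mem
      ((ContinuousLinearEquiv.isOpen (𝕜 := ℝ) (E := Y) (F := Y)).mem_nhds ?_)
    rw [hM0]
    exact ⟨ContinuousLinearEquiv.refl ℝ Y, rfl⟩
  let f : X × Y → X →L[ℝ] Y := fun p => -((M p).inverse.comp (A p))
  have hfs : ∀ᶠ p in 𝓝 ((0 : X), (0 : Y)), ContDiffAt ℝ ∞ f p := by
    filter_upwards [hΘs, hMs, hMinv] with p h1 h2 h3
    exact ((ContDiffAt.comp p h3.contDiffAt_map_inverse h2).clm_comp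
      (h1.clm_comp contDiffAt_const)).neg
  have hker : ∀ᶠ p in 𝓝 ((0 : X), (0 : Y)), ∀ v w, Θ p (v, w) = 0 ↔ w = f p v := by
    filter_upwards [hMinv] with p hp v w
    obtain ⟨e, he⟩ := hp
    rw [hAM]
    simp only [f, ← he, ContinuousLinearMap.inverse_equiv, neg_apply,
      ContinuousLinearMap.comp_apply, ContinuousLinearEquiv.coe_coe]
    rw [← map_neg, ContinuousLinearEquiv.eq_symm_apply, eq_neg_iff_add_eq_zero, add_comm]
  have hfint : ∀ᶠ p in 𝓝 ((0 : X), (0 : Y)), ∀ v w,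
      fderiv ℝ f p (v, f p v) w = fderiv ℝ f p (w, f p w) v := by
    filter_upwards [hct.eventually hint, hΘs, hΘd, hMinv, hfs, hker, hker.eventually_nhds]
      with p h1 h2 h3 h4 h5 h6 h7 v w
    have hM : Function.Injective (M p) := by
      obtain ⟨e, he⟩ := h4
      rw [← he]
      exact e.injective
    -- Differentiating `Θ p (v, f p v) = 0` expresses `M ∘ Df` by `DΘ`, so the symmetry of `DΘ` on
    -- `ker Θ` becomes the integrability condition for `f`.
    have hdiff : ∀ u v, M p (fderiv ℝ f p u v) = -fderiv ℝ Θ p u (v, f p v) := by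
      intro u v
      have hz : (fun p => Θ p (v, f p v)) =ᶠ[𝓝 p] fun _ => 0 := by
        filter_upwards [h7] with p' hp'
        exact (hp' _ _).2 rfl
      have hd1 := (h2.differentiableAt (by simp)).hasFDerivAt.clm_apply
        ((hasFDerivAt_const v p).prodMk
          ((h5.differentiableAt (by simp)).hasFDerivAt.clm_apply (hasFDerivAt_const v p)))
      have := congrArg (fun A => A u) (hd1.unique ((hasFDerivAt_const 0 p).congr_of_eventuallyEq hz))
      simp only [add_apply, ContinuousLinearMap.comp_apply, ContinuousLinearMap.flip_apply,
        ContinuousLinearMap.prod_apply, zero_apply, map_zero, zero_add] at this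
      exact eq_neg_of_add_eq_zero_left this
    apply hM
    rw [hdiff, hdiff, h3, h3, h1]
    · exact (h6 _ _).2 rfl
    · exact (h6 _ _).2 rfl
  obtain ⟨q, hq, hqker⟩ := exists_firstIntegrals_of_graph f 0 hfs hfint
  have ht : Filter.Tendsto (fun x => Λ.symm (x - x₀)) (𝓝 x₀) (𝓝 ((0 : X), (0 : Y))) := by
    have : Continuous (fun x => Λ.symm (x - x₀)) := by fun_prop
    have h := this.tendsto x₀
    rwa [sub_self, map_zero] at h
  refine ⟨fun x => q (Λ.symm (x - x₀)), ?_, ?_⟩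
  · filter_upwards [ht.eventually hq] with x hx
    exact ContDiffAt.comp x hx (by fun_prop)
  · filter_upwards [ht.eventually hq, ht.eventually hqker, ht.eventually hker] with x h1 h2 h3
    have hcx : c (Λ.symm (x - x₀)) = x := by simp [c]
    have hd : ∀ v, fderiv ℝ (fun x => q (Λ.symm (x - x₀))) x v =
        fderiv ℝ q (Λ.symm (x - x₀)) (Λ.symm v) := by
      intro v
      have ha : HasFDerivAt (fun x => Λ.symm (x - x₀)) (Λ.symm : E →L[ℝ] X × Y) x :=
        Λ.symm.hasFDerivAt.comp x ((hasFDerivAt_id x).sub_const x₀)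
      have hcomp : HasFDerivAt (fun x => q (Λ.symm (x - x₀))) _ x :=
        HasFDerivAt.comp x (h1.differentiableAt (by simp)).hasFDerivAt ha
      rw [hcomp.fderiv]
      rfl
    constructor
    · intro y
      obtain ⟨u, hu⟩ := h2.1 y
      exact ⟨Λ u, by rw [hd, Λ.symm_apply_apply, hu]⟩
    · intro v
      rw [hd]
      have e1 : Λ.symm v = ((Λ.symm v).1, (Λ.symm v).2) := rfl
      rw [e1, h2.2, ← h3]
      change θ (c _) (Λ (Λ.symm v)) = 0 ↔ _
      rw [hcx, Λ.apply_symm_apply]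

end Frobenius
-- Families of linear maps of constant rank
section ConstantRank

variable {E F Y Z : Type*} [NormedAddCommGroup E] [NormedSpace ℝ E]
  [NormedAddCommGroup F] [NormedSpace ℝ F] [FiniteDimensional ℝ F]
  [NormedAddCommGroup Y] [NormedSpace ℝ Y] [FiniteDimensional ℝ Y]
  [NormedAddCommGroup Z] [NormedSpace ℝ Z]

/-- A smooth family of linear maps that is surjective at one point has a smooth family of right
inverses near that point. -/
theorem exists_smooth_rightInverse (B : Z → E →L[ℝ] Y) (x₀ : Z)
    (hB : ∀ᶠ x in 𝓝 x₀, ContDiffAt ℝ ∞ B x) (hs : Function.Surjective (B x₀)) :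
    ∃ R : Z → Y →L[ℝ] E, (∀ᶠ x in 𝓝 x₀, ContDiffAt ℝ ∞ R x) ∧
      ∀ᶠ x in 𝓝 x₀, ∀ y, B x (R x y) = y := by
  obtain ⟨J', hJ'⟩ := (B x₀).toLinearMap.exists_rightInverse_of_surjective
    (LinearMap.range_eq_top.2 hs)
  let J : Y →L[ℝ] E := LinearMap.toContinuousLinearMap J'
  -- `J` is a right inverse at `x₀` only. Nearby `B x ∘ J` is still invertible, and `J ∘ (B x ∘
  -- J)⁻¹` is a right inverse of `B x`.
  let M : Z → Y →L[ℝ] Y := fun x => (B x).comp J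
  have hM : ∀ᶠ x in 𝓝 x₀, ContDiffAt ℝ ∞ M x := by
    filter_upwards [hB] with x hx
    exact hx.clm_comp contDiffAt_const
  have hM0 : M x₀ = ContinuousLinearMap.id ℝ Y := by
    ext1 y
    exact congrArg (fun A => A y) hJ'
  have hinv : ∀ᶠ x in 𝓝 x₀, (M x).IsInvertible := by
    refine hM.self_of_nhds.continuousAt.eventually_mem
      ((ContinuousLinearEquiv.isOpen (𝕜 := ℝ) (E := Y) (F := Y)).mem_nhds ?_)
    rw [hM0]
    exact ⟨ContinuousLinearEquiv.refl ℝ Y, rfl⟩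
  refine ⟨fun x => J.comp (M x).inverse, ?_, ?_⟩
  · filter_upwards [hM, hinv] with x h1 h2
    exact contDiffAt_const.clm_comp (ContDiffAt.comp x h2.contDiffAt_map_inverse h1)
  · filter_upwards [hinv] with x hx y
    obtain ⟨e, he⟩ := hx
    change M x ((M x).inverse y) = y
    rw [← he, ContinuousLinearMap.inverse_equiv]
    exact e.apply_symm_apply y

theorem eventually_surjective (B : Z → E →L[ℝ] Y) (x₀ : Z)
    (hB : ∀ᶠ x in 𝓝 x₀, ContDiffAt ℝ ∞ B x) (hs : Function.Surjective (B x₀)) :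
    ∀ᶠ x in 𝓝 x₀, Function.Surjective (B x) := by
  obtain ⟨R, -, hR⟩ := exists_smooth_rightInverse B x₀ hB hs
  filter_upwards [hR] with x hx y
  exact ⟨_, hx y⟩

/-- A smooth family of linear maps of constant rank can be replaced by a family of surjective ones
with the same kernels. -/
theorem exists_comp_surjective [FiniteDimensional ℝ E] (A : Z → E →L[ℝ] F) (x₀ : Z) (d : ℕ)
    (hA : ∀ᶠ x in 𝓝 x₀, ContDiffAt ℝ ∞ A x)
    (hd : ∀ᶠ x in 𝓝 x₀, Module.finrank ℝ (LinearMap.ker (A x).toLinearMap) = d) :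
    ∃ (m : ℕ) (T : F →L[ℝ] (Fin m → ℝ)), d + m = Module.finrank ℝ E ∧
      ∀ᶠ x in 𝓝 x₀, Function.Surjective (T.comp (A x)) ∧ ∀ v, T (A x v) = 0 ↔ A x v = 0 := by
  -- `T` projects onto the range at `x₀`. Then `T ∘ A x` is onto at `x₀` and hence nearby, where
  -- constant rank forces its kernel to be no larger than that of `A x`.
  let R := LinearMap.range (A x₀).toLinearMap
  obtain ⟨P, hP⟩ := R.subtype.exists_leftInverse_of_injective
    (LinearMap.ker_eq_bot.2 R.injective_subtype)
  let b := (Module.finBasis ℝ R).equivFun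
  let T : F →L[ℝ] (Fin (Module.finrank ℝ R) → ℝ) :=
    LinearMap.toContinuousLinearMap (b.toLinearMap ∘ₗ P)
  have hrank := (A x₀).toLinearMap.finrank_range_add_finrank_ker
  rw [hd.self_of_nhds, add_comm] at hrank
  have hs0 : Function.Surjective (T.comp (A x₀)) := by
    intro y
    obtain ⟨v, hv⟩ := (b.symm y).2
    refine ⟨v, ?_⟩
    have h1 : P (A x₀ v) = b.symm y := by
      have h2 : A x₀ v = R.subtype (b.symm y) := hv
      rw [h2]
      exact congrArg (fun A => A (b.symm y)) hP
    change b (P (A x₀ v)) = y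
    rw [h1, b.apply_symm_apply]
  have hTA : ∀ᶠ x in 𝓝 x₀, ContDiffAt ℝ ∞ (fun x => T.comp (A x)) x := by
    filter_upwards [hA] with x hx
    exact contDiffAt_const.clm_comp hx
  refine ⟨_, T, hrank, ?_⟩
  filter_upwards [eventually_surjective _ x₀ hTA hs0, hd] with x hs hdx
  refine ⟨hs, fun v => ⟨fun h => ?_, fun h => by rw [h, map_zero]⟩⟩
  have hle : LinearMap.ker (A x).toLinearMap ≤ LinearMap.ker (T.comp (A x)).toLinearMap := by
    intro v hv
    have hv' : A x v = 0 := hv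
    change T (A x v) = 0
    rw [hv', map_zero]
  have h1 := (T.comp (A x)).toLinearMap.finrank_range_add_finrank_ker
  rw [LinearMap.range_eq_top.2 hs, finrank_top, Module.finrank_fin_fun] at h1
  have heq := Submodule.eq_of_le_of_finrank_eq hle (by
    have : Module.finrank ℝ R + d = Module.finrank ℝ E := by rw [add_comm]; exact hrank
    omega)
  have : v ∈ LinearMap.ker (T.comp (A x)).toLinearMap := h
  rw [← heq] at this
  exact this

/-- Vectors in the kernel of a smooth family of linear maps of constant rank extend to smooth
vector fields with values in the kernels. -/
theorem exists_smooth_section [FiniteDimensional ℝ E] (A : Z → E →L[ℝ] F) (x₀ : Z) (d : ℕ)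
    (hA : ∀ᶠ x in 𝓝 x₀, ContDiffAt ℝ ∞ A x)
    (hd : ∀ᶠ x in 𝓝 x₀, Module.finrank ℝ (LinearMap.ker (A x).toLinearMap) = d)
    (v : E) (hv : A x₀ v = 0) :
    ∃ X : Z → E, ContDiffAt ℝ ∞ X x₀ ∧ X x₀ = v ∧ ∀ᶠ x in 𝓝 x₀, A x (X x) = 0 := by
  obtain ⟨m, T, -, hT⟩ := exists_comp_surjective A x₀ d hA hd
  have hTA : ∀ᶠ x in 𝓝 x₀, ContDiffAt ℝ ∞ (fun x => T.comp (A x)) x := by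
    filter_upwards [hA] with x hx
    exact contDiffAt_const.clm_comp hx
  obtain ⟨R, hR, hR'⟩ := exists_smooth_rightInverse _ x₀ hTA hT.self_of_nhds.1
  -- The constant field `v`, corrected by a lift of its defect; the defect vanishes at `x₀`.
  refine ⟨fun x => v - R x (T (A x v)), ?_, by simp [hv], ?_⟩
  · exact contDiffAt_const.sub (hR.self_of_nhds.clm_apply
      (hTA.self_of_nhds.clm_apply contDiffAt_const))
  · filter_upwards [hR', hT] with x h1 h2
    rw [← h2.2, map_sub, map_sub, sub_eq_zero]
    exact (h1 _).symm

end ConstantRank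

/-- Frobenius' theorem for the kernel of a form of constant rank. -/
theorem frobenius_of_constantRank {E F : Type*} [NormedAddCommGroup E] [NormedSpace ℝ E]
    [FiniteDimensional ℝ E] [NormedAddCommGroup F] [NormedSpace ℝ F] [FiniteDimensional ℝ F]
    (θ : E → E →L[ℝ] F) (x₀ : E) (d : ℕ) (hθ : ∀ᶠ x in 𝓝 x₀, ContDiffAt ℝ ∞ θ x)
    (hd : ∀ᶠ x in 𝓝 x₀, Module.finrank ℝ (LinearMap.ker (θ x).toLinearMap) = d)
    (hint : ∀ᶠ x in 𝓝 x₀, ∀ v w, θ x v = 0 → θ x w = 0 → fderiv ℝ θ x v w = fderiv ℝ θ x w v)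
    {m : ℕ} (hm : d + m = Module.finrank ℝ E) :
    ∃ q : E → Fin m → ℝ, (∀ᶠ x in 𝓝 x₀, ContDiffAt ℝ ∞ q x) ∧
      ∀ᶠ x in 𝓝 x₀, Function.Surjective (fderiv ℝ q x) ∧
        ∀ v, fderiv ℝ q x v = 0 ↔ θ x v = 0 := by
  obtain ⟨m', T, hm', hT⟩ := exists_comp_surjective θ x₀ d hθ hd
  obtain rfl : m = m' := by omega
  obtain ⟨q, hq, hq'⟩ := frobenius (fun x => T.comp (θ x)) x₀
    (by filter_upwards [hθ] with x hx; exact contDiffAt_const.clm_comp hx) hT.self_of_nhds.1 (by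
      filter_upwards [hT, hint, hθ] with x h1 h2 h3 v w hv hw
      have hd : HasFDerivAt (fun x => T.comp (θ x)) _ x :=
        (hasFDerivAt_const T x).clm_comp (h3.differentiableAt (by simp)).hasFDerivAt
      rw [hd.fderiv]
      simp [h2 v w ((h1.2 v).1 hv) ((h1.2 w).1 hw)])
  refine ⟨q, hq, ?_⟩
  filter_upwards [hq', hT] with x h1 h2
  exact ⟨h1.1, fun v => (h1.2 v).trans (h2.2 v)⟩

/-! ### Primitives along the leaves of a foliation -/

section Potential

variable {E : Type*} [NormedAddCommGroup E] [NormedSpace ℝ E]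

theorem fderiv_fderiv_symm {F : Type*} [NormedAddCommGroup F] [NormedSpace ℝ F] {f : E → F} {x : E}
    (hf : ContDiffAt ℝ ∞ f x) (v w : E) :
    fderiv ℝ (fderiv ℝ f) x v w = fderiv ℝ (fderiv ℝ f) x w v :=
  hf.isSymmSndFDerivAt
    (by rw [minSmoothness_of_isRCLikeNormedField]; exact ENat.LEInfty.out) v w

theorem fderiv_smooth {F : Type*} [NormedAddCommGroup F] [NormedSpace ℝ F] {f : E → F} {x : E}
    (hf : ContDiffAt ℝ ∞ f x) : ContDiffAt ℝ ∞ (fderiv ℝ f) x :=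
  hf.fderiv_right (m := ∞) (by simp)

/-- A form that is closed along the leaves of the foliation `q = const` is exact along them. -/
theorem exists_leafwise_potential [FiniteDimensional ℝ E] {Y Y' : Type} [NormedAddCommGroup Y] [NormedSpace ℝ Y]
    [FiniteDimensional ℝ Y] [NormedAddCommGroup Y'] [NormedSpace ℝ Y'] [FiniteDimensional ℝ Y']
    (η : E → E →L[ℝ] Y') (q : E → Y) (x₀ : E)
    (hη : ∀ᶠ x in 𝓝 x₀, ContDiffAt ℝ ∞ η x) (hq : ∀ᶠ x in 𝓝 x₀, ContDiffAt ℝ ∞ q x)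
    (hs : Function.Surjective (fderiv ℝ q x₀))
    (hcl : ∀ᶠ x in 𝓝 x₀, ∀ v w, fderiv ℝ q x v = 0 → fderiv ℝ q x w = 0 →
      fderiv ℝ η x v w = fderiv ℝ η x w v) :
    ∃ s : E → Y', (∀ᶠ x in 𝓝 x₀, ContDiffAt ℝ ∞ s x) ∧
      ∀ᶠ x in 𝓝 x₀, ∀ v, fderiv ℝ q x v = 0 → fderiv ℝ s x v = η x v := by
  -- The kernel of `Θ` is the graph of `η` over `ker dq`, so its integral manifolds are graphs of
  -- leafwise primitives. Its involutivity is the closedness of `η` along the leaves.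
  let Θ : E × Y' → E × Y' →L[ℝ] Y × Y' := fun p =>
    ((fderiv ℝ q p.1).comp (ContinuousLinearMap.fst ℝ E Y')).prod
      (ContinuousLinearMap.snd ℝ E Y' - (η p.1).comp (ContinuousLinearMap.fst ℝ E Y'))
  have hfst : Filter.Tendsto (Prod.fst : E × Y' → E) (𝓝 (x₀, 0)) (𝓝 x₀) :=
    continuous_fst.tendsto (x₀, (0 : Y'))
  have hΘs : ∀ᶠ p in 𝓝 (x₀, (0 : Y')), ContDiffAt ℝ ∞ Θ p := by
    filter_upwards [hfst.eventually hq, hfst.eventually hη] with p h1 h2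
    have h3 : ContDiffAt ℝ ∞ (fun p : E × Y' => fderiv ℝ q p.1) p :=
      ContDiffAt.comp p (fderiv_smooth h1) contDiffAt_fst
    have h4 : ContDiffAt ℝ ∞ (fun p : E × Y' => η p.1) p := ContDiffAt.comp p h2 contDiffAt_fst
    have h5 : Θ = fun p => (ContinuousLinearMap.inl ℝ Y Y').comp ((fderiv ℝ q p.1).comp
        (ContinuousLinearMap.fst ℝ E Y')) + (ContinuousLinearMap.inr ℝ Y Y').comp
        (ContinuousLinearMap.snd ℝ E Y' - (η p.1).comp (ContinuousLinearMap.fst ℝ E Y')) := by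
      funext p
      refine ContinuousLinearMap.ext fun u => ?_
      simp [Θ]
    rw [h5]
    exact (contDiffAt_const.clm_comp (h3.clm_comp contDiffAt_const)).add
      (contDiffAt_const.clm_comp (contDiffAt_const.sub (h4.clm_comp contDiffAt_const)))
  have hΘsurj : Function.Surjective (Θ (x₀, 0)) := by
    rintro ⟨y, c⟩
    obtain ⟨v, hv⟩ := hs y
    refine ⟨(v, c + η x₀ v), ?_⟩
    simp [Θ, hv]
  have hΘd : ∀ᶠ p in 𝓝 (x₀, (0 : Y')), ∀ u w, fderiv ℝ Θ p u w =
      (fderiv ℝ (fderiv ℝ q) p.1 u.1 w.1, -fderiv ℝ η p.1 u.1 w.1) := by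
    filter_upwards [hfst.eventually hq, hfst.eventually hη, hΘs] with p h1 h2 h0 u w
    have h3 : HasFDerivAt (fun p : E × Y' => fderiv ℝ q p.1) _ p :=
      HasFDerivAt.comp p ((fderiv_smooth h1).differentiableAt (by simp)).hasFDerivAt hasFDerivAt_fst
    have h4 : HasFDerivAt (fun p : E × Y' => η p.1) _ p :=
      HasFDerivAt.comp p (h2.differentiableAt (by simp)).hasFDerivAt hasFDerivAt_fst
    have h5 := (h3.clm_apply (hasFDerivAt_const w.1 p)).prodMk
      ((hasFDerivAt_const w.2 p).sub (h4.clm_apply (hasFDerivAt_const w.1 p)))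
    have h6 : HasFDerivAt (fun p => Θ p w) _ p :=
      (h0.differentiableAt (by simp)).hasFDerivAt.clm_apply (hasFDerivAt_const w p)
    have h7 := congrArg (fun A => A u) (h6.unique h5)
    simpa using h7
  obtain ⟨G, hG, hGker⟩ := frobenius Θ (x₀, 0) hΘs hΘsurj (by
    filter_upwards [hΘd, hfst.eventually hcl, hfst.eventually hq] with p h1 h2 h3 u w hu hw
    have hu1 : fderiv ℝ q p.1 u.1 = 0 := congrArg Prod.fst hu
    have hw1 : fderiv ℝ q p.1 w.1 = 0 := congrArg Prod.fst hw
    rw [h1, h1, h2 _ _ hu1 hw1, fderiv_fderiv_symm h3])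
  let a : E × Y' := (x₀, 0)
  let D : E × Y' →L[ℝ] Y × Y' := fderiv ℝ G a
  -- The graph is transverse to the factor `Y'`. Composing `G` with `C` makes its derivative along
  -- `Y'` the identity at `a`, so that `H (x, s) = H a` can be solved for `s`.
  obtain ⟨C, hC⟩ := (D.comp (ContinuousLinearMap.inr ℝ E Y')).toLinearMap
    |>.exists_leftInverse_of_injective (by
    rw [LinearMap.ker_eq_bot']
    intro c hc
    have h1 := (hGker.self_of_nhds.2 (0, c)).1 hc
    simpa [Θ] using congrArg Prod.snd h1)
  let C' : Y × Y' →L[ℝ] Y' := LinearMap.toContinuousLinearMap C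
  have hC' : ∀ c, C' (D (0, c)) = c := fun c => congrArg (fun A => A c) hC
  let H : E × Y' → Y' := fun p => C' (G p)
  have hHs : ∀ᶠ p in 𝓝 a, ContDiffAt ℝ ∞ H p := by
    filter_upwards [hG] with p hp
    exact C'.contDiff.contDiffAt.comp p hp
  have hHd : ∀ᶠ p in 𝓝 a, ∀ u, fderiv ℝ H p u = C' (fderiv ℝ G p u) := by
    filter_upwards [hG] with p hp u
    have h : HasFDerivAt H _ p :=
      C'.hasFDerivAt.comp p (hp.differentiableAt (by simp)).hasFDerivAt
    rw [h.fderiv]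
    rfl
  have hHker : ∀ᶠ p in 𝓝 a, ∀ v, fderiv ℝ q p.1 v = 0 → fderiv ℝ H p (v, η p.1 v) = 0 := by
    filter_upwards [hHd, hGker] with p h1 h2 v hv
    rw [h1, (h2.2 _).2, map_zero]
    simp [Θ, hv]
  have hinr : ∀ᶠ p in 𝓝 a,
      ((fderiv ℝ H p).comp (ContinuousLinearMap.inr ℝ E Y')).IsInvertible := by
    have hc : ContinuousAt (fun p => (fderiv ℝ H p).comp (ContinuousLinearMap.inr ℝ E Y')) a :=
      ((fderiv_smooth hHs.self_of_nhds).clm_comp contDiffAt_const).continuousAt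
    refine hc.eventually_mem ((ContinuousLinearEquiv.isOpen (𝕜 := ℝ) (E := Y') (F := Y')).mem_nhds
      ⟨ContinuousLinearEquiv.refl ℝ Y', ?_⟩)
    ext1 c
    exact ((hHd.self_of_nhds (0, c)).trans (hC' c)).symm
  let Ψ : E × Y' → E × Y' := fun p => (p.1, H p)
  have hΨs : ∀ᶠ p in 𝓝 a, ContDiffAt ℝ ∞ Ψ p := by
    filter_upwards [hHs] with p hp
    exact contDiffAt_fst.prodMk hp
  let e : (E × Y') ≃L[ℝ] (E × Y') :=
    (ContinuousLinearEquiv.refl ℝ E).skewProd (ContinuousLinearEquiv.refl ℝ Y')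
      ((fderiv ℝ H a).comp (ContinuousLinearMap.inl ℝ E Y'))
  have he : HasFDerivAt Ψ (e : (E × Y') →L[ℝ] (E × Y')) a := by
    refine (hasFDerivAt_fst.prodMk (hHs.self_of_nhds.differentiableAt
      (by simp)).hasFDerivAt).congr_fderiv (ContinuousLinearMap.ext fun p => ?_)
    have hp : p = (p.1, 0) + (0, p.2) := by ext <;> simp
    refine Prod.ext rfl ?_
    change fderiv ℝ H a p = p.2 + fderiv ℝ H a (p.1, 0)
    conv_lhs => rw [hp, map_add, hHd.self_of_nhds (0, p.2), hC']
    exact add_comm _ _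
  obtain ⟨φ, hφ, haφ, hsrc, hsm⟩ := exists_smooth_openPartialHomeomorph hΨs he
    (hHs.and (hHker.and hinr))
  have hc : ContinuousAt (fun x : E => (x, H a)) x₀ := by fun_prop
  have hev : ∀ᶠ x in 𝓝 x₀, (x, H a) ∈ φ.target := by
    refine hc.eventually_mem (φ.open_target.mem_nhds ?_)
    have := φ.map_source haφ
    rwa [hφ] at this
  have hs : ∀ᶠ x in 𝓝 x₀, ContDiffAt ℝ ∞ (fun x => (φ.symm (x, H a)).2) x := by
    filter_upwards [hev] with x hx
    exact contDiffAt_snd.comp x (ContDiffAt.comp x (hsm _ hx) (by fun_prop))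
  refine ⟨fun x => (φ.symm (x, H a)).2, hs, ?_⟩
  have hfib : ∀ x, (x, H a) ∈ φ.target → φ.symm (x, H a) = (x, (φ.symm (x, H a)).2) ∧
      H (x, (φ.symm (x, H a)).2) = H a := by
    intro x hx
    have h := φ.right_inv hx
    rw [hφ] at h
    have h0 : (φ.symm (x, H a)).1 = x := congrArg Prod.fst h
    have h1 : φ.symm (x, H a) = (x, (φ.symm (x, H a)).2) := Prod.ext h0 rfl
    exact ⟨h1, by rw [← h1]; exact congrArg Prod.snd h⟩
  filter_upwards [hev, hev.eventually_nhds, hs] with x hx hx' hsx v hv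
  set s : E → Y' := fun x => (φ.symm (x, H a)).2
  obtain ⟨-, hHx, hkerx, hinvx⟩ := hsrc _ (φ.map_target hx)
  rw [(hfib x hx).1] at hHx hkerx hinvx
  -- Differentiating `H (x, s x) = const` gives `dH (v, ds v) = 0`. Since also `dH (v, η v) = 0`,
  -- invertibility along `Y'` yields `ds v = η v`.
  have hconst : HasFDerivAt (fun x => H (x, s x)) (0 : E →L[ℝ] Y') x := by
    refine (hasFDerivAt_const (H a) x).congr_of_eventuallyEq ?_
    filter_upwards [hx'] with y hy using (hfib y hy).2
  have hcomp : HasFDerivAt (fun x => H (x, s x)) _ x :=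
    HasFDerivAt.comp (g := H) x (hHx.differentiableAt (by simp)).hasFDerivAt
      ((hasFDerivAt_id x).prodMk (hsx.differentiableAt (by simp)).hasFDerivAt)
  have h1 : fderiv ℝ H (x, s x) (v, fderiv ℝ s x v) = 0 :=
    congrArg (fun A => A v) (hcomp.unique hconst)
  have h2 := hkerx v hv
  obtain ⟨e', he'⟩ := hinvx
  have h3 : e' (fderiv ℝ s x v - η x v) = 0 := by
    have h4 : e' (fderiv ℝ s x v - η x v) = fderiv ℝ H (x, s x) (0, fderiv ℝ s x v - η x v) :=
      congrArg (fun A => A (fderiv ℝ s x v - η x v)) he'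
    have h5 : ((0 : E), fderiv ℝ s x v - η x v) = (v, fderiv ℝ s x v) - (v, η x v) := by simp
    rw [h4, h5, map_sub, h1, h2, sub_zero]
  exact sub_eq_zero.1 ((map_eq_zero_iff e' e'.injective).1 h3)

end Potential

/-! ### Darboux coordinates from an isotropic foliation -/

section DarbouxChart

variable {E : Type*} [NormedAddCommGroup E] [NormedSpace ℝ E] {k n : ℕ}

/-- The equation `η = ds - ∑ p dq` at the point `x`, for the functions `φ = (s, q, p)`. -/
def DarbouxEqAt (η : E → E →L[ℝ] (Fin k → ℝ)) (φ : E → DarbouxSpace k n) (x : E) : Prop :=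
  ∀ v α, η x v α = (fderiv ℝ φ x v).1 α - ∑ i, (φ x).2.2 i α * (fderiv ℝ φ x v).2.1 i

/-- If `dη` vanishes on the fibres of `q`, then `η = ds - ∑ p dq` for suitable functions
`s` and `p`. -/
theorem exists_darboux_functions [FiniteDimensional ℝ E]
    (η : E → E →L[ℝ] (Fin k → ℝ)) (q : E → Fin n → ℝ) (x₀ : E)
    (hη : ∀ᶠ x in 𝓝 x₀, ContDiffAt ℝ ∞ η x) (hq : ∀ᶠ x in 𝓝 x₀, ContDiffAt ℝ ∞ q x)
    (hs : Function.Surjective (fderiv ℝ q x₀))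
    (hcl : ∀ᶠ x in 𝓝 x₀, ∀ v w, fderiv ℝ q x v = 0 → fderiv ℝ q x w = 0 →
      fderiv ℝ η x v w = fderiv ℝ η x w v) :
    ∃ φ : E → DarbouxSpace k n, (∀ᶠ x in 𝓝 x₀, ContDiffAt ℝ ∞ φ x) ∧
      (∀ x, (φ x).2.1 = q x) ∧ ∀ᶠ x in 𝓝 x₀, DarbouxEqAt η φ x := by
  obtain ⟨s, hsm, hseq⟩ := exists_leafwise_potential η q x₀ hη hq hs hcl
  obtain ⟨R, hR, hRq⟩ := exists_smooth_rightInverse (fderiv ℝ q) x₀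
    (hq.mono fun x hx => fderiv_smooth hx) hs
  -- `ds - η` vanishes on `ker dq` and so factors through `dq`; its `i`-th coefficient is its value
  -- on a lift of the `i`-th basis vector.
  let p : E → Fin n → Fin k → ℝ := fun x i => (fderiv ℝ s x - η x) (R x (Pi.single i 1))
  have hp : ∀ᶠ x in 𝓝 x₀, ContDiffAt ℝ ∞ p x := by
    filter_upwards [hsm, hη, hR] with x h1 h2 h3
    refine contDiffAt_pi.2 fun i => ?_
    exact ((fderiv_smooth h1).sub h2).clm_apply (h3.clm_apply contDiffAt_const)
  refine ⟨fun x => (s x, q x, p x), ?_, fun x => rfl, ?_⟩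
  · filter_upwards [hsm, hq, hp] with x h1 h2 h3
    exact h1.prodMk (h2.prodMk h3)
  · filter_upwards [hsm, hq, hp, hseq, hRq] with x h1 h2 h3 h4 h5 v α
    have hd := ((h1.differentiableAt (by simp)).hasFDerivAt.prodMk
      ((h2.differentiableAt (by simp)).hasFDerivAt.prodMk
        (h3.differentiableAt (by simp)).hasFDerivAt)).fderiv
    rw [hd]
    simp only [ContinuousLinearMap.prod_apply]
    have hker : fderiv ℝ q x (v - R x (fderiv ℝ q x v)) = 0 := by
      rw [map_sub, h5, sub_self]
    have h6 := h4 _ hker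
    rw [map_sub, map_sub] at h6
    have h7 : (fderiv ℝ s x - η x) v = ∑ i, fderiv ℝ q x v i • p x i := by
      have h8 : (fderiv ℝ s x - η x) v = (fderiv ℝ s x - η x) (R x (fderiv ℝ q x v)) := by
        simp only [sub_apply]
        rw [sub_eq_sub_iff_sub_eq_sub]
        exact h6
      rw [h8]
      conv_lhs => rw [pi_eq_sum_univ' (fderiv ℝ q x v)]
      rw [map_sum, map_sum]
      refine Finset.sum_congr rfl fun i _ => ?_
      rw [map_smul, map_smul]
    have h9 := congrFun h7 α
    simp only [sub_apply, Pi.sub_apply, Finset.sum_apply, Pi.smul_apply, smul_eq_mul] at h9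
    have h10 : ∑ i, p x i α * fderiv ℝ q x v i = ∑ i, fderiv ℝ q x v i * p x i α :=
      Finset.sum_congr rfl fun i _ => mul_comm _ _
    rw [h10, ← h9]
    ring

/-- The exterior derivative of `ds - ∑ p dq` vanishes on vectors annihilated by `dq` and `dp`. -/
theorem DarbouxEqAt.fderiv_symm {η : E → E →L[ℝ] (Fin k → ℝ)} {φ : E → DarbouxSpace k n} {x : E}
    (h : ∀ᶠ y in 𝓝 x, DarbouxEqAt η φ y) (hη : ContDiffAt ℝ ∞ η x) (hφ : ContDiffAt ℝ ∞ φ x)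
    (v w : E) (α : Fin k) :
    fderiv ℝ η x v w α - fderiv ℝ η x w v α =
      ∑ i, ((fderiv ℝ φ x w).2.2 i α * (fderiv ℝ φ x v).2.1 i -
        (fderiv ℝ φ x v).2.2 i α * (fderiv ℝ φ x w).2.1 i) := by
  let S : DarbouxSpace k n →L[ℝ] ℝ := (ContinuousLinearMap.proj α).comp
    (ContinuousLinearMap.fst ℝ _ _)
  let Q : Fin n → DarbouxSpace k n →L[ℝ] ℝ := fun i => (ContinuousLinearMap.proj i).comp
    ((ContinuousLinearMap.fst ℝ _ _).comp (ContinuousLinearMap.snd ℝ _ _))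
  let P : Fin n → DarbouxSpace k n →L[ℝ] ℝ := fun i => (ContinuousLinearMap.proj α).comp
    ((ContinuousLinearMap.proj (R := ℝ) (φ := fun _ : Fin n => Fin k → ℝ) i).comp
      ((ContinuousLinearMap.snd ℝ _ _).comp (ContinuousLinearMap.snd ℝ _ _)))
  -- The product rule for `ds - ∑ p dq`. The terms with second derivatives are symmetric and cancel
  -- in the exterior derivative.
  have key : ∀ v w, fderiv ℝ η x v w α = S (fderiv ℝ (fderiv ℝ φ) x v w) -
      ∑ i, (P i (fderiv ℝ φ x v) * Q i (fderiv ℝ φ x w) +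
        P i (φ x) * Q i (fderiv ℝ (fderiv ℝ φ) x v w)) := by
    intro v w
    have hφd := (hφ.differentiableAt (by simp)).hasFDerivAt
    have hφdd := (((fderiv_smooth hφ).differentiableAt (by simp)).hasFDerivAt).clm_apply
      (hasFDerivAt_const w x)
    have h1 : HasFDerivAt (fun y => η y w α) ((ContinuousLinearMap.proj α).comp
        ((ContinuousLinearMap.apply ℝ (Fin k → ℝ) w).comp (fderiv ℝ η x))) x :=
      (ContinuousLinearMap.proj (R := ℝ) (φ := fun _ : Fin k => ℝ) α).hasFDerivAt.comp x
        ((ContinuousLinearMap.apply ℝ (Fin k → ℝ) w).hasFDerivAt.comp x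
          (hη.differentiableAt (by simp)).hasFDerivAt)
    have h2 : HasFDerivAt (fun y => S (fderiv ℝ φ y w) -
        ∑ i, P i (φ y) * Q i (fderiv ℝ φ y w)) _ x :=
      (S.hasFDerivAt.comp x hφdd).sub (HasFDerivAt.fun_sum fun i _ =>
        ((P i).hasFDerivAt.comp x hφd).mul ((Q i).hasFDerivAt.comp x hφdd))
    have h3 : (fun y => η y w α) =ᶠ[𝓝 x] fun y => S (fderiv ℝ φ y w) -
        ∑ i, P i (φ y) * Q i (fderiv ℝ φ y w) := by
      filter_upwards [h] with y hy using hy w α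
    have h4 := congrArg (fun A => A v) (h1.unique (h2.congr_of_eventuallyEq h3))
    simp only [ContinuousLinearMap.comp_apply, sub_apply, sum_apply, add_apply, smul_apply,
      ContinuousLinearMap.apply_apply, ContinuousLinearMap.proj_apply, zero_apply, map_zero,
      ContinuousLinearMap.flip_apply, smul_eq_mul, Function.comp_apply, zero_add] at h4
    rw [h4]
    congr 1
    exact Finset.sum_congr rfl fun i _ => by ring
  rw [key v w, key w v, fderiv_fderiv_symm hφ v w]
  rw [sub_sub_sub_cancel_left, ← Finset.sum_sub_distrib]
  refine Finset.sum_congr rfl fun i _ => ?_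
  change (P i (fderiv ℝ φ x w) * Q i (fderiv ℝ φ x v) + _) - (P i (fderiv ℝ φ x v) *
    Q i (fderiv ℝ φ x w) + _) = P i (fderiv ℝ φ x w) * Q i (fderiv ℝ φ x v) - P i (fderiv ℝ φ x v) *
    Q i (fderiv ℝ φ x w)
  ring

/-- **Darboux' theorem** for a `k`-contact form `η`, relative to a foliation `q = const` whose
leaves are isotropic for `dη`. -/
theorem exists_darboux_chart [FiniteDimensional ℝ E]
    (η : E → E →L[ℝ] (Fin k → ℝ)) (q : E → Fin n → ℝ) (x₀ : E)
    (hη : ∀ᶠ x in 𝓝 x₀, ContDiffAt ℝ ∞ η x) (hq : ∀ᶠ x in 𝓝 x₀, ContDiffAt ℝ ∞ q x)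
    (hs : Function.Surjective (fderiv ℝ q x₀))
    (hcl : ∀ᶠ x in 𝓝 x₀, ∀ v w, fderiv ℝ q x v = 0 → fderiv ℝ q x w = 0 →
      fderiv ℝ η x v w = fderiv ℝ η x w v)
    (hnd : ∀ v, η x₀ v = 0 → (∀ w, fderiv ℝ η x₀ v w = fderiv ℝ η x₀ w v) → v = 0)
    (hdim : Module.finrank ℝ E = n + k * n + k) {r : E → Prop} (hr : ∀ᶠ x in 𝓝 x₀, r x) :
    ∃ φ : OpenPartialHomeomorph E (DarbouxSpace k n), x₀ ∈ φ.source ∧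
      (∀ y ∈ φ.target, ContDiffAt ℝ ∞ φ.symm y) ∧
      ∀ x ∈ φ.source, ContDiffAt ℝ ∞ φ x ∧ DarbouxEqAt η φ x ∧
        (∀ v, (fderiv ℝ φ x v).2.1 = fderiv ℝ q x v) ∧ r x := by
  obtain ⟨φ, hφ, hφq, hφη⟩ := exists_darboux_functions η q x₀ hη hq hs hcl
  -- Both `η` and `dη` are expressed by the differential of `φ`, so a vector that it kills lies in
  -- `ker η ∩ ker dη = 0`.
  have hinj : Function.Injective (fderiv ℝ φ x₀) := by
    rw [injective_iff_map_eq_zero]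
    intro v hv
    refine hnd v ?_ fun w => ?_
    · funext α
      rw [hφη.self_of_nhds v α, hv]
      simp
    · funext α
      rw [← sub_eq_zero, DarbouxEqAt.fderiv_symm hφη hη.self_of_nhds hφ.self_of_nhds, hv]
      simp
  have hdim' : Module.finrank ℝ E = Module.finrank ℝ (DarbouxSpace k n) := by
    rw [hdim]
    simp only [Module.finrank_prod, Module.finrank_self, Module.finrank_pi_fintype,
      Finset.sum_const, Finset.card_univ, Fintype.card_fin, smul_eq_mul]
    ring
  let e : E ≃L[ℝ] DarbouxSpace k n := (LinearEquiv.ofInjectiveOfFinrankEq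
    (fderiv ℝ φ x₀).toLinearMap hinj hdim').toContinuousLinearEquiv
  have he : HasFDerivAt φ (e : E →L[ℝ] DarbouxSpace k n) x₀ :=
    (hφ.self_of_nhds.differentiableAt (by simp)).hasFDerivAt
  obtain ⟨ψ, hψ, hx₀, hsrc, hsm⟩ := exists_smooth_openPartialHomeomorph hφ he
    (hφη.and (hφ.and hr))
  refine ⟨ψ, hx₀, hsm, fun x hx => ?_⟩
  obtain ⟨h1, h2, h3, h4⟩ := hsrc x hx
  rw [hψ]
  refine ⟨h1, h2, fun v => ?_, h4⟩
  have hd := ((ContinuousLinearMap.fst ℝ (Fin n → ℝ) (Fin n → Fin k → ℝ)).comp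
    (ContinuousLinearMap.snd ℝ (Fin k → ℝ) _)).hasFDerivAt.comp x
      (h3.differentiableAt (by simp)).hasFDerivAt
  have hqe : q = ⇑((ContinuousLinearMap.fst ℝ (Fin n → ℝ) (Fin n → Fin k → ℝ)).comp
    (ContinuousLinearMap.snd ℝ (Fin k → ℝ) _)) ∘ φ := funext fun y => (hφq y).symm
  rw [hqe, hd.fderiv]
  rfl

end DarbouxChart

/-! ### Calculus of the exterior derivative on a normed space -/

section ExteriorDerivative

variable {E F : Type*} [NormedAddCommGroup E] [NormedSpace ℝ E] [NormedAddCommGroup F]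
  [NormedSpace ℝ F]

/-- The exterior derivative of a one-form on a normed space. -/
def extD (η : E → E →L[ℝ] F) (x : E) : E →L[ℝ] E →L[ℝ] F :=
  fderiv ℝ η x - (fderiv ℝ η x).flip

theorem extD_apply (η : E → E →L[ℝ] F) (x v w : E) :
    extD η x v w = fderiv ℝ η x v w - fderiv ℝ η x w v := rfl

theorem extD_swap (η : E → E →L[ℝ] F) (x v w : E) : extD η x v w = -extD η x w v := by
  simp [extD_apply]

theorem extD_self (η : E → E →L[ℝ] F) (x v : E) : extD η x v v = 0 := by simp [extD_apply]

/-- Exchanging the arguments of a bilinear map, as a continuous linear map. -/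
def flipCLM (E F : Type*) [NormedAddCommGroup E] [NormedSpace ℝ E] [NormedAddCommGroup F]
    [NormedSpace ℝ F] : (E →L[ℝ] E →L[ℝ] F) →L[ℝ] (E →L[ℝ] E →L[ℝ] F) :=
  ((ContinuousLinearMap.flipₗᵢ ℝ E E F).toContinuousLinearEquiv :
    (E →L[ℝ] E →L[ℝ] F) →L[ℝ] (E →L[ℝ] E →L[ℝ] F))

theorem contDiffAt_flip {X : Type*} [NormedAddCommGroup X] [NormedSpace ℝ X]
    {B : X → E →L[ℝ] E →L[ℝ] F} {x : X} (hB : ContDiffAt ℝ ∞ B x) :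
    ContDiffAt ℝ ∞ (fun y => (B y).flip) x :=
  have h : ContDiff ℝ ∞ (flipCLM E F) := by fun_prop
  ContDiffAt.comp (g := flipCLM E F) x h.contDiffAt hB

theorem extD_smooth {η : E → E →L[ℝ] F} {x : E} (hη : ContDiffAt ℝ ∞ η x) :
    ContDiffAt ℝ ∞ (extD η) x :=
  (fderiv_smooth hη).sub (contDiffAt_flip (fderiv_smooth hη))

theorem hasFDerivAt_extD {η : E → E →L[ℝ] F} {x : E} (hη : ContDiffAt ℝ ∞ η x) :
    HasFDerivAt (extD η) (fderiv ℝ (extD η) x) x :=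
  ((extD_smooth hη).differentiableAt (by simp)).hasFDerivAt

theorem fderiv_extD {η : E → E →L[ℝ] F} {x : E} (hη : ContDiffAt ℝ ∞ η x) (a b c : E) :
    fderiv ℝ (extD η) x a b c =
      fderiv ℝ (fderiv ℝ η) x a b c - fderiv ℝ (fderiv ℝ η) x a c b := by
  have h := ((fderiv_smooth hη).differentiableAt (by simp)).hasFDerivAt
  have h2 : HasFDerivAt (fun y => (fderiv ℝ η y).flip) _ x := HasFDerivAt.comp (g := flipCLM E F) x
    ((flipCLM E F).hasFDerivAt (x := fderiv ℝ η x)) h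
  have h3 : HasFDerivAt (extD η) _ x := h.sub h2
  rw [h3.fderiv]
  rfl

/-- The exterior derivative of a one-form is closed. -/
theorem fderiv_extD_cyclic {η : E → E →L[ℝ] F} {x : E} (hη : ContDiffAt ℝ ∞ η x) (a b c : E) :
    fderiv ℝ (extD η) x a b c + fderiv ℝ (extD η) x b c a + fderiv ℝ (extD η) x c a b = 0 := by
  rw [fderiv_extD hη, fderiv_extD hη, fderiv_extD hη, fderiv_fderiv_symm hη b a,
    fderiv_fderiv_symm hη c b, fderiv_fderiv_symm hη c a]
  abel

theorem fderiv_extD_swap {η : E → E →L[ℝ] F} {x : E} (hη : ContDiffAt ℝ ∞ η x) (a b c : E) :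
    fderiv ℝ (extD η) x a b c = -fderiv ℝ (extD η) x a c b := by
  rw [fderiv_extD hη, fderiv_extD hη]
  abel

/-- The product rule for a two-form evaluated on two vector fields. -/
theorem hasFDerivAt_extD_apply {η : E → E →L[ℝ] F} {x : E} (hη : ContDiffAt ℝ ∞ η x)
    {X Y : E → E} (hX : ContDiffAt ℝ ∞ X x) (hY : ContDiffAt ℝ ∞ Y x) (v : E) :
    fderiv ℝ (fun y => extD η y (X y) (Y y)) x v =
      fderiv ℝ (extD η) x v (X x) (Y x) + extD η x (fderiv ℝ X x v) (Y x) +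
        extD η x (X x) (fderiv ℝ Y x v) := by
  have h := ((hasFDerivAt_extD hη).clm_apply (hX.differentiableAt (by simp)).hasFDerivAt).clm_apply
    (hY.differentiableAt (by simp)).hasFDerivAt
  rw [h.fderiv]
  simp only [add_apply, ContinuousLinearMap.comp_apply, ContinuousLinearMap.flip_apply]
  abel

/-- A one-form that annihilates the tangent spaces of an integral manifold `f` is closed on the
tangent spaces. -/
theorem fderiv_symm_of_integralManifold {U : Type*} [NormedAddCommGroup U] [NormedSpace ℝ U]
    {θ : E → E →L[ℝ] F} {f : U → E} {u : U} (hf : ContDiffAt ℝ ∞ f u)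
    (hθ : ContDiffAt ℝ ∞ θ (f u)) (h : ∀ᶠ y in 𝓝 u, ∀ a, θ (f y) (fderiv ℝ f y a) = 0) (a b : U) :
    fderiv ℝ θ (f u) (fderiv ℝ f u a) (fderiv ℝ f u b) =
      fderiv ℝ θ (f u) (fderiv ℝ f u b) (fderiv ℝ f u a) := by
  -- Differentiate `θ (f y) (Df y b) = 0`; the other term contains the second derivative of `f`,
  -- which is symmetric.
  have key : ∀ a b, fderiv ℝ θ (f u) (fderiv ℝ f u a) (fderiv ℝ f u b) =
      -θ (f u) (fderiv ℝ (fderiv ℝ f) u a b) := by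
    intro a b
    have h1 : HasFDerivAt (fun y => θ (f y)) _ u :=
      HasFDerivAt.comp u (hθ.differentiableAt (by simp)).hasFDerivAt
        (hf.differentiableAt (by simp)).hasFDerivAt
    have h2 := h1.clm_apply ((((fderiv_smooth hf).differentiableAt (by simp)).hasFDerivAt).clm_apply
      (hasFDerivAt_const b u))
    have h3 : (fun y => θ (f y) (fderiv ℝ f y b)) =ᶠ[𝓝 u] fun _ => 0 := by
      filter_upwards [h] with y hy using hy b
    have h4 := congrArg (fun A => A a)
      (h2.unique ((hasFDerivAt_const 0 u).congr_of_eventuallyEq h3))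
    simp only [add_apply, ContinuousLinearMap.comp_apply, ContinuousLinearMap.flip_apply,
      zero_apply, map_zero, zero_add] at h4
    exact eq_neg_of_add_eq_zero_right h4
  rw [key, key, fderiv_fderiv_symm hf]

end ExteriorDerivative

/-! ### Linear algebra of a polarization -/

section LinearAlgebra

variable {E : Type*} [AddCommGroup E] [Module ℝ E] {k n : ℕ}

/-- The orthogonal of `V` with respect to a vector-valued bilinear map. -/
def orth (Ω : E →ₗ[ℝ] E →ₗ[ℝ] (Fin k → ℝ)) (V : Submodule ℝ E) : Submodule ℝ E where
  carrier := {w | ∀ v ∈ V, Ω v w = 0}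
  zero_mem' := by intro v _; simp
  add_mem' := by intro a b ha hb v hv; simp [ha v hv, hb v hv]
  smul_mem' := by intro c a ha v hv; simp [ha v hv]

theorem mem_orth {Ω : E →ₗ[ℝ] E →ₗ[ℝ] (Fin k → ℝ)} {V : Submodule ℝ E} {w : E} :
    w ∈ orth Ω V ↔ ∀ v ∈ V, Ω v w = 0 := Iff.rfl

/-- The structure of a polarization `V` of a `k`-contact vector space: its orthogonal is the sum
of `V` and the kernel, and `Ω` identifies `V` with the `ℝ^k`-valued forms that vanish on it. -/
theorem polarization_orth [FiniteDimensional ℝ E] (hk : 1 ≤ k) (Ω : E →ₗ[ℝ] E →ₗ[ℝ] (Fin k → ℝ))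
    (halt : ∀ v w, Ω v w = -Ω w v) (V : Submodule ℝ E)
    (hdim : Module.finrank ℝ E = n + k * n + k) (hV : Module.finrank ℝ V = n * k)
    (hker : Module.finrank ℝ (LinearMap.ker Ω) = k)
    (hdisj : Disjoint V (LinearMap.ker Ω)) (hiso : ∀ v ∈ V, ∀ w ∈ V, Ω v w = 0) :
    orth Ω V = V ⊔ LinearMap.ker Ω ∧ Module.finrank ℝ (orth Ω V) = n * k + k ∧
      ∀ g : E →ₗ[ℝ] (Fin k → ℝ), (∀ w ∈ orth Ω V, g w = 0) → ∃ v ∈ V, Ω v = g := by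
  set D := orth Ω V with hD
  have hle : V ⊔ LinearMap.ker Ω ≤ D := by
    refine sup_le (fun w hw v hv => hiso v hv w hw) (fun w hw v hv => ?_)
    have hw' : Ω w = 0 := hw
    rw [halt, hw']
    simp
  have hsup : Module.finrank ℝ (V ⊔ LinearMap.ker Ω : Submodule ℝ E) = n * k + k := by
    have h := Submodule.finrank_sup_add_finrank_inf_eq V (LinearMap.ker Ω)
    rw [hdisj.eq_bot, finrank_bot, hV, hker] at h
    simpa using h
  have hDge : n * k + k ≤ Module.finrank ℝ D := hsup ▸ Submodule.finrank_mono hle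
  -- `D` contains `V ⊕ ker Ω`, so `dim D ≥ n k + k`. Injectivity of `τ` gives `n k ≤ k dim (E/D)`,
  -- that is `dim D ≤ n k + k`. Equality of dimensions then makes `τ` bijective.
  let τ : V →ₗ[ℝ] (E ⧸ D) →ₗ[ℝ] (Fin k → ℝ) :=
    { toFun := fun v => D.liftQ (Ω v) (fun w hw => hw v v.2)
      map_add' := by
        intro a b
        refine D.linearMap_qext (LinearMap.ext fun w => ?_)
        change Ω (a + b) w = Ω a w + Ω b w
        rw [map_add]
        rfl
      map_smul' := by
        intro c a
        refine D.linearMap_qext (LinearMap.ext fun w => ?_)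
        change Ω (c • (a : E)) w = c • Ω a w
        rw [map_smul]
        rfl }
  have hτ : ∀ (v : V) w, τ v (D.mkQ w) = Ω v w := fun v w => rfl
  have hτinj : Function.Injective τ := by
    rw [injective_iff_map_eq_zero]
    intro v hv
    have : (v : E) ∈ LinearMap.ker Ω := by
      refine LinearMap.mem_ker.2 (LinearMap.ext fun w => ?_)
      rw [← hτ, hv]
      rfl
    exact Subtype.ext ((Submodule.disjoint_def.1 hdisj) v v.2 this)
  have hquot := D.finrank_quotient_add_finrank
  have hhom : Module.finrank ℝ ((E ⧸ D) →ₗ[ℝ] (Fin k → ℝ)) = Module.finrank ℝ (E ⧸ D) * k := by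
    rw [Module.finrank_linearMap, Module.finrank_fin_fun]
  have hle2 := LinearMap.finrank_le_finrank_of_injective hτinj
  rw [hhom, hV] at hle2
  have hn : n ≤ Module.finrank ℝ (E ⧸ D) := Nat.le_of_mul_le_mul_right hle2 hk
  have hcomm : k * n = n * k := mul_comm _ _
  have hDdim : Module.finrank ℝ D = n * k + k := by omega
  have hqn : Module.finrank ℝ (E ⧸ D) = n := by omega
  refine ⟨(Submodule.eq_of_le_of_finrank_eq hle (by rw [hsup, hDdim])).symm, hDdim,
    fun g hg => ?_⟩
  have hτsurj : Function.Surjective τ :=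
    (LinearMap.injective_iff_surjective_of_finrank_eq_finrank (by rw [hhom, hqn, hV])).1 hτinj
  obtain ⟨v, hv⟩ := hτsurj (D.liftQ g hg)
  refine ⟨v, v.2, LinearMap.ext fun w => ?_⟩
  rw [← hτ, hv]
  rfl

/-- For `k ≥ 2` there are no non-trivial symmetric operators from `V` to a complement of its
orthogonal. -/
theorem mem_orth_of_symmetric (hk : 2 ≤ k) (Ω : E →ₗ[ℝ] E →ₗ[ℝ] (Fin k → ℝ))
    (V : Submodule ℝ E)
    (hrep : ∀ g : E →ₗ[ℝ] (Fin k → ℝ), (∀ w ∈ orth Ω V, g w = 0) → ∃ v ∈ V, Ω v = g)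
    (N : E → E) (hN : ∀ v ∈ V, ∀ w ∈ V, Ω v (N w) = Ω w (N v)) (v : E) (hv : v ∈ V) :
    N v ∈ orth Ω V := by
  -- The component `β` of `Ω u`, moved to slot `γ`, still vanishes on the orthogonal and is
  -- therefore represented by a vector of `V`.
  have hcomp : ∀ u ∈ V, ∀ β γ : Fin k, ∃ u' ∈ V, ∀ z, Ω u' z = Pi.single γ (Ω u z β) := by
    intro u hu β γ
    obtain ⟨u', hu', h⟩ := hrep
      ((LinearMap.single ℝ (fun _ : Fin k => ℝ) γ) ∘ₗ (LinearMap.proj β) ∘ₗ Ω u) (by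
        intro w hw
        simp [hw u hu])
    refine ⟨u', hu', fun z => ?_⟩
    rw [h]
    rfl
  intro w hw
  funext β
  have : Nontrivial (Fin k) := Fin.nontrivial_iff_two_le.2 hk
  obtain ⟨γ, hγ⟩ := exists_ne β
  -- `w'` keeps only component `β` of `w`; `v'` carries component `β` of `v` in slot `γ ≠ β`. Then
  -- `Ω(w, Nv)_β = Ω(w', Nv)_β = Ω(v, Nw')_β = Ω(v', Nw')_γ = Ω(w', Nv')_γ = 0`, because `Ω w'` has
  -- no component `γ`.
  obtain ⟨w', hw', hw1⟩ := hcomp w hw β β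
  obtain ⟨v', hv', hv1⟩ := hcomp v hv β γ
  have h1 : Ω w (N v) β = Ω w' (N v) β := by rw [hw1]; simp
  have h2 : Ω v (N w') β = Ω v' (N w') γ := by rw [hv1]; simp
  rw [h1, hN w' hw' v hv, h2, hN v' hv' w' hw', hw1]
  simp [hγ]

end LinearAlgebra

/-! ### Contractions of `dη` with a frame, and brackets with Reeb fields -/

section Polarized

variable {E : Type*} [NormedAddCommGroup E] [NormedSpace ℝ E] {k n : ℕ}

/-- The exterior derivative at a point, as an algebraic bilinear map. -/
def extDLin (η : E → E →L[ℝ] (Fin k → ℝ)) (x : E) : E →ₗ[ℝ] E →ₗ[ℝ] (Fin k → ℝ) :=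
  (ContinuousLinearMap.coeLM ℝ) ∘ₗ (extD η x).toLinearMap

@[simp] theorem extDLin_apply (η : E → E →L[ℝ] (Fin k → ℝ)) (x v w : E) :
    extDLin η x v w = extD η x v w := rfl

theorem mem_ker_extDLin {η : E → E →L[ℝ] (Fin k → ℝ)} {x v : E} :
    v ∈ LinearMap.ker (extDLin η x) ↔ extD η x v = 0 := by
  rw [LinearMap.mem_ker]
  constructor
  · intro h
    ext1 w
    exact congrArg (fun A => A w) h
  · intro h
    refine LinearMap.ext fun w => ?_
    rw [extDLin_apply, h]
    rfl

theorem ker_extDLin (η : E → E →L[ℝ] (Fin k → ℝ)) (x : E) :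
    LinearMap.ker (extDLin η x) = LinearMap.ker (extD η x).toLinearMap := by
  ext v
  exact mem_ker_extDLin

/-- The conditions on a `k`-contact form on a normed space, at the point `x`. -/
structure KContactAt (η : E → E →L[ℝ] (Fin k → ℝ)) (x : E) : Prop where
  smooth : ContDiffAt ℝ ∞ η x
  corank : Module.finrank ℝ (LinearMap.ker (η x).toLinearMap) + k = Module.finrank ℝ E
  rank : Module.finrank ℝ (LinearMap.ker (extD η x).toLinearMap) = k
  disjoint : ∀ v, η x v = 0 → extD η x v = 0 → v = 0

/-- The forms `ι_X dη` for the members `X` of a finite family of vector fields. -/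
def frameForm {ι : Type} [Fintype ι] [DecidableEq ι] (η : E → E →L[ℝ] (Fin k → ℝ))
    (X : ι → E → E) (x : E) : E →L[ℝ] (ι → Fin k → ℝ) :=
  ∑ a, (ContinuousLinearMap.single ℝ (fun _ : ι => Fin k → ℝ) a).comp (extD η x (X a x))

variable {ι : Type} [Fintype ι] [DecidableEq ι]

@[simp] theorem frameForm_apply (η : E → E →L[ℝ] (Fin k → ℝ)) (X : ι → E → E) (x v : E) (a : ι) :
    frameForm η X x v a = extD η x (X a x) v := by
  simp [frameForm, Finset.sum_apply, Pi.single_apply, Finset.sum_ite_eq]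

theorem frameForm_smooth {η : E → E →L[ℝ] (Fin k → ℝ)} {X : ι → E → E} {x : E}
    (hη : ContDiffAt ℝ ∞ η x) (hX : ∀ a, ContDiffAt ℝ ∞ (X a) x) :
    ContDiffAt ℝ ∞ (frameForm η X) x := by
  refine ContDiffAt.sum fun a _ => ?_
  exact contDiffAt_const.clm_comp ((extD_smooth hη).clm_apply (hX a))

theorem fderiv_frameForm {η : E → E →L[ℝ] (Fin k → ℝ)} {X : ι → E → E} {x : E}
    (hη : ContDiffAt ℝ ∞ η x) (hX : ∀ a, ContDiffAt ℝ ∞ (X a) x) (v w : E) (a : ι) :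
    fderiv ℝ (frameForm η X) x v w a =
      fderiv ℝ (extD η) x v (X a x) w + extD η x (fderiv ℝ (X a) x v) w := by
  have h1 := ((frameForm_smooth hη hX).differentiableAt (by simp)).hasFDerivAt.clm_apply
    (hasFDerivAt_const w x)
  have h2 := (ContinuousLinearMap.proj (R := ℝ) (φ := fun _ : ι => Fin k → ℝ) a).hasFDerivAt.comp
    x h1
  have h3 : HasFDerivAt (fun y => extD η y (X a y) w) _ x :=
    ((hasFDerivAt_extD hη).clm_apply ((hX a).differentiableAt (by simp)).hasFDerivAt).clm_apply
      (hasFDerivAt_const w x)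
  have h4 : (fun y => extD η y (X a y) w) = fun y => (ContinuousLinearMap.proj (R := ℝ)
      (φ := fun _ : ι => Fin k → ℝ) a) (frameForm η X y w) := by
    funext y
    simp
  rw [h4] at h3
  have h5 := congrArg (fun A => A v) (h2.unique h3)
  simp only [add_apply, ContinuousLinearMap.comp_apply, ContinuousLinearMap.flip_apply,
    zero_apply, map_zero, zero_add, ContinuousLinearMap.proj_apply] at h5
  rw [h5]
  abel

/-- Contracting the derivative of the frame forms with a section `Z` of the kernel of `dη`. -/
theorem frameForm_bracket {η : E → E →L[ℝ] (Fin k → ℝ)} {X : ι → E → E} {x : E}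
    (hη : ContDiffAt ℝ ∞ η x) (hX : ∀ a, ContDiffAt ℝ ∞ (X a) x) {Z : E → E}
    (hZ : ContDiffAt ℝ ∞ Z x) (hZ0 : ∀ᶠ y in 𝓝 x, extD η y (Z y) = 0) (w : E) (a : ι) :
    fderiv ℝ (frameForm η X) x (Z x) w a - fderiv ℝ (frameForm η X) x w (Z x) a =
      extD η x (fderiv ℝ (X a) x (Z x) - fderiv ℝ Z x (X a x)) w := by
  -- Invariantly: `L_Z dη = 0` because `ι_Z dη = 0` and `dη` is closed, and so `ι_Z d(ι_X dη) = L_Z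
  -- (ι_X dη) = ι_[Z,X] dη`.
  have hz : ∀ u w, fderiv ℝ (extD η) x u (Z x) w = -extD η x (fderiv ℝ Z x u) w := by
    intro u w
    have h := hasFDerivAt_extD_apply hη hZ (contDiffAt_const (c := w)) u
    have h0 : (fun y => extD η y (Z y) w) =ᶠ[𝓝 x] fun _ => 0 := by
      filter_upwards [hZ0] with y hy
      rw [hy]
      rfl
    rw [h0.fderiv_eq] at h
    simp only [fderiv_fun_const, Pi.zero_apply, zero_apply, map_zero, add_zero] at h
    exact eq_neg_of_add_eq_zero_left h.symm
  have hZx : extD η x (Z x) = 0 := hZ0.self_of_nhds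
  have h1 := fderiv_extD_cyclic hη (Z x) (X a x) w
  have h2 : extD η x (fderiv ℝ (X a) x w) (Z x) = 0 := by
    rw [extD_swap, hZx]
    simp
  rw [fderiv_frameForm hη hX, fderiv_frameForm hη hX, h2, add_zero, map_sub, sub_apply]
  rw [fderiv_extD_swap hη (X a x) w (Z x), hz, fderiv_extD_swap hη w (Z x) (X a x)] at h1
  rw [neg_neg] at h1
  have h3 : fderiv ℝ (extD η) x (Z x) (X a x) w - fderiv ℝ (extD η) x w (X a x) (Z x) =
      -extD η x (fderiv ℝ Z x (X a x)) w := by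
    rw [eq_neg_iff_add_eq_zero, ← h1]
    abel
  rw [sub_eq_add_neg _ (extD η x (fderiv ℝ Z x (X a x)) w), ← h3]
  abel

/-- The Lie brackets of a section `Z` of the kernel of `dη` with the members of an isotropic frame
`X` pair symmetrically with the frame. -/
theorem bracket_symmetric {η : E → E →L[ℝ] (Fin k → ℝ)} {X : ι → E → E} {x : E}
    (hη : ContDiffAt ℝ ∞ η x) (hX : ∀ a, ContDiffAt ℝ ∞ (X a) x)
    (hiso : ∀ᶠ y in 𝓝 x, ∀ a b, extD η y (X a y) (X b y) = 0) {Z : E → E}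
    (hZ : ContDiffAt ℝ ∞ Z x) (hZ0 : ∀ᶠ y in 𝓝 x, extD η y (Z y) = 0) (a b : ι) :
    extD η x (X a x) (fderiv ℝ (X b) x (Z x) - fderiv ℝ Z x (X b x)) =
      extD η x (X b x) (fderiv ℝ (X a) x (Z x) - fderiv ℝ Z x (X a x)) := by
  -- Invariantly: `0 = Z (dη (X_a, X_b)) = dη ([Z, X_a], X_b) + dη (X_a, [Z, X_b])`, since `L_Z dη =
  -- 0`.
  have h0 : (fun y => extD η y (X a y) (X b y)) =ᶠ[𝓝 x] fun _ => 0 := by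
    filter_upwards [hiso] with y hy using hy a b
  have h := hasFDerivAt_extD_apply hη (hX a) (hX b) (Z x)
  rw [h0.fderiv_eq] at h
  simp only [fderiv_fun_const, Pi.zero_apply, zero_apply] at h
  have h1 := frameForm_bracket hη hX hZ hZ0 (X b x) a
  rw [fderiv_frameForm hη hX, fderiv_frameForm hη hX] at h1
  have hZx : extD η x (Z x) = 0 := hZ0.self_of_nhds
  have h2 : extD η x (fderiv ℝ (X a) x (X b x)) (Z x) = 0 := by
    rw [extD_swap, hZx]
    simp
  have hz : fderiv ℝ (extD η) x (X b x) (X a x) (Z x) = extD η x (fderiv ℝ Z x (X b x)) (X a x) := by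
    have h := hasFDerivAt_extD_apply hη hZ (contDiffAt_const (c := X a x)) (X b x)
    have h0 : (fun y => extD η y (Z y) (X a x)) =ᶠ[𝓝 x] fun _ => 0 := by
      filter_upwards [hZ0] with y hy
      rw [hy]
      rfl
    rw [h0.fderiv_eq] at h
    simp only [fderiv_fun_const, Pi.zero_apply, zero_apply, map_zero, add_zero] at h
    rw [fderiv_extD_swap hη, eq_comm, eq_neg_iff_add_eq_zero, add_comm]
    exact h.symm
  rw [h2, hz, add_zero] at h1
  rw [extD_swap η x (X b x), ← h1, map_sub, extD_swap η x (fderiv ℝ Z x (X b x)),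
    eq_neg_iff_add_eq_zero, h]
  abel

end Polarized

/-! ### First integrals of the orthogonal of the polarization, for `k ≥ 2` -/

section PolarizedIntegrals

variable {E : Type*} [NormedAddCommGroup E] [NormedSpace ℝ E] {k n : ℕ}

/-- This makes Frobenius' theorem for `frameForm` a statement about the orthogonal of the spanned
distribution. -/
theorem frameForm_eq_zero_iff {η : E → E →L[ℝ] (Fin k → ℝ)} {ι : Type} [Fintype ι] [DecidableEq ι]
    {X : ι → E → E} {x w : E} : frameForm η X x w = 0 ↔
      w ∈ orth (extDLin η x) (Submodule.span ℝ (Set.range fun a => X a x)) := by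
  rw [mem_orth]
  constructor
  · intro h v hv
    induction hv using Submodule.span_induction with
    | mem v hv =>
      obtain ⟨a, rfl⟩ := hv
      rw [extDLin_apply, ← frameForm_apply, h]
      rfl
    | zero => simp
    | add v v' _ _ h1 h2 => rw [map_add, LinearMap.add_apply, h1, h2, add_zero]
    | smul c v _ h1 => rw [map_smul, LinearMap.smul_apply, h1, smul_zero]
  · intro h
    funext a
    rw [frameForm_apply]
    exact h _ (Submodule.subset_span ⟨a, rfl⟩)

/-- The frame `X` near `x` of a polarization spans the tangent spaces of an integral manifold
through `x`. -/
def HasIntegralManifoldAt {ι : Type} [Fintype ι] (X : ι → E → E) (x : E) : Prop :=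
  ∃ f : (ι → ℝ) → E, ContDiffAt ℝ ∞ f 0 ∧ f 0 = x ∧ ∀ᶠ u in 𝓝 0,
    LinearMap.range (fderiv ℝ f u).toLinearMap = Submodule.span ℝ (Set.range fun a => X a (f u))

/-- One-forms that annihilate a frame of an integrable distribution are closed on it. -/
theorem HasIntegralManifoldAt.fderiv_symm {ι : Type} [Fintype ι] {X : ι → E → E} {x : E}
    (h : HasIntegralManifoldAt X x) {F : Type*} [NormedAddCommGroup F] [NormedSpace ℝ F]
    {θ : E → E →L[ℝ] F} (hθ : ContDiffAt ℝ ∞ θ x) (hX : ∀ᶠ y in 𝓝 x, ∀ a, θ y (X a y) = 0)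
    {v w : E} (hv : v ∈ Submodule.span ℝ (Set.range fun a => X a x))
    (hw : w ∈ Submodule.span ℝ (Set.range fun a => X a x)) :
    fderiv ℝ θ x v w = fderiv ℝ θ x w v := by
  obtain ⟨f, hf, rfl, hr⟩ := h
  rw [← hr.self_of_nhds] at hv hw
  obtain ⟨a, rfl⟩ := hv
  obtain ⟨b, rfl⟩ := hw
  refine fderiv_symm_of_integralManifold hf hθ ?_ a b
  filter_upwards [hr, hf.continuousAt.eventually hX] with u h1 h2 c
  have hc : fderiv ℝ f u c ∈ Submodule.span ℝ (Set.range fun a => X a (f u)) := by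
    rw [← h1]
    exact ⟨c, rfl⟩
  have hle : Submodule.span ℝ (Set.range fun a => X a (f u)) ≤
      LinearMap.ker (θ (f u)).toLinearMap := by
    rw [Submodule.span_le]
    rintro _ ⟨a, rfl⟩
    exact h2 a
  exact hle hc

/-- The data of a polarized `k`-contact form near `x₀`, in terms of a frame of the polarization. -/
structure PolarizedNear (n : ℕ) (η : E → E →L[ℝ] (Fin k → ℝ)) (X : Fin (n * k) → E → E)
    (x₀ : E) : Prop where
  finrank_eq : Module.finrank ℝ E = n + k * n + k
  contact : ∀ᶠ x in 𝓝 x₀, KContactAt η x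
  smooth : ∀ᶠ x in 𝓝 x₀, ∀ a, ContDiffAt ℝ ∞ (X a) x
  independent : ∀ᶠ x in 𝓝 x₀, LinearIndependent ℝ fun a => X a x
  le_ker : ∀ᶠ x in 𝓝 x₀, ∀ a, η x (X a x) = 0
  integrable : ∀ᶠ x in 𝓝 x₀, HasIntegralManifoldAt X x

theorem PolarizedNear.eventually {η : E → E →L[ℝ] (Fin k → ℝ)} {X : Fin (n * k) → E → E} {x₀ : E}
    (h : PolarizedNear n η X x₀) : ∀ᶠ x in 𝓝 x₀, PolarizedNear n η X x := by
  filter_upwards [h.contact.eventually_nhds, h.smooth.eventually_nhds,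
    h.independent.eventually_nhds, h.le_ker.eventually_nhds, h.integrable.eventually_nhds]
    with x h1 h2 h3 h4 h5
  exact ⟨h.finrank_eq, h1, h2, h3, h4, h5⟩

namespace PolarizedNear

variable {η : E → E →L[ℝ] (Fin k → ℝ)} {X : Fin (n * k) → E → E} {x : E}

/-- `η` restricts to zero on the integral manifolds of the polarization, and therefore so does `dη`.
-/
theorem isotropic (h : PolarizedNear n η X x) {v w : E}
    (hv : v ∈ Submodule.span ℝ (Set.range fun a => X a x))
    (hw : w ∈ Submodule.span ℝ (Set.range fun a => X a x)) : extD η x v w = 0 := by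
  rw [extD_apply, sub_eq_zero]
  exact h.integrable.self_of_nhds.fderiv_symm h.contact.self_of_nhds.smooth h.le_ker hv hw

theorem span_le_ker (h : PolarizedNear n η X x) {v : E}
    (hv : v ∈ Submodule.span ℝ (Set.range fun a => X a x)) : η x v = 0 := by
  have hle : Submodule.span ℝ (Set.range fun a => X a x) ≤ LinearMap.ker (η x).toLinearMap := by
    rw [Submodule.span_le]
    rintro _ ⟨a, rfl⟩
    exact h.le_ker.self_of_nhds a
  exact hle hv

variable [FiniteDimensional ℝ E]

theorem orth_span (hk : 1 ≤ k) (h : PolarizedNear n η X x) :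
    orth (extDLin η x) (Submodule.span ℝ (Set.range fun a => X a x)) =
        Submodule.span ℝ (Set.range fun a => X a x) ⊔ LinearMap.ker (extDLin η x) ∧
      Module.finrank ℝ (orth (extDLin η x) (Submodule.span ℝ (Set.range fun a => X a x))) =
        n * k + k ∧
      ∀ g : E →ₗ[ℝ] (Fin k → ℝ), (∀ w ∈ orth (extDLin η x)
        (Submodule.span ℝ (Set.range fun a => X a x)), g w = 0) →
        ∃ v ∈ Submodule.span ℝ (Set.range fun a => X a x), extDLin η x v = g := by
  refine polarization_orth hk _ (fun v w => extD_swap η x v w) _ h.finrank_eq ?_ ?_ ?_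
    (fun v hv w hw => h.isotropic hv hw)
  · rw [finrank_span_eq_card h.independent.self_of_nhds, Fintype.card_fin]
  · rw [ker_extDLin]
    exact h.contact.self_of_nhds.rank
  · rw [Submodule.disjoint_def]
    intro v hv hv'
    exact h.contact.self_of_nhds.disjoint v (h.span_le_ker hv) (mem_ker_extDLin.1 hv')

/-- For `k ≥ 2` the brackets of sections of the Reeb distribution with sections of the polarization
lie in the sum of both distributions. -/
theorem bracket_mem (hk : 2 ≤ k) (h : PolarizedNear n η X x) {Z : E → E}
    (hZ : ContDiffAt ℝ ∞ Z x) (hZ0 : ∀ᶠ y in 𝓝 x, extD η y (Z y) = 0) (a : Fin (n * k)) :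
    fderiv ℝ (X a) x (Z x) - fderiv ℝ Z x (X a x) ∈
      orth (extDLin η x) (Submodule.span ℝ (Set.range fun a => X a x)) := by
  let V := Submodule.span ℝ (Set.range fun a => X a x)
  let N : Fin (n * k) → E := fun a => fderiv ℝ (X a) x (Z x) - fderiv ℝ Z x (X a x)
  let b := Module.Basis.span h.independent.self_of_nhds
  have hb : ∀ a, (b a : E) = X a x := fun a =>
    congrArg Subtype.val (Module.Basis.span_apply h.independent.self_of_nhds a)
  -- The brackets with the frame fields at the point `x` prescribe a linear operator on `V`; its
  -- extension to `E` only fits the form of the algebraic lemma.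
  obtain ⟨N', hN'⟩ := LinearMap.exists_extend (b.constr ℝ N)
  have hN : ∀ a, N' (X a x) = N a := by
    intro a
    rw [← hb, ← b.constr_basis ℝ N a, ← hN']
    rfl
  have hsym : ∀ a b, extD η x (X a x) (N b) = extD η x (X b x) (N a) := by
    intro a b
    refine bracket_symmetric h.contact.self_of_nhds.smooth h.smooth.self_of_nhds ?_ hZ hZ0 a b
    filter_upwards [h.eventually] with y hy a b
    exact hy.isotropic (Submodule.subset_span ⟨a, rfl⟩) (Submodule.subset_span ⟨b, rfl⟩)
  have hsym' : ∀ v ∈ V, ∀ w ∈ V, extDLin η x v (N' w) = extDLin η x w (N' v) := by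
    intro v hv w hw
    induction hv using Submodule.span_induction with
    | mem v hv =>
      obtain ⟨a, rfl⟩ := hv
      induction hw using Submodule.span_induction with
      | mem w hw =>
        obtain ⟨b, rfl⟩ := hw
        simp only [hN]
        exact hsym a b
      | zero => simp
      | add v v' _ _ h1 h2 => simp only [map_add, LinearMap.add_apply, h1, h2]
      | smul c v _ h1 => simp only [map_smul, LinearMap.smul_apply, h1]
    | zero => simp
    | add v v' _ _ h1 h2 => simp only [map_add, LinearMap.add_apply, h1, h2]
    | smul c v _ h1 => simp only [map_smul, LinearMap.smul_apply, h1]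
  have hfin := mem_orth_of_symmetric hk (extDLin η x) V (h.orth_span (by omega)).2.2 N' hsym'
    (X a x) (Submodule.subset_span ⟨a, rfl⟩)
  rwa [hN] at hfin

/-- `V^⊥ = V + ker dη` is isotropic: it is orthogonal to `V` by definition and to `ker dη`
trivially. -/
theorem extD_orth (hk : 1 ≤ k) (h : PolarizedNear n η X x) {v w : E}
    (hv : frameForm η X x v = 0) (hw : frameForm η X x w = 0) : extD η x v w = 0 := by
  rw [frameForm_eq_zero_iff] at hv hw
  rw [(h.orth_span hk).1] at hv
  obtain ⟨v1, hv1, v2, hv2, rfl⟩ := Submodule.mem_sup.1 hv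
  rw [map_add, add_apply, mem_ker_extDLin.1 hv2, zero_apply, add_zero]
  exact hw v1 hv1

/-- For `k ≥ 2` the orthogonal of the polarization is involutive. -/
theorem frameForm_involutive (hk : 2 ≤ k) (h : PolarizedNear n η X x) {v w : E}
    (hv : frameForm η X x v = 0) (hw : frameForm η X x w = 0) :
    fderiv ℝ (frameForm η X) x v w = fderiv ℝ (frameForm η X) x w v := by
  have hη := h.contact.self_of_nhds.smooth
  have hX := h.smooth.self_of_nhds
  -- `ker dη` has constant rank, so the Reeb vector extends to a smooth section. `frameForm_bracket`
  -- then reduces the claim to brackets lying in the isotropic space `V^⊥`.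
  have hreeb : ∀ R w, extD η x R = 0 → frameForm η X x w = 0 →
      fderiv ℝ (frameForm η X) x R w - fderiv ℝ (frameForm η X) x w R = 0 := by
    intro R w hR hw
    obtain ⟨Z, hZ, rfl, hZ0⟩ := exists_smooth_section (extD η) x k
      (h.contact.mono fun y hy => extD_smooth hy.smooth) (h.contact.mono fun y hy => hy.rank) R hR
    funext a
    rw [Pi.sub_apply, frameForm_bracket hη hX hZ hZ0]
    exact h.extD_orth (by omega) (frameForm_eq_zero_iff.2 (h.bracket_mem hk hZ hZ0 a)) hw
  have hV : ∀ v ∈ Submodule.span ℝ (Set.range fun a => X a x), frameForm η X x v = 0 := by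
    intro v hv
    rw [frameForm_eq_zero_iff]
    exact fun u hu => h.isotropic hu hv
  have hpol : ∀ v ∈ Submodule.span ℝ (Set.range fun a => X a x),
      ∀ w ∈ Submodule.span ℝ (Set.range fun a => X a x),
      fderiv ℝ (frameForm η X) x v w - fderiv ℝ (frameForm η X) x w v = 0 := by
    intro v hv w hw
    rw [sub_eq_zero]
    refine h.integrable.self_of_nhds.fderiv_symm (frameForm_smooth hη hX) ?_ hv hw
    filter_upwards [h.eventually] with y hy a
    rw [frameForm_eq_zero_iff]
    exact fun u hu => hy.isotropic hu (Submodule.subset_span ⟨a, rfl⟩)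
  have hker : ∀ R, extD η x R = 0 → frameForm η X x R = 0 := by
    intro R hR
    funext a
    rw [frameForm_apply, extD_swap, hR]
    simp
  rw [frameForm_eq_zero_iff, (h.orth_span (by omega)).1] at hv hw
  obtain ⟨v1, hv1, v2, hv2, rfl⟩ := Submodule.mem_sup.1 hv
  obtain ⟨w1, hw1, w2, hw2, rfl⟩ := Submodule.mem_sup.1 hw
  rw [mem_ker_extDLin] at hv2 hw2
  have e1 := hpol v1 hv1 w1 hw1
  have e2 := hreeb v2 w1 hv2 (hV w1 hw1)
  have e3 := hreeb w2 v1 hw2 (hV v1 hv1)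
  have e4 := hreeb v2 w2 hv2 (hker w2 hw2)
  rw [sub_eq_zero] at e1 e2 e3 e4
  simp only [map_add, add_apply]
  rw [e1, e2, e3, e4]
  abel

/-- For `k ≥ 2` the orthogonal of the polarization has first integrals. -/
theorem exists_firstIntegrals (hk : 2 ≤ k) (h : PolarizedNear n η X x) :
    ∃ q : E → Fin n → ℝ, (∀ᶠ y in 𝓝 x, ContDiffAt ℝ ∞ q y) ∧
      ∀ᶠ y in 𝓝 x, Function.Surjective (fderiv ℝ q y) ∧ (∀ a, fderiv ℝ q y (X a y) = 0) ∧
        ∀ v w, fderiv ℝ q y v = 0 → fderiv ℝ q y w = 0 → extD η y v w = 0 := by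
  obtain ⟨q, hq, hq'⟩ := frobenius_of_constantRank (frameForm η X) x (n * k + k)
    (h.eventually.mono fun y hy => frameForm_smooth hy.contact.self_of_nhds.smooth
      hy.smooth.self_of_nhds)
    (h.eventually.mono fun y hy => by
      rw [← (hy.orth_span (by omega)).2.1]
      have : LinearMap.ker (frameForm η X y).toLinearMap =
          orth (extDLin η y) (Submodule.span ℝ (Set.range fun a => X a y)) := by
        ext w
        exact frameForm_eq_zero_iff
      exact congrArg (fun S : Submodule ℝ E => Module.finrank ℝ S) this)
    (h.eventually.mono fun y hy v w hv hw => hy.frameForm_involutive hk hv hw)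
    (m := n) (by rw [h.finrank_eq]; ring)
  refine ⟨q, hq, ?_⟩
  filter_upwards [hq', h.eventually] with y h1 h2
  refine ⟨h1.1, fun a => ?_, fun v w hv hw => h2.extD_orth (by omega) ((h1.2 v).1 hv)
    ((h1.2 w).1 hw)⟩
  rw [h1.2, frameForm_eq_zero_iff]
  exact fun u hu => h2.isotropic hu (Submodule.subset_span ⟨a, rfl⟩)

end PolarizedNear

end PolarizedIntegrals

/-! ### Coisotropic foliations of a contact manifold, for `k = 1` -/

section Coisotropic

/-- For `k = 1` the form is an ordinary scalar reflexive form, and `ker Ω ≤ C` removes the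
correction term of the usual dimension formula. -/
theorem finrank_add_finrank_orth {E : Type*} [AddCommGroup E] [Module ℝ E] [FiniteDimensional ℝ E]
    (Ω : E →ₗ[ℝ] E →ₗ[ℝ] (Fin 1 → ℝ)) (halt : ∀ v w, Ω v w = -Ω w v) (C : Submodule ℝ E)
    (hC : LinearMap.ker Ω ≤ C) : Module.finrank ℝ C + Module.finrank ℝ (orth Ω C) =
      Module.finrank ℝ E + Module.finrank ℝ (LinearMap.ker Ω) := by
  let B : LinearMap.BilinForm ℝ E := LinearMap.mk₂ ℝ (fun v w => Ω v w 0)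
    (by intros; simp) (by intros; simp) (by intros; simp) (by intros; simp)
  have hB : ∀ v w, B v w = 0 ↔ Ω v w = 0 := by
    intro v w
    constructor
    · intro h
      funext i
      rw [Subsingleton.elim i 0]
      exact h
    · intro h
      exact congrFun h 0
  have hrefl : B.IsRefl := by
    intro v w h
    rw [hB] at h ⊢
    rw [halt, h, neg_zero]
  have h := LinearMap.BilinForm.finrank_add_finrank_orthogonal hrefl C
  have h1 : B.orthogonal C = orth Ω C := by
    ext w
    rw [LinearMap.BilinForm.mem_orthogonal_iff, mem_orth]
    exact forall₂_congr fun v _ => hB v w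
  have h2 : B.orthogonal ⊤ = LinearMap.ker Ω := by
    ext w
    rw [LinearMap.BilinForm.mem_orthogonal_iff, LinearMap.mem_ker]
    constructor
    · intro h
      refine LinearMap.ext fun v => ?_
      rw [halt, (hB v w).1 (h v trivial), neg_zero]
      rfl
    · intro h v _
      refine (hB v w).2 ?_
      rw [halt, h]
      simp
  rw [h1, h2, inf_eq_right.2 hC] at h
  exact h

variable {E : Type*} [NormedAddCommGroup E] [NormedSpace ℝ E] {n m : ℕ}

/-- The fibres of `Q` near `x` are coisotropic for the contact form `η`. -/
structure CoisotropicNear (n : ℕ) (η : E → E →L[ℝ] (Fin 1 → ℝ)) (Q : E → Fin m → ℝ) (x : E) :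
    Prop where
  finrank_eq : Module.finrank ℝ E = n + 1 * n + 1
  contact : ∀ᶠ y in 𝓝 x, KContactAt η y
  smooth : ∀ᶠ y in 𝓝 x, ContDiffAt ℝ ∞ Q y
  surjective : ∀ᶠ y in 𝓝 x, Function.Surjective (fderiv ℝ Q y)
  coisotropic : ∀ᶠ y in 𝓝 x, ∀ v, (∀ w, fderiv ℝ Q y w = 0 → extD η y w v = 0) →
    fderiv ℝ Q y v = 0

namespace CoisotropicNear

variable {η : E → E →L[ℝ] (Fin 1 → ℝ)} {Q : E → Fin m → ℝ} {x : E}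

theorem eventually (h : CoisotropicNear n η Q x) : ∀ᶠ y in 𝓝 x, CoisotropicNear n η Q y := by
  filter_upwards [h.contact.eventually_nhds, h.smooth.eventually_nhds,
    h.surjective.eventually_nhds, h.coisotropic.eventually_nhds] with x h1 h2 h3 h4
  exact ⟨h.finrank_eq, h1, h2, h3, h4⟩

theorem orth_le (h : CoisotropicNear n η Q x) :
    orth (extDLin η x) (LinearMap.ker (fderiv ℝ Q x).toLinearMap) ≤
      LinearMap.ker (fderiv ℝ Q x).toLinearMap :=
  fun v hv => h.coisotropic.self_of_nhds v fun w hw => hv w hw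

theorem ker_extDLin_le_orth (η : E → E →L[ℝ] (Fin 1 → ℝ)) (x : E) (C : Submodule ℝ E) :
    LinearMap.ker (extDLin η x) ≤ orth (extDLin η x) C := by
  intro v hv w _
  rw [extDLin_apply, extD_swap, mem_ker_extDLin.1 hv]
  simp

variable [FiniteDimensional ℝ E]

theorem finrank_ker (h : CoisotropicNear n η Q x) :
    m + Module.finrank ℝ (LinearMap.ker (fderiv ℝ Q x).toLinearMap) = n + 1 * n + 1 := by
  have h1 := (fderiv ℝ Q x).toLinearMap.finrank_range_add_finrank_ker
  rw [LinearMap.range_eq_top.2 h.surjective.self_of_nhds, finrank_top, Module.finrank_fin_fun,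
    h.finrank_eq] at h1
  exact h1

theorem finrank_orth (h : CoisotropicNear n η Q x) {C : Submodule ℝ E}
    (hC : LinearMap.ker (extDLin η x) ≤ C) :
    Module.finrank ℝ C + Module.finrank ℝ (orth (extDLin η x) C) = n + 1 * n + 2 := by
  rw [finrank_add_finrank_orth _ (fun v w => extD_swap η x v w) C hC, h.finrank_eq, ker_extDLin,
    h.contact.self_of_nhds.rank]

/-- The fibres have dimension `2n + 1 - m`. They contain the Reeb line, so their dimension and that
of their orthogonal add up to `2n + 2`. -/
theorem finrank_orth_ker (h : CoisotropicNear n η Q x) :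
    Module.finrank ℝ (orth (extDLin η x) (LinearMap.ker (fderiv ℝ Q x).toLinearMap)) = m + 1 := by
  have h1 := h.finrank_orth ((ker_extDLin_le_orth η x _).trans h.orth_le)
  have h2 := h.finrank_ker
  omega

/-- The fibres of `q`, when there are as many components as possible, are isotropic. -/
theorem isotropic {Q : E → Fin n → ℝ} (h : CoisotropicNear n η Q x) (v w : E)
    (hv : fderiv ℝ Q x v = 0) (hw : fderiv ℝ Q x w = 0) : extD η x v w = 0 := by
  -- For `m = n` both dimensions are `n + 1`, so the tangent space of a fibre is its own orthogonal.
  have heq := Submodule.eq_of_le_of_finrank_eq h.orth_le (by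
    have h1 := h.finrank_orth_ker
    have h2 := h.finrank_ker
    omega)
  have hw' : w ∈ LinearMap.ker (fderiv ℝ Q x).toLinearMap := hw
  rw [← heq] at hw'
  exact hw' v hv

/-- Near a point there is a finite family of vector fields spanning the tangent spaces of the fibres
of a submersion. -/
theorem exists_spanning_fields (h : CoisotropicNear n η Q x) :
    ∃ X : Fin (Module.finrank ℝ E) → E → E, (∀ᶠ y in 𝓝 x, ∀ a, ContDiffAt ℝ ∞ (X a) y) ∧
      ∀ᶠ y in 𝓝 x, Submodule.span ℝ (Set.range fun a => X a y) =
        LinearMap.ker (fderiv ℝ Q y).toLinearMap := by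
  obtain ⟨R, hR, hRQ⟩ := exists_smooth_rightInverse (fderiv ℝ Q) x
    (h.smooth.mono fun y hy => fderiv_smooth hy) h.surjective.self_of_nhds
  let b := Module.finBasis ℝ E
  -- The projections to `ker dQ` of a basis of `E`. Only spanning is needed, so the dependence among
  -- them does no harm.
  refine ⟨fun a y => b a - R y (fderiv ℝ Q y (b a)), ?_, ?_⟩
  · filter_upwards [hR, h.smooth] with y h1 h2 a
    exact contDiffAt_const.sub (h1.clm_apply ((fderiv_smooth h2).clm_apply contDiffAt_const))
  · filter_upwards [hRQ] with y hy
    apply le_antisymm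
    · rw [Submodule.span_le]
      rintro _ ⟨a, rfl⟩
      change fderiv ℝ Q y (b a - R y (fderiv ℝ Q y (b a))) = 0
      rw [map_sub, hy, sub_self]
    · intro v hv
      have hv' : fderiv ℝ Q y v = 0 := hv
      have h1 : v = ∑ a, b.repr v a • (b a - R y (fderiv ℝ Q y (b a))) := by
        simp only [smul_sub, Finset.sum_sub_distrib, ← map_smul, ← map_sum, b.sum_repr, hv',
          map_zero, sub_zero]
      rw [h1]
      exact Submodule.sum_mem _ fun a _ => Submodule.smul_mem _ _ (Submodule.subset_span ⟨a, rfl⟩)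

/-- The characteristic distribution of a coisotropic foliation is involutive. -/
theorem frameForm_involutive (h : CoisotropicNear n η Q x) {ι : Type} [Fintype ι] [DecidableEq ι]
    {X : ι → E → E} (hX : ∀ᶠ y in 𝓝 x, ∀ a, ContDiffAt ℝ ∞ (X a) y)
    (hspan : ∀ᶠ y in 𝓝 x, Submodule.span ℝ (Set.range fun a => X a y) =
      LinearMap.ker (fderiv ℝ Q y).toLinearMap) {v w : E}
    (hv : frameForm η X x v = 0) (hw : frameForm η X x w = 0) :
    fderiv ℝ (frameForm η X) x v w = fderiv ℝ (frameForm η X) x w v := by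
  have hη := h.contact.self_of_nhds.smooth
  have hXx := hX.self_of_nhds
  have hmem : ∀ᶠ y in 𝓝 x, ∀ u, frameForm η X y u = 0 ↔
      u ∈ orth (extDLin η y) (LinearMap.ker (fderiv ℝ Q y).toLinearMap) := by
    filter_upwards [hspan] with y hy u
    rw [frameForm_eq_zero_iff, hy]
  have hker : ∀ᶠ y in 𝓝 x, ∀ u, frameForm η X y u = 0 → fderiv ℝ Q y u = 0 := by
    filter_upwards [hmem, h.eventually] with y h1 h2 u hu
    exact h2.orth_le ((h1 u).1 hu)
  have hrank : ∀ᶠ y in 𝓝 x,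
      Module.finrank ℝ (LinearMap.ker (frameForm η X y).toLinearMap) = m + 1 := by
    filter_upwards [hmem, h.eventually] with y h1 h2
    rw [← h2.finrank_orth_ker]
    have : LinearMap.ker (frameForm η X y).toLinearMap =
        orth (extDLin η y) (LinearMap.ker (fderiv ℝ Q y).toLinearMap) := by
      ext u
      exact h1 u
    exact congrArg (fun S : Submodule ℝ E => Module.finrank ℝ S) this
  have hsm : ∀ᶠ y in 𝓝 x, ContDiffAt ℝ ∞ (frameForm η X) y := by
    filter_upwards [hX, h.contact] with y h1 h2 using frameForm_smooth h2.smooth h1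
  obtain ⟨Y, hY, hYx, hY0⟩ := exists_smooth_section _ x _ hsm hrank v hv
  obtain ⟨Z, hZ, hZx, hZ0⟩ := exists_smooth_section _ x _ hsm hrank w hw
  have hXQ : ∀ᶠ y in 𝓝 x, ∀ a, fderiv ℝ Q y (X a y) = 0 := by
    filter_upwards [hspan] with y hy a
    have : X a y ∈ LinearMap.ker (fderiv ℝ Q y).toLinearMap := by
      rw [← hy]
      exact Submodule.subset_span ⟨a, rfl⟩
    exact this
  have hQs := h.smooth.self_of_nhds
  have hDQ : ∀ {X : E → E}, ContDiffAt ℝ ∞ X x → (∀ᶠ y in 𝓝 x, fderiv ℝ Q y (X y) = 0) → ∀ u,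
      fderiv ℝ Q x (fderiv ℝ X x u) = -fderiv ℝ (fderiv ℝ Q) x u (X x) := by
    intro X hX h0 u
    have h1 := ((fderiv_smooth hQs).differentiableAt (by simp)).hasFDerivAt.clm_apply
      (hX.differentiableAt (by simp)).hasFDerivAt
    have h2 := congrArg (fun A => A u)
      (h1.unique ((hasFDerivAt_const (0 : Fin m → ℝ) x).congr_of_eventuallyEq h0))
    simp only [add_apply, ContinuousLinearMap.comp_apply, ContinuousLinearMap.flip_apply,
      zero_apply] at h2
    exact eq_neg_of_add_eq_zero_left h2
  -- `Y` and `X a` are both tangent to the fibres of `Q`, hence so is their bracket, and `w` is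
  -- orthogonal to all vectors tangent to the fibres.
  have hbr : ∀ {Y : E → E}, ContDiffAt ℝ ∞ Y x → (∀ᶠ y in 𝓝 x, frameForm η X y (Y y) = 0) → ∀ a,
      ∀ w, frameForm η X x w = 0 →
        extD η x (fderiv ℝ (X a) x (Y x) - fderiv ℝ Y x (X a x)) w = 0 := by
    intro Y hY hY0 a w hw
    refine (hmem.self_of_nhds w).1 hw _ ?_
    change fderiv ℝ Q x _ = 0
    rw [map_sub, hDQ (hXx a) (hXQ.mono fun y hy => hy a),
      hDQ hY ((hker.and hY0).mono fun y hy => hy.1 _ hy.2), fderiv_fderiv_symm hQs]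
    abel
  have hYZ : (fun y => extD η y (Y y) (Z y)) =ᶠ[𝓝 x] fun _ => 0 := by
    filter_upwards [hmem, hker, hY0, hZ0] with y h1 h2 h3 h4
    exact (h1 _).1 h4 _ (h2 _ h3)
  funext a
  -- Closedness of `dη` on `Y`, `Z`, `X a`: the function `dη (Y, Z)` vanishes identically and the
  -- brackets with `X a` contribute nothing, which leaves `dη (X a, [Y, Z]) = 0`.
  have h1 := hasFDerivAt_extD_apply hη hY hZ (X a x)
  rw [hYZ.fderiv_eq] at h1
  simp only [fderiv_fun_const, Pi.zero_apply, zero_apply] at h1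
  have h2 := fderiv_extD_cyclic hη v (X a x) w
  have h3 := hbr hY hY0 a w hw
  have h4 := hbr hZ hZ0 a v hv
  rw [map_sub, sub_apply, sub_eq_zero] at h3 h4
  rw [hYx] at h1 h3
  rw [hZx] at h1 h4
  rw [fderiv_frameForm hη hXx, fderiv_frameForm hη hXx, h3, h4, ← sub_eq_zero]
  rw [fderiv_extD_swap hη (X a x) w v, fderiv_extD_swap hη w v (X a x)] at h2
  rw [extD_swap η x v (fderiv ℝ Z x (X a x))] at h1
  have h5 : fderiv ℝ (extD η) x v (X a x) w - fderiv ℝ (extD η) x w (X a x) v =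
      fderiv ℝ (extD η) x (X a x) v w := by
    rw [sub_eq_iff_eq_add, ← sub_eq_zero, ← h2]
    abel
  rw [add_sub_add_comm, h5, h1]
  abel

/-- A coisotropic foliation of corank `m < n` is contained in the fibres of one more function,
together with which it is still coisotropic. -/
theorem exists_succ (h : CoisotropicNear n η Q x) (hm : m < n) :
    ∃ Q' : E → Fin (m + 1) → ℝ, CoisotropicNear n η Q' x := by
  obtain ⟨X, hX, hspan⟩ := h.exists_spanning_fields
  have hmem : ∀ᶠ y in 𝓝 x, ∀ u, frameForm η X y u = 0 ↔
      u ∈ orth (extDLin η y) (LinearMap.ker (fderiv ℝ Q y).toLinearMap) := by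
    filter_upwards [hspan] with y hy u
    rw [frameForm_eq_zero_iff, hy]
  obtain ⟨l, hl⟩ : ∃ l, (m + 1) + l = n + 1 * n + 1 := ⟨n + 1 * n + 1 - (m + 1), by omega⟩
  obtain ⟨G, hG, hG'⟩ := frobenius_of_constantRank (frameForm η X) x (m + 1) (by
      filter_upwards [hX, h.contact] with y h1 h2 using frameForm_smooth h2.smooth h1) (by
      filter_upwards [hmem, h.eventually] with y h1 h2
      rw [← h2.finrank_orth_ker]
      have : LinearMap.ker (frameForm η X y).toLinearMap =
          orth (extDLin η y) (LinearMap.ker (fderiv ℝ Q y).toLinearMap) := by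
        ext u
        exact h1 u
      exact congrArg (fun S : Submodule ℝ E => Module.finrank ℝ S) this) (by
      filter_upwards [h.eventually, hX.eventually_nhds, hspan.eventually_nhds]
        with y h1 h2 h3 v w hv hw
      exact h1.frameForm_involutive h2 h3 hv hw) (m := l) (by rw [hl, h.finrank_eq])
  -- If all first integrals were constant on the fibres of `Q`, the fibres would be isotropic. Then
  -- `2n + 1 - m ≤ m + 1`, contrary to `m < n`.
  obtain ⟨v₀, hv₀, i, hi⟩ : ∃ v₀, fderiv ℝ Q x v₀ = 0 ∧ ∃ i, fderiv ℝ G x v₀ i ≠ 0 := by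
    by_contra! hcon
    have hle : LinearMap.ker (fderiv ℝ Q x).toLinearMap ≤
        orth (extDLin η x) (LinearMap.ker (fderiv ℝ Q x).toLinearMap) := by
      intro v hv
      rw [← hmem.self_of_nhds, ← hG'.self_of_nhds.2]
      exact funext fun i => hcon v hv i
    have h1 := Submodule.finrank_mono hle
    have h2 := h.finrank_orth_ker
    have h3 := h.finrank_ker
    omega
  let g : E → ℝ := fun y => G y i
  have hg : ∀ᶠ y in 𝓝 x, ContDiffAt ℝ ∞ g y := by
    filter_upwards [hG] with y hy using (contDiffAt_pi.1 hy) i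
  have hgd : ∀ᶠ y in 𝓝 x, ∀ v, fderiv ℝ g y v = fderiv ℝ G y v i := by
    filter_upwards [hG] with y hy v
    have h1 : HasFDerivAt g _ y := (ContinuousLinearMap.proj (R := ℝ) (φ := fun _ : Fin l => ℝ)
      i).hasFDerivAt.comp y (hy.differentiableAt (by simp)).hasFDerivAt
    rw [h1.fderiv]
    rfl
  let Λ : (ℝ × (Fin m → ℝ)) ≃L[ℝ] (Fin (m + 1) → ℝ) := ContinuousLinearEquiv.ofFinrankEq
    (by simp [add_comm])
  have hQ' : ∀ᶠ y in 𝓝 x, ContDiffAt ℝ ∞ (fun y => Λ (g y, Q y)) y := by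
    filter_upwards [hg, h.smooth] with y h1 h2
    exact Λ.contDiff.contDiffAt.comp y (h1.prodMk h2)
  have hd : ∀ᶠ y in 𝓝 x, ∀ v, fderiv ℝ (fun y => Λ (g y, Q y)) y v =
      Λ (fderiv ℝ g y v, fderiv ℝ Q y v) := by
    filter_upwards [hg, h.smooth] with y h1 h2 v
    have h3 : HasFDerivAt (fun y => Λ (g y, Q y)) _ y := Λ.hasFDerivAt.comp y
      ((h1.differentiableAt (by simp)).hasFDerivAt.prodMk
        (h2.differentiableAt (by simp)).hasFDerivAt)
    rw [h3.fderiv]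
    rfl
  have hd0 : ∀ᶠ y in 𝓝 x, ∀ v, fderiv ℝ (fun y => Λ (g y, Q y)) y v = 0 ↔
      fderiv ℝ g y v = 0 ∧ fderiv ℝ Q y v = 0 := by
    filter_upwards [hd] with y hy v
    rw [hy, map_eq_zero_iff Λ Λ.injective, Prod.mk_eq_zero]
  refine ⟨fun y => Λ (g y, Q y), h.finrank_eq, h.contact, hQ', ?_, ?_⟩
  · refine eventually_surjective _ x (hQ'.mono fun y hy => fderiv_smooth hy) fun u => ?_
    obtain ⟨v, hv⟩ := h.surjective.self_of_nhds (Λ.symm u).2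
    -- A multiple of `v₀` adjusts the value of `dg` without changing that of `dQ`.
    refine ⟨v + (((Λ.symm u).1 - fderiv ℝ g x v) / fderiv ℝ g x v₀) • v₀, ?_⟩
    rw [hd.self_of_nhds, ← Λ.eq_symm_apply]
    have hne : fderiv ℝ g x v₀ ≠ 0 := by rw [hgd.self_of_nhds]; exact hi
    refine Prod.ext ?_ ?_
    · simp only [map_add, map_smul, smul_eq_mul]
      field_simp
      ring
    · simp [hv₀, hv]
  · filter_upwards [h.eventually, hd0, hmem, hG', hgd] with y h1 h2 h3 h4 h5 v hv
    set C := LinearMap.ker (fderiv ℝ Q y).toLinearMap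
    set K := orth (extDLin η y) C
    have hKg : ∀ u ∈ K, fderiv ℝ g y u = 0 := by
      intro u hu
      rw [h5, (h4.2 u).2 ((h3 u).2 hu)]
      rfl
    -- `g` is a first integral of `K = C^⊥ ⊆ C`, so `v` is orthogonal to `K`, and `K^⊥ = C` by
    -- dimension.
    have hvC : v ∈ C := by
      have hker := ker_extDLin_le_orth η y C
      have hle : C ≤ orth (extDLin η y) K := by
        intro u hu w hw
        rw [extDLin_apply, extD_swap, ← extDLin_apply, hw u hu, neg_zero]
      have heq := Submodule.eq_of_le_of_finrank_eq hle (by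
        have e1 := h1.finrank_orth (hker.trans h1.orth_le)
        have e2 := h1.finrank_orth hker
        change Module.finrank ℝ C + Module.finrank ℝ K = _ at e1
        change Module.finrank ℝ K + Module.finrank ℝ (orth (extDLin η y) K) = _ at e2
        omega)
      rw [heq]
      exact fun w hw => hv w ((h2 w).2 ⟨hKg w hw, h1.orth_le hw⟩)
    have hvC' : fderiv ℝ Q y v = 0 := hvC
    refine (h2 v).2 ⟨?_, hvC'⟩
    -- If `dg v ≠ 0`, then `C` is spanned by `v` and `C ∩ ker dg`. As `v` is orthogonal to both, it
    -- lies in `K`, where `dg` vanishes.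
    by_contra hne
    refine hne (hKg v fun w hw => ?_)
    have hw' : fderiv ℝ Q y w = 0 := hw
    have h6 := hv (w - (fderiv ℝ g y w / fderiv ℝ g y v) • v) ((h2 _).2 ⟨by
      rw [map_sub, map_smul, smul_eq_mul, div_mul_cancel₀ _ hne, sub_self], by
      rw [map_sub, map_smul, hvC', hw', smul_zero, sub_zero]⟩)
    rw [map_sub, map_smul, sub_apply, smul_apply, extD_self, smul_zero, sub_zero] at h6
    exact h6

end CoisotropicNear

/-- Near every point of a contact manifold there are `n` independent functions in involution that
are invariant under the Reeb flow. -/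
theorem exists_involutive_functions [FiniteDimensional ℝ E] (η : E → E →L[ℝ] (Fin 1 → ℝ)) (x : E)
    (hdim : Module.finrank ℝ E = n + 1 * n + 1) (hη : ∀ᶠ y in 𝓝 x, KContactAt η y) :
    ∃ q : E → Fin n → ℝ, (∀ᶠ y in 𝓝 x, ContDiffAt ℝ ∞ q y) ∧
      ∀ᶠ y in 𝓝 x, Function.Surjective (fderiv ℝ q y) ∧
        ∀ v w, fderiv ℝ q y v = 0 → fderiv ℝ q y w = 0 → extD η y v w = 0 := by
  have key : ∀ m ≤ n, ∃ Q : E → Fin m → ℝ, CoisotropicNear n η Q x := by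
    intro m
    induction m with
    | zero =>
      intro _
      exact ⟨fun _ => 0, hdim, hη, Filter.Eventually.of_forall fun y => contDiffAt_const,
        Filter.Eventually.of_forall fun y u => ⟨0, Subsingleton.elim _ _⟩,
        Filter.Eventually.of_forall fun y v _ => Subsingleton.elim _ _⟩
    | succ m ih =>
      intro hm
      obtain ⟨Q, hQ⟩ := ih (by omega)
      exact hQ.exists_succ (by omega)
  obtain ⟨q, hq⟩ := key n le_rfl
  refine ⟨q, hq.smooth, ?_⟩
  filter_upwards [hq.eventually] with y hy
  exact ⟨hy.surjective.self_of_nhds, hy.isotropic⟩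

end Coisotropic

/-! ### Isotropic subspaces of the `(q, p)`-space -/

section LegendrianSubspaces

variable {k n : ℕ}

/-- For every subspace of `ℝ^n` some of the standard coordinates form linear coordinates of it. -/
theorem exists_coordinate_subset (A : Submodule ℝ (Fin n → ℝ)) :
    ∃ I : Finset (Fin n), I.card = Module.finrank ℝ A ∧
      (∀ q ∈ A, (∀ i ∈ I, q i = 0) → q = 0) ∧
      ∀ p : Fin n → ℝ, (∀ j ∉ I, p j = 0) → (∀ q ∈ A, ∑ i, p i * q i = 0) → p = 0 := by
  let c : Fin n → Module.Dual ℝ A := fun i => (LinearMap.proj i) ∘ₗ A.subtype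
  have hc : ∀ i (q : A), c i q = (q : Fin n → ℝ) i := fun i q => rfl
  -- A maximal independent family among the coordinates restricted to `A`. That it spans makes these
  -- coordinates separate points of `A`; that it is independent rules out the relation `∑ p_i q^i =
  -- 0` with support in `I`.
  obtain ⟨κ, a, ha, hspan, hli⟩ := exists_linearIndependent' ℝ c
  have : Fintype κ := Fintype.ofInjective a ha
  classical
  have hmem : ∀ i, i ∈ Finset.univ.image a ↔ ∃ t, a t = i := by simp
  have hkey : ∀ q : A, (∀ t, (q : Fin n → ℝ) (a t) = 0) → q = 0 := by
    intro q hq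
    have h1 : ∀ f ∈ Submodule.span ℝ (Set.range c), f q = 0 := by
      rw [← hspan]
      intro f hf
      induction hf using Submodule.span_induction with
      | mem f hf =>
        obtain ⟨t, rfl⟩ := hf
        exact hq t
      | zero => rfl
      | add f g _ _ h1 h2 => rw [LinearMap.add_apply, h1, h2, add_zero]
      | smul r f _ h1 => rw [LinearMap.smul_apply, h1, smul_zero]
    exact Subtype.ext (funext fun i => h1 _ (Submodule.subset_span ⟨i, rfl⟩))
  refine ⟨Finset.univ.image a, ?_, ?_, ?_⟩
  · rw [Finset.card_image_of_injective _ ha, Finset.card_univ, ← Subspace.dual_finrank_eq]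
    apply le_antisymm hli.fintype_card_le_finrank
    have hinj : Function.Injective ((LinearMap.pi fun t => c (a t)) : A →ₗ[ℝ] κ → ℝ) := by
      rw [injective_iff_map_eq_zero]
      exact fun q hq => hkey q fun t => congrFun hq t
    have h2 := LinearMap.finrank_le_finrank_of_injective hinj
    rw [Subspace.dual_finrank_eq]
    simpa using h2
  · intro q hq h0
    have := hkey ⟨q, hq⟩ fun t => h0 _ ((hmem _).2 ⟨t, rfl⟩)
    exact congrArg Subtype.val this
  · intro p hp hpq
    have h1 : ∑ t, p (a t) • c (a t) = 0 := by
      refine LinearMap.ext fun q => ?_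
      rw [LinearMap.sum_apply, LinearMap.zero_apply, ← hpq q q.2]
      have h2 : ∑ t, (p (a t) • c (a t)) q =
          ∑ i ∈ Finset.univ.image a, p i * (q : Fin n → ℝ) i := by
        rw [Finset.sum_image (fun _ _ _ _ h => ha h)]
        rfl
      rw [h2]
      refine Finset.sum_subset (Finset.subset_univ _) fun i _ hi => ?_
      rw [hp i hi, zero_mul]
    have h3 := Fintype.linearIndependent_iff.1 hli _ h1
    funext i
    by_cases hi : i ∈ Finset.univ.image a
    · obtain ⟨t, rfl⟩ := (hmem i).1 hi
      exact h3 t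
    · exact hp i hi

/-- The model of the form `dη` on the space of all `(q, p)`. -/
def modelForm (u w : (Fin n → ℝ) × (Fin n → Fin k → ℝ)) (α : Fin k) : ℝ :=
  ∑ i, (w.2 i α * u.1 i - u.2 i α * w.1 i)

/-- The dimension of an isotropic subspace is bounded by the dimension of its projection. -/
theorem finrank_isotropic_le (T : Submodule ℝ ((Fin n → ℝ) × (Fin n → Fin k → ℝ)))
    (hT : ∀ u ∈ T, ∀ w ∈ T, ∀ α, modelForm u w α = 0) :
    Module.finrank ℝ T ≤ Module.finrank ℝ (T.map (LinearMap.fst ℝ _ _)) +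
      k * (n - Module.finrank ℝ (T.map (LinearMap.fst ℝ (Fin n → ℝ) (Fin n → Fin k → ℝ)))) := by
  set A := T.map (LinearMap.fst ℝ (Fin n → ℝ) (Fin n → Fin k → ℝ)) with hA
  let π : T →ₗ[ℝ] (Fin n → ℝ) := (LinearMap.fst ℝ _ _) ∘ₗ T.subtype
  have hπ : LinearMap.range π = A := by
    rw [LinearMap.range_comp, Submodule.range_subtype]
  have hrn := π.finrank_range_add_finrank_ker
  rw [hπ] at hrn
  rw [← hrn]
  refine Nat.add_le_add_left ?_ _
  let δ : (Fin n → Fin k → ℝ) →ₗ[ℝ] (Fin n → ℝ) →ₗ[ℝ] (Fin k → ℝ) := LinearMap.mk₂ ℝ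
    (fun p q α => ∑ i, p i α * q i)
    (by intros; funext α; simp [add_mul, Finset.sum_add_distrib])
    (by intros; funext α; simp [mul_assoc, Finset.mul_sum])
    (by intros; funext α; simp [mul_add, Finset.sum_add_distrib])
    (by intros; funext α; simp [mul_left_comm, Finset.mul_sum])
  have hδ : ∀ p q α, δ p q α = ∑ i, p i α * q i := fun _ _ _ => rfl
  have hmem : ∀ u : LinearMap.ker π, A ≤ LinearMap.ker (δ u.1.1.2) := by
    rintro ⟨⟨u, hu⟩, hu'⟩ q ⟨w, hw, rfl⟩
    refine LinearMap.mem_ker.2 (funext fun α => ?_)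
    have h1 := hT w hw u hu α
    have h2 : u.1 = 0 := hu'
    simp only [modelForm, h2, Pi.zero_apply, mul_zero, sub_zero] at h1
    exact h1
  -- A vertical vector `(0, p)` of `T` pairs to zero with `A`, so `p` is a linear map from `ℝ^n / A`
  -- to `ℝ^k`. This bounds the vertical part by `k (n - dim A)`.
  let ρ : LinearMap.ker π →ₗ[ℝ] ((Fin n → ℝ) ⧸ A) →ₗ[ℝ] (Fin k → ℝ) :=
    { toFun := fun u => A.liftQ (δ u.1.1.2) (hmem u)
      map_add' := by
        intro u w
        refine A.linearMap_qext (LinearMap.ext fun q => ?_)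
        change δ (u.1.1.2 + w.1.1.2) q = δ u.1.1.2 q + δ w.1.1.2 q
        rw [map_add]
        rfl
      map_smul' := by
        intro c u
        refine A.linearMap_qext (LinearMap.ext fun q => ?_)
        change δ (c • u.1.1.2) q = c • δ u.1.1.2 q
        rw [map_smul]
        rfl }
  have hρ : Function.Injective ρ := by
    rw [injective_iff_map_eq_zero]
    rintro ⟨⟨u, hu⟩, hu'⟩ h
    have h2 : u.1 = 0 := hu'
    have h3 : u.2 = 0 := by
      funext i α
      have h4 : ρ ⟨⟨u, hu⟩, hu'⟩ (A.mkQ (Pi.single i 1)) α = 0 := by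
        rw [h]
        rfl
      change δ u.2 (Pi.single i 1) α = 0 at h4
      simpa [hδ, Pi.single_apply] using h4
    exact Subtype.ext (Subtype.ext (Prod.ext h2 h3))
  have h := LinearMap.finrank_le_finrank_of_injective hρ
  have h2 := A.finrank_quotient_add_finrank
  rw [Module.finrank_fin_fun] at h2
  rw [Module.finrank_linearMap, Module.finrank_fin_fun] at h
  refine h.trans ?_
  rw [mul_comm]
  refine Nat.mul_le_mul_left _ ?_
  omega

/-- A Legendrian subspace has linear coordinates consisting of some of the `q` and the
complementary `p`. -/
theorem exists_mixed_coordinates (hk : 1 ≤ k)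
    (S F : Submodule ℝ ((Fin n → ℝ) × (Fin n → Fin k → ℝ)))
    (hS : ∀ u ∈ S, ∀ w ∈ S, ∀ α, modelForm u w α = 0)
    (hF : ∀ u ∈ F, ∀ w ∈ F, ∀ α, modelForm u w α = 0) (hSF : S ⊔ F = ⊤) :
    ∃ I : Finset (Fin n), Module.finrank ℝ S = I.card + k * (n - I.card) ∧
      ∀ u ∈ S, (∀ i ∈ I, u.1 i = 0) → (∀ j ∉ I, u.2 j = 0) → u = 0 := by
  set A := S.map (LinearMap.fst ℝ (Fin n → ℝ) (Fin n → Fin k → ℝ)) with hA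
  set B := F.map (LinearMap.fst ℝ (Fin n → ℝ) (Fin n → Fin k → ℝ)) with hB
  have h1 := finrank_isotropic_le S hS
  have h2 := finrank_isotropic_le F hF
  rw [← hA] at h1
  rw [← hB] at h2
  have hAB : A ⊔ B = ⊤ := by
    rw [hA, hB, ← Submodule.map_sup, hSF, Submodule.map_top, LinearMap.range_eq_top]
    exact Prod.fst_surjective
  have h3 := Submodule.finrank_add_le_finrank_add_finrank A B
  have h4 := Submodule.finrank_add_le_finrank_add_finrank S F
  rw [hAB, finrank_top, Module.finrank_fin_fun] at h3
  rw [hSF, finrank_top, Module.finrank_prod, Module.finrank_fin_fun, Module.finrank_pi_fintype]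
    at h4
  simp only [Module.finrank_fin_fun, Finset.sum_const, Finset.card_univ, Fintype.card_fin,
    smul_eq_mul] at h4
  have hAn : Module.finrank ℝ A ≤ n := by simpa using A.finrank_le
  have hBn : Module.finrank ℝ B ≤ n := by simpa using B.finrank_le
  obtain ⟨I, hI, hIq, hIp⟩ := exists_coordinate_subset A
  refine ⟨I, ?_, ?_⟩
  · rw [hI]
    -- From `a + b ≥ n` and `k ≥ 1`, the upper bounds for `S` and `F` add up to at most `n + k n`,
    -- and `dim S + dim F` is at least that. So both bounds are attained.
    generalize Module.finrank ℝ A = a at *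
    generalize Module.finrank ℝ B = b at *
    obtain ⟨a', ha'⟩ := Nat.exists_eq_add_of_le hAn
    obtain ⟨b', hb'⟩ := Nat.exists_eq_add_of_le hBn
    have e1 : n - a = a' := by omega
    have e2 : n - b = b' := by omega
    rw [e1] at h1 ⊢
    rw [e2] at h2
    obtain ⟨c, rfl⟩ := Nat.exists_eq_add_of_le hk
    have hle : c * (a' + b') ≤ c * n := Nat.mul_le_mul_left _ (by omega)
    have e3 : c * (a' + b') = c * a' + c * b' := mul_add _ _ _
    have e4 : (1 + c) * a' = a' + c * a' := by ring
    have e5 : (1 + c) * b' = b' + c * b' := by ring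
    have e6 : n * (1 + c) = n + c * n := by ring
    omega
  · intro u hu hq hp
    have hu1 : u.1 = 0 := hIq u.1 ⟨u, hu, rfl⟩ hq
    refine Prod.ext hu1 ?_
    funext i α
    -- The remaining vertical vector pairs to zero with `A` and has its `p` supported in `I`, so
    -- `hIp` kills each component.
    have := hIp (fun i => u.2 i α) (fun j hj => by rw [hp j hj]; rfl) (by
      rintro q ⟨w, hw, rfl⟩
      have h := hS w hw u hu α
      simp only [modelForm, hu1, Pi.zero_apply, mul_zero, sub_zero] at h
      exact h)
    exact congrFun this i

end LegendrianSubspaces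

/-! ### Changes of Darboux coordinates: permutations and partial Legendre transformations -/

section AdaptedCharts

variable {E : Type*} [NormedAddCommGroup E] [NormedSpace ℝ E] {k n : ℕ}

/-- The chart `φ` of a normed space is a smooth system of `k`-contact Darboux coordinates, adapted
to the distribution spanned by `X` if `k ≥ 2`. -/
structure AdaptedChart (η : E → E →L[ℝ] (Fin k → ℝ)) (V : E → Submodule ℝ E)
    (φ : OpenPartialHomeomorph E (DarbouxSpace k n)) : Prop where
  smooth : ∀ x ∈ φ.source, ContDiffAt ℝ ∞ φ x
  smooth_symm : ∀ y ∈ φ.target, ContDiffAt ℝ ∞ φ.symm y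
  darboux : ∀ x ∈ φ.source, DarbouxEqAt η φ x
  momenta : 2 ≤ k → ∀ x ∈ φ.source, ∀ v, v ∈ V x ↔
    (fderiv ℝ φ x v).1 = 0 ∧ (fderiv ℝ φ x v).2.1 = 0

/-- The derivative of a local diffeomorphism is injective. -/
theorem fderiv_injective_of_smooth_symm {F : Type*} [NormedAddCommGroup F] [NormedSpace ℝ F]
    {φ : OpenPartialHomeomorph E F} {x : E} (hx : x ∈ φ.source) (h : ContDiffAt ℝ ∞ φ x)
    (h' : ContDiffAt ℝ ∞ φ.symm (φ x)) : Function.Injective (fderiv ℝ φ x) := by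
  have h1 : HasFDerivAt (fun y => φ.symm (φ y)) _ x :=
    HasFDerivAt.comp x (h'.differentiableAt (by simp)).hasFDerivAt
      (h.differentiableAt (by simp)).hasFDerivAt
  have h2 : HasFDerivAt (fun y => φ.symm (φ y)) (ContinuousLinearMap.id ℝ E) x := by
    refine (hasFDerivAt_id x).congr_of_eventuallyEq ?_
    filter_upwards [φ.open_source.mem_nhds hx] with y hy using φ.left_inv hy
  intro v w hvw
  have h3 := congrArg (fun A => A v) (h1.unique h2)
  have h4 := congrArg (fun A => A w) (h1.unique h2)
  simp only [ContinuousLinearMap.comp_apply, ContinuousLinearMap.id_apply] at h3 h4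
  rw [← h3, hvw, h4]

/-- A diffeomorphism of the model space that preserves the form `ds - ∑ p dq`. -/
structure IsContactEquiv (T : DarbouxSpace k n ≃ₜ DarbouxSpace k n) : Prop where
  smooth : ContDiff ℝ ∞ T
  smooth_symm : ContDiff ℝ ∞ T.symm
  form : ∀ c u α, (fderiv ℝ T c u).1 α - ∑ i, (T c).2.2 i α * (fderiv ℝ T c u).2.1 i =
    u.1 α - ∑ i, c.2.2 i α * u.2.1 i
  momenta : 2 ≤ k → ∀ c u, ((fderiv ℝ T c u).1 = 0 ∧ (fderiv ℝ T c u).2.1 = 0) ↔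
    (u.1 = 0 ∧ u.2.1 = 0)

theorem IsContactEquiv.fderiv_comp {T : DarbouxSpace k n ≃ₜ DarbouxSpace k n}
    (hT : IsContactEquiv T) {φ : E → DarbouxSpace k n} {x : E} (hφ : ContDiffAt ℝ ∞ φ x) (v : E) :
    fderiv ℝ (fun y => T (φ y)) x v = fderiv ℝ T (φ x) (fderiv ℝ φ x v) := by
  have h : HasFDerivAt (fun y => T (φ y)) _ x :=
    HasFDerivAt.comp x (hT.smooth.differentiable (by simp) (φ x)).hasFDerivAt
      (hφ.differentiableAt (by simp)).hasFDerivAt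
  rw [h.fderiv]
  rfl

theorem AdaptedChart.transHomeomorph {η : E → E →L[ℝ] (Fin k → ℝ)} {V : E → Submodule ℝ E}
    {φ : OpenPartialHomeomorph E (DarbouxSpace k n)} (h : AdaptedChart η V φ)
    {T : DarbouxSpace k n ≃ₜ DarbouxSpace k n} (hT : IsContactEquiv T) :
    AdaptedChart η V (φ.transHomeomorph T) := by
  refine ⟨fun x hx => ?_, fun y hy => ?_, fun x hx v α => ?_, fun hk x hx v => ?_⟩
  · exact hT.smooth.contDiffAt.comp x (h.smooth x hx)
  · exact ContDiffAt.comp (g := φ.symm) (f := T.symm) y (h.smooth_symm _ hy)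
      hT.smooth_symm.contDiffAt
  · have h1 := hT.fderiv_comp (h.smooth x hx) v
    change η x v α = (fderiv ℝ (fun y => T (φ y)) x v).1 α - ∑ i, (T (φ x)).2.2 i α *
      (fderiv ℝ (fun y => T (φ y)) x v).2.1 i
    rw [h1, hT.form]
    exact h.darboux x hx v α
  · have h1 := hT.fderiv_comp (h.smooth x hx) v
    change v ∈ V x ↔ (fderiv ℝ (fun y => T (φ y)) x v).1 = 0 ∧
      (fderiv ℝ (fun y => T (φ y)) x v).2.1 = 0
    rw [h1, hT.momenta hk]
    exact h.momenta hk x hx v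

/-- Renumbering the coordinates. -/
def permuteCoords (k : ℕ) (σ : Equiv.Perm (Fin n)) : DarbouxSpace k n ≃L[ℝ] DarbouxSpace k n :=
  LinearEquiv.toContinuousLinearEquiv
    { toFun := fun c => (c.1, fun i => c.2.1 (σ i), fun i => c.2.2 (σ i))
      invFun := fun c => (c.1, fun i => c.2.1 (σ.symm i), fun i => c.2.2 (σ.symm i))
      map_add' := fun _ _ => rfl
      map_smul' := fun _ _ => rfl
      left_inv := fun c => by simp
      right_inv := fun c => by simp }

theorem permuteCoords_apply (σ : Equiv.Perm (Fin n)) (c : DarbouxSpace k n) :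
    permuteCoords k σ c = (c.1, fun i => c.2.1 (σ i), fun i => c.2.2 (σ i)) := rfl

theorem fderiv_permuteCoords (σ : Equiv.Perm (Fin n)) (c u : DarbouxSpace k n) :
    fderiv ℝ (permuteCoords k σ).toHomeomorph c u = permuteCoords k σ u :=
  congrArg (fun A => A u) (permuteCoords k σ).fderiv

theorem isContactEquiv_permuteCoords (σ : Equiv.Perm (Fin n)) :
    IsContactEquiv (permuteCoords k σ).toHomeomorph where
  smooth := (permuteCoords k σ).contDiff
  smooth_symm := (permuteCoords k σ).symm.contDiff
  form c u α := by
    rw [fderiv_permuteCoords]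
    change u.1 α - ∑ i, c.2.2 (σ i) α * u.2.1 (σ i) = _
    rw [Equiv.sum_comp σ fun i => c.2.2 i α * u.2.1 i]
  momenta _ c u := by
    rw [fderiv_permuteCoords]
    refine and_congr_right fun _ => ⟨fun h => ?_, fun h => ?_⟩
    · funext i
      have := congrFun h (σ.symm i)
      simpa [permuteCoords_apply] using this
    · funext i
      exact congrFun h (σ i)

/-- The function `s` of a point of the model space of a contact manifold. -/
def coordS (n : ℕ) : DarbouxSpace 1 n →L[ℝ] ℝ :=
  (ContinuousLinearMap.proj 0).comp (ContinuousLinearMap.fst ℝ _ _)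

/-- The function `q^i` of a point of the model space of a contact manifold. -/
def coordQ (i : Fin n) : DarbouxSpace 1 n →L[ℝ] ℝ :=
  (ContinuousLinearMap.proj i).comp
    ((ContinuousLinearMap.fst ℝ _ _).comp (ContinuousLinearMap.snd ℝ _ _))

/-- The function `p_i` of a point of the model space of a contact manifold. -/
def coordP (i : Fin n) : DarbouxSpace 1 n →L[ℝ] ℝ :=
  (ContinuousLinearMap.proj 0).comp
    ((ContinuousLinearMap.proj (R := ℝ) (φ := fun _ : Fin n => Fin 1 → ℝ) i).comp
      ((ContinuousLinearMap.snd ℝ _ _).comp (ContinuousLinearMap.snd ℝ _ _)))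

theorem coordS_apply (c : DarbouxSpace 1 n) : coordS n c = c.1 0 := rfl
theorem coordQ_apply (c : DarbouxSpace 1 n) (i : Fin n) : coordQ i c = c.2.1 i := rfl
theorem coordP_apply (c : DarbouxSpace 1 n) (i : Fin n) : coordP i c = c.2.2 i 0 := rfl

/-- The partial Legendre transformation with respect to the coordinates in `J`, where the sign
`ε = 1`, or its inverse, where `ε = -1`. -/
def legendreFun (ε : ℝ) (J : Finset (Fin n)) (c : DarbouxSpace 1 n) : DarbouxSpace 1 n :=
  (fun _ => coordS n c - ∑ i ∈ J, coordP i c * coordQ i c,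
    fun i => if i ∈ J then ε * coordP i c else coordQ i c,
    fun i _ => if i ∈ J then -ε * coordQ i c else coordP i c)

/-- For `ε² = 1` each product `p_i q^i` with `i ∈ J` changes sign, so the second correction of `s`
undoes the first. -/
theorem legendreFun_legendreFun {ε : ℝ} (h : ε * ε = 1) (J : Finset (Fin n))
    (c : DarbouxSpace 1 n) : legendreFun (-ε) J (legendreFun ε J c) = c := by
  have hp : ∀ i ∈ J, coordP i (legendreFun ε J c) = -ε * coordQ i c := fun i hi => if_pos hi
  have hq : ∀ i ∈ J, coordQ i (legendreFun ε J c) = ε * coordP i c := fun i hi => if_pos hi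
  refine Prod.ext (funext fun i => ?_) (Prod.ext (funext fun i => ?_) (funext₂ fun i j => ?_))
  · have h1 : ∑ i ∈ J, coordP i (legendreFun ε J c) * coordQ i (legendreFun ε J c) =
        -∑ i ∈ J, coordP i c * coordQ i c := by
      rw [← Finset.sum_neg_distrib]
      refine Finset.sum_congr rfl fun i hi => ?_
      rw [hp i hi, hq i hi]
      linear_combination (-(coordP i c * coordQ i c)) * h
    change coordS n c - ∑ i ∈ J, coordP i c * coordQ i c -
      ∑ i ∈ J, coordP i (legendreFun ε J c) * coordQ i (legendreFun ε J c) = _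
    rw [h1, Subsingleton.elim i 0, coordS_apply]
    ring
  · change (if i ∈ J then -ε * coordP i (legendreFun ε J c) else coordQ i (legendreFun ε J c)) = _
    by_cases hi : i ∈ J
    · rw [if_pos hi, hp i hi, ← coordQ_apply]
      linear_combination coordQ i c * h
    · rw [if_neg hi]
      exact if_neg hi
  · change (if i ∈ J then -(-ε) * coordQ i (legendreFun ε J c)
      else coordP i (legendreFun ε J c)) = _
    rw [Subsingleton.elim j 0]
    by_cases hi : i ∈ J
    · rw [if_pos hi, hq i hi, ← coordP_apply]
      linear_combination coordP i c * h
    · rw [if_neg hi]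
      exact if_neg hi

theorem contDiff_legendreFun (ε : ℝ) (J : Finset (Fin n)) : ContDiff ℝ ∞ (legendreFun ε J) := by
  refine ContDiff.prodMk (contDiff_pi.2 fun _ => ?_)
    (ContDiff.prodMk (contDiff_pi.2 fun i => ?_) (contDiff_pi.2 fun i => contDiff_pi.2 fun _ => ?_))
  · exact (coordS n).contDiff.sub
      (ContDiff.sum fun i _ => (coordP i).contDiff.mul (coordQ i).contDiff)
  · by_cases hi : i ∈ J
    · simp only [hi, if_true]
      exact contDiff_const.mul (coordP i).contDiff
    · simp only [hi, if_false]
      exact (coordQ i).contDiff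
  · by_cases hi : i ∈ J
    · simp only [hi, if_true]
      exact contDiff_const.mul (coordQ i).contDiff
    · simp only [hi, if_false]
      exact (coordP i).contDiff

/-- The partial Legendre transformation as a homeomorphism of the model space. -/
def legendreHomeomorph (J : Finset (Fin n)) : DarbouxSpace 1 n ≃ₜ DarbouxSpace 1 n where
  toFun := legendreFun 1 J
  invFun := legendreFun (-1) J
  left_inv := legendreFun_legendreFun (by norm_num) J
  right_inv c := by simpa using legendreFun_legendreFun (ε := -1) (by norm_num) J c
  continuous_toFun := (contDiff_legendreFun 1 J).continuous
  continuous_invFun := (contDiff_legendreFun (-1) J).continuous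

section Derivative

variable (J : Finset (Fin n)) (c u : DarbouxSpace 1 n)

theorem hasFDerivAt_clm_legendre (A : DarbouxSpace 1 n →L[ℝ] ℝ) :
    HasFDerivAt (fun c => A (legendreFun 1 J c)) (A.comp (fderiv ℝ (legendreFun 1 J) c)) c :=
  HasFDerivAt.comp c A.hasFDerivAt
    ((contDiff_legendreFun 1 J).differentiable (by simp) c).hasFDerivAt

theorem coordS_fderiv_legendreFun : coordS n (fderiv ℝ (legendreFun 1 J) c u) =
    coordS n u - ∑ i ∈ J, (coordP i c * coordQ i u + coordQ i c * coordP i u) := by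
  have h1 : HasFDerivAt (fun c => coordS n (legendreFun 1 J c))
      (coordS n - ∑ i ∈ J, (coordP i c • coordQ i + coordQ i c • coordP i)) c :=
    HasFDerivAt.fun_sub (coordS n).hasFDerivAt
      (HasFDerivAt.fun_sum fun i _ => (coordP i).hasFDerivAt.mul (coordQ i).hasFDerivAt)
  have h2 := congrArg (fun A => A u) ((hasFDerivAt_clm_legendre J c (coordS n)).unique h1)
  simpa using h2

theorem coordQ_fderiv_legendreFun (i : Fin n) : coordQ i (fderiv ℝ (legendreFun 1 J) c u) =
    if i ∈ J then coordP i u else coordQ i u := by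
  have h1 : HasFDerivAt (fun c => coordQ i (legendreFun 1 J c))
      (if i ∈ J then coordP i else coordQ i) c := by
    by_cases hi : i ∈ J
    · rw [if_pos hi]
      refine (coordP i).hasFDerivAt.congr_of_eventuallyEq (Filter.Eventually.of_forall fun c => ?_)
      exact (if_pos hi).trans (one_mul _)
    · rw [if_neg hi]
      exact (coordQ i).hasFDerivAt.congr_of_eventuallyEq
        (Filter.Eventually.of_forall fun c => if_neg hi)
  have h2 := congrArg (fun A => A u) ((hasFDerivAt_clm_legendre J c (coordQ i)).unique h1)
  refine h2.trans ?_
  split_ifs <;> rfl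

end Derivative

/-- For `i ∈ J` the new pair is `(p, -q)`, and `d(s - p q) + q dp = ds - p dq`. The condition on
momenta concerns `k ≥ 2` only, so exchanging `q` and `p` is permitted here. -/
theorem isContactEquiv_legendre (J : Finset (Fin n)) : IsContactEquiv (legendreHomeomorph J) where
  smooth := contDiff_legendreFun 1 J
  smooth_symm := contDiff_legendreFun (-1) J
  momenta h := absurd h (by norm_num)
  form c u α := by
    rw [Subsingleton.elim α 0]
    change coordS n (fderiv ℝ (legendreFun 1 J) c u) - ∑ i, coordP i (legendreFun 1 J c) *
      coordQ i (fderiv ℝ (legendreFun 1 J) c u) = coordS n u - ∑ i, coordP i c * coordQ i u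
    have h1 : ∀ i, coordP i (legendreFun 1 J c) * coordQ i (fderiv ℝ (legendreFun 1 J) c u) =
        coordP i c * coordQ i u -
          if i ∈ J then coordP i c * coordQ i u + coordQ i c * coordP i u else 0 := by
      intro i
      rw [coordQ_fderiv_legendreFun]
      by_cases hi : i ∈ J
      · have h2 : coordP i (legendreFun 1 J c) = -1 * coordQ i c := if_pos hi
        rw [if_pos hi, if_pos hi, h2]
        ring
      · have h2 : coordP i (legendreFun 1 J c) = coordP i c := if_neg hi
        rw [if_neg hi, if_neg hi, h2, sub_zero]
    simp_rw [h1, Finset.sum_sub_distrib, Finset.sum_ite_mem, Finset.univ_inter]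
    rw [coordS_fderiv_legendreFun]
    ring

end AdaptedCharts

/-! ### Darboux charts adapted to a Legendrian subspace -/

section LegendrianCharts

variable {E : Type*} [NormedAddCommGroup E] [NormedSpace ℝ E] [FiniteDimensional ℝ E] {k n : ℕ}

theorem PolarizedNear.exists_involutive_functions (hk : 1 ≤ k) {η : E → E →L[ℝ] (Fin k → ℝ)}
    {X : Fin (n * k) → E → E} {x : E} (h : PolarizedNear n η X x) :
    ∃ q : E → Fin n → ℝ, (∀ᶠ y in 𝓝 x, ContDiffAt ℝ ∞ q y) ∧
      ∀ᶠ y in 𝓝 x, Function.Surjective (fderiv ℝ q y) ∧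
        (2 ≤ k → ∀ a, fderiv ℝ q y (X a y) = 0) ∧
        ∀ v w, fderiv ℝ q y v = 0 → fderiv ℝ q y w = 0 → extD η y v w = 0 := by
  rcases hk.eq_or_lt with rfl | hk
  · obtain ⟨q, hq, hq'⟩ := KContact.exists_involutive_functions η x h.finrank_eq h.contact
    exact ⟨q, hq, hq'.mono fun y hy => ⟨hy.1, fun h => absurd h (by norm_num), hy.2⟩⟩
  · obtain ⟨q, hq, hq'⟩ := h.exists_firstIntegrals hk
    exact ⟨q, hq, hq'.mono fun y hy => ⟨hy.1, fun _ => hy.2.1, hy.2.2⟩⟩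

/-- The predicate `r` carries further local conditions over to the whole chart domain. -/
theorem PolarizedNear.exists_adapted_darboux_chart (hk : 1 ≤ k) {η : E → E →L[ℝ] (Fin k → ℝ)}
    {X : Fin (n * k) → E → E} {x₀ : E} (h : PolarizedNear n η X x₀) {r : E → Prop}
    (hr : ∀ᶠ x in 𝓝 x₀, r x) :
    ∃ φ : OpenPartialHomeomorph E (DarbouxSpace k n), x₀ ∈ φ.source ∧
      AdaptedChart η (fun x => Submodule.span ℝ (Set.range fun a => X a x)) φ ∧
      ∀ x ∈ φ.source, r x := by
  obtain ⟨q, hq, hq'⟩ := h.exists_involutive_functions hk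
  obtain ⟨φ, hx₀, hsymm, hφ⟩ := exists_darboux_chart η q x₀
    (h.contact.mono fun x hx => hx.smooth) hq hq'.self_of_nhds.1
    (hq'.mono fun x hx v w hv hw => sub_eq_zero.1 (hx.2.2 v w hv hw))
    (fun v hv hv' => h.contact.self_of_nhds.disjoint v hv (by
      ext1 w
      exact sub_eq_zero.2 (hv' w)))
    h.finrank_eq ((h.eventually.and hq').and hr)
  have hinj : ∀ x ∈ φ.source, Function.Injective (fderiv ℝ φ x) := fun x hx =>
    fderiv_injective_of_smooth_symm hx (hφ x hx).1 (hsymm _ (φ.map_source hx))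
  refine ⟨φ, hx₀, ⟨fun x hx => (hφ x hx).1, hsymm, fun x hx => (hφ x hx).2.1, ?_⟩,
    fun x hx => (hφ x hx).2.2.2.2⟩
  intro hk' x hx v
  obtain ⟨-, hd, hDq, ⟨hX, hqx⟩, -⟩ := hφ x hx
  set B : E →ₗ[ℝ] (Fin k → ℝ) × (Fin n → ℝ) :=
    (LinearMap.prod (LinearMap.fst ℝ _ _) ((LinearMap.fst ℝ _ _).comp (LinearMap.snd ℝ _ _))).comp
      (fderiv ℝ φ x).toLinearMap with hB
  have hBv : ∀ v, B v = ((fderiv ℝ φ x v).1, (fderiv ℝ φ x v).2.1) := fun v => rfl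
  have hmem : ∀ v, v ∈ LinearMap.ker B ↔ (fderiv ℝ φ x v).1 = 0 ∧ (fderiv ℝ φ x v).2.1 = 0 := by
    intro v
    rw [LinearMap.mem_ker, hBv, Prod.mk_eq_zero]
  rw [← hmem]
  -- `q` is constant along the polarization, and `ds = η + ∑ p dq` then vanishes on it too.
  have hle : Submodule.span ℝ (Set.range fun a => X a x) ≤ LinearMap.ker B := by
    rw [Submodule.span_le]
    rintro _ ⟨a, rfl⟩
    have h1 : (fderiv ℝ φ x (X a x)).2.1 = 0 := by rw [hDq]; exact hqx.2.1 hk' a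
    refine (hmem _).2 ⟨?_, h1⟩
    funext α
    have h2 := hd (X a x) α
    rw [hX.le_ker.self_of_nhds a, h1] at h2
    simpa using h2.symm
  -- On the common kernel of `ds` and `dq` the map `dp` is injective, into a space of dimension `n
  -- k`.
  have hfin : Module.finrank ℝ (LinearMap.ker B) ≤
      Module.finrank ℝ (Submodule.span ℝ (Set.range fun a => X a x)) := by
    rw [finrank_span_eq_card hX.independent.self_of_nhds, Fintype.card_fin]
    have h1 : Function.Injective (((LinearMap.snd ℝ _ _).comp ((LinearMap.snd ℝ _ _).comp
        (fderiv ℝ φ x).toLinearMap)).domRestrict (LinearMap.ker B) :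
        LinearMap.ker B →ₗ[ℝ] (Fin n → Fin k → ℝ)) := by
      rw [injective_iff_map_eq_zero]
      intro v hv
      have h2 := (hmem _).1 v.2
      refine Subtype.ext (hinj x hx ?_)
      rw [ZeroMemClass.coe_zero, map_zero]
      exact Prod.ext h2.1 (Prod.ext h2.2 hv)
    refine (LinearMap.finrank_le_finrank_of_injective h1).trans ?_
    rw [Module.finrank_pi_fintype]
    simp
  rw [Submodule.eq_of_le_of_finrank_le hle hfin]

/-- A permutation that moves an initial segment onto a given set. -/
theorem exists_perm_mem_iff_lt_card (I : Finset (Fin n)) :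
    ∃ σ : Equiv.Perm (Fin n), ∀ i, σ i ∈ I ↔ i.val < I.card := by
  have hcard : Fintype.card {i : Fin n // i.val < I.card} = Fintype.card {i // i ∈ I} := by
    rw [Fintype.card_subtype, Fintype.card_coe]
    have hI : I.card ≤ n := by simpa using I.card_le_univ
    rw [Fin.card_filter_val_lt, min_eq_right hI]
  let e : {i : Fin n // i.val < I.card} ≃ {i // i ∈ I} := Fintype.equivOfCardEq hcard
  refine ⟨e.extendSubtype, fun i => ⟨fun h => ?_, fun h => e.extendSubtype_mem i h⟩⟩
  by_contra hi
  exact e.extendSubtype_not_mem i hi h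

/-- On `S` the equation `ds = ∑ p dq` holds, so forgetting `s` loses nothing and
`exists_mixed_coordinates` applies in the `(q, p)`-space. A coordinate change then normalises its
index set `I`. -/
theorem PolarizedNear.exists_legendrian_chart (hk : 1 ≤ k) {η : E → E →L[ℝ] (Fin k → ℝ)}
    {X : Fin (n * k) → E → E} {x₀ : E} (h : PolarizedNear n η X x₀) {r : E → Prop}
    (hr : ∀ᶠ x in 𝓝 x₀, r x) (S F : Submodule ℝ E) (hSη : ∀ v ∈ S, η x₀ v = 0)
    (hS : ∀ v ∈ S, ∀ w ∈ S, extD η x₀ v w = 0) (hF : ∀ v ∈ F, ∀ w ∈ F, extD η x₀ v w = 0)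
    (hSF : S ⊔ F = ⊤) :
    ∃ s ≤ n, Module.finrank ℝ S = s + k * (n - s) ∧ (k = 1 → s = n) ∧
      ∃ φ : OpenPartialHomeomorph E (DarbouxSpace k n), x₀ ∈ φ.source ∧
        AdaptedChart η (fun x => Submodule.span ℝ (Set.range fun a => X a x)) φ ∧
        (∀ x ∈ φ.source, r x) ∧ ∀ v ∈ S, mixedCoords s (fderiv ℝ φ x₀ v) = 0 → v = 0 := by
  obtain ⟨φ, hx₀, hφ, hφr⟩ := h.exists_adapted_darboux_chart hk hr
  have hinj : Function.Injective (fderiv ℝ φ x₀) :=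
    fderiv_injective_of_smooth_symm hx₀ (hφ.smooth _ hx₀) (hφ.smooth_symm _ (φ.map_source hx₀))
  have hfin : Module.finrank ℝ E = Module.finrank ℝ (DarbouxSpace k n) := by
    rw [h.finrank_eq, Module.finrank_prod, Module.finrank_prod, Module.finrank_pi,
      Module.finrank_pi, Module.finrank_pi_fintype]
    simp
    ring
  have hsurj : Function.Surjective (fderiv ℝ φ x₀) :=
    (LinearMap.injective_iff_surjective_of_finrank_eq_finrank hfin
      (f := (fderiv ℝ φ x₀).toLinearMap)).1 hinj
  set P : E →ₗ[ℝ] (Fin n → ℝ) × (Fin n → Fin k → ℝ) :=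
    (LinearMap.snd ℝ _ _).comp (fderiv ℝ φ x₀).toLinearMap with hP
  have hPv : ∀ v, P v = (fderiv ℝ φ x₀ v).2 := fun v => rfl
  have hPS : ∀ v ∈ S, P v = 0 → v = 0 := by
    intro v hv hv'
    rw [hPv] at hv'
    refine hinj ?_
    rw [map_zero]
    refine Prod.ext (funext fun α => ?_) hv'
    have h1 := hφ.darboux x₀ hx₀ v α
    rw [hSη v hv, hv'] at h1
    simpa using h1.symm
  have hform : ∀ v w α, extD η x₀ v w α = modelForm (P v) (P w) α :=
    DarbouxEqAt.fderiv_symm (Filter.eventually_of_mem (φ.open_source.mem_nhds hx₀) hφ.darboux)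
      h.contact.self_of_nhds.smooth (hφ.smooth x₀ hx₀)
  obtain ⟨I, hI, hI'⟩ := exists_mixed_coordinates hk (S.map P) (F.map P)
    (by
      rintro _ ⟨v, hv, rfl⟩ _ ⟨w, hw, rfl⟩ α
      rw [← hform, hS v hv w hw]
      rfl)
    (by
      rintro _ ⟨v, hv, rfl⟩ _ ⟨w, hw, rfl⟩ α
      rw [← hform, hF v hv w hw]
      rfl)
    (by
      rw [← Submodule.map_sup, hSF, Submodule.map_top, LinearMap.range_eq_top]
      exact Prod.snd_surjective.comp hsurj)
  have hIn : I.card ≤ n := by simpa using I.card_le_univ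
  have hSI : Module.finrank ℝ S = I.card + k * (n - I.card) := by
    rw [← hI, ← LinearMap.range_domRestrict]
    refine (LinearMap.finrank_range_of_inj ?_).symm
    rw [injective_iff_map_eq_zero]
    exact fun v hv => Subtype.ext (hPS v v.2 hv)
  have hI'' : ∀ v ∈ S, (∀ i ∈ I, (fderiv ℝ φ x₀ v).2.1 i = 0) →
      (∀ j ∉ I, (fderiv ℝ φ x₀ v).2.2 j = 0) → v = 0 := fun v hv h1 h2 =>
    hPS v hv (hI' (P v) ⟨v, hv, rfl⟩ h1 h2)
  rcases hk.eq_or_lt with rfl | hk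
  -- For `k = 1`, exchanging `q` and `p` outside `I` turns all the parametrizing variables into
  -- `q`'s.
  · refine ⟨n, le_rfl, by omega, fun _ => rfl, φ.transHomeomorph (legendreHomeomorph Iᶜ), hx₀,
      hφ.transHomeomorph (isContactEquiv_legendre _), hφr, fun v hv hv' => ?_⟩
    change mixedCoords n (fderiv ℝ (fun y => legendreHomeomorph Iᶜ (φ y)) x₀ v) = 0 at hv'
    rw [(isContactEquiv_legendre Iᶜ).fderiv_comp (hφ.smooth x₀ hx₀)] at hv'
    have h1 : ∀ i : Fin n,
        coordQ i (fderiv ℝ (legendreFun 1 Iᶜ) (φ x₀) (fderiv ℝ φ x₀ v)) = 0 := fun i =>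
      congrFun (congrArg Prod.fst hv') ⟨i, i.2⟩
    simp only [coordQ_fderiv_legendreFun] at h1
    refine hI'' v hv (fun i hi => ?_) fun j hj => funext fun α => ?_
    · exact (if_neg (by simpa using hi)).symm.trans (h1 i)
    · rw [Subsingleton.elim α 0]
      exact (if_pos (by simpa using hj)).symm.trans (h1 j)
  -- For `k ≥ 2` the momenta must keep spanning the polarization, so the indices are only
  -- renumbered.
  · obtain ⟨σ, hσ⟩ := exists_perm_mem_iff_lt_card I
    refine ⟨I.card, hIn, hSI, fun h => by omega,
      φ.transHomeomorph (permuteCoords k σ).toHomeomorph, hx₀,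
      hφ.transHomeomorph (isContactEquiv_permuteCoords _), hφr, fun v hv hv' => ?_⟩
    change mixedCoords I.card
      (fderiv ℝ (fun y => (permuteCoords k σ).toHomeomorph (φ y)) x₀ v) = 0 at hv'
    rw [(isContactEquiv_permuteCoords σ).fderiv_comp (hφ.smooth x₀ hx₀),
      fderiv_permuteCoords] at hv'
    refine hI'' v hv (fun i hi => ?_) fun j hj => ?_
    · have h1 : (σ.symm i).val < I.card := (hσ _).1 (by simpa using hi)
      have h2 : (fderiv ℝ φ x₀ v).2.1 (σ (σ.symm i)) = 0 :=
        congrFun (congrArg Prod.fst hv') ⟨σ.symm i, h1⟩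
      simpa using h2
    · have h1 : I.card ≤ (σ.symm j).val := by
        by_contra! h3
        have := (hσ _).2 h3
        simp [hj] at this
      have h2 : (fderiv ℝ φ x₀ v).2.2 (σ (σ.symm j)) = 0 :=
        congrFun (congrArg Prod.snd hv') ⟨σ.symm j, h1⟩
      simpa using h2

end LegendrianCharts

/-! ### Local expressions of forms and vector fields in the charts of `M` -/

section Charts

variable {E : Type*} [NormedAddCommGroup E] [NormedSpace ℝ E]
  {M : Type*} [TopologicalSpace M] [ChartedSpace E M] [IsManifold 𝓘(ℝ, E) ∞ M]

theorem chartAt_mdifferentiable (z : M) : (chartAt E z).MDifferentiable 𝓘(ℝ, E) 𝓘(ℝ, E) :=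
  mdifferentiable_chart z

theorem contMDiffAt_chartAt (z : M) {x : M} (hx : x ∈ (chartAt E z).source) :
    ContMDiffAt 𝓘(ℝ, E) 𝓘(ℝ, E) ∞ (chartAt E z) x :=
  contMDiffOn_chart.contMDiffAt ((chartAt E z).open_source.mem_nhds hx)

theorem contMDiffAt_chartAt_symm (z : M) {y : E} (hy : y ∈ (chartAt E z).target) :
    ContMDiffAt 𝓘(ℝ, E) 𝓘(ℝ, E) ∞ (chartAt E z).symm y :=
  contMDiffOn_chart_symm.contMDiffAt ((chartAt E z).open_target.mem_nhds hy)

theorem continuousLinearMapAt_trivializationAt_eq (z : M) {x : M}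
    (hx : x ∈ (chartAt E z).source) :
    (trivializationAt E (TangentSpace 𝓘(ℝ, E)) z).continuousLinearMapAt ℝ x =
      mfderiv 𝓘(ℝ, E) 𝓘(ℝ, E) (chartAt E z) x := by
  rw [TangentBundle.continuousLinearMapAt_trivializationAt hx]
  simp only [mfld_simps]
  rfl

theorem symmL_trivializationAt_eq (z : M) {x : M} (hx : x ∈ (chartAt E z).source) :
    (trivializationAt E (TangentSpace 𝓘(ℝ, E)) z).symmL ℝ x =
      mfderiv 𝓘(ℝ, E) 𝓘(ℝ, E) (chartAt E z).symm (chartAt E z x) := by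
  rw [TangentBundle.symmL_trivializationAt hx]
  simp only [modelWithCornersSelf_coe, Set.range_id, mfderivWithin_univ]
  rfl

/-- In the bundle trivialization over the chart domain, the coordinates of `η` are its composition
with the derivative of the inverse chart, which is `inChart`. -/
theorem OneForm.IsSmooth.contDiffAt_inChart {k : ℕ} {η : OneForm E M k} (hη : η.IsSmooth) (z : M)
    {y : E} (hy : y ∈ (chartAt E z).target) : ContDiffAt ℝ ∞ (η.inChart z) y := by
  set x := (chartAt E z).symm y with hx
  have hxs : x ∈ (chartAt E z).source := (chartAt E z).map_target hy
  have h1 := ((trivializationAt (E →L[ℝ] (Fin k → ℝ)) (fun x : M => TangentSpace 𝓘(ℝ, E) x →L[ℝ]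
    Bundle.Trivial M (Fin k → ℝ) x) z).contMDiffAt_section_iff (IB := 𝓘(ℝ, E)) (n := ∞)
      (s := fun x => η x) (x₀ := x) (by simpa using hxs)).1 (hη x)
  have h2 : ContMDiffAt 𝓘(ℝ, E) 𝓘(ℝ, E →L[ℝ] (Fin k → ℝ)) ∞ (fun y : E =>
      (trivializationAt (E →L[ℝ] (Fin k → ℝ)) (fun x : M => TangentSpace 𝓘(ℝ, E) x →L[ℝ]
        Bundle.Trivial M (Fin k → ℝ) x) z
          ⟨(chartAt E z).symm y, η ((chartAt E z).symm y)⟩).2) y :=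
    h1.comp y (contMDiffAt_chartAt_symm z hy)
  refine h2.contDiffAt.congr_of_eventuallyEq ?_
  filter_upwards [(chartAt E z).open_target.mem_nhds hy] with y' hy'
  have hs : (chartAt E z).symm y' ∈ (chartAt E z).source := (chartAt E z).map_target hy'
  rw [hom_trivializationAt_apply]
  simp only [ContinuousLinearMap.inCoordinates]
  rw [symmL_trivializationAt_eq z hs, (chartAt E z).right_inv hy']
  ext v
  simp [OneForm.inChart]

theorem contDiffAt_inChart_vectorField {X : ∀ y : M, TangentSpace 𝓘(ℝ, E) y} {U : Set M}
    (hU : IsOpen U) (hX : ContMDiffOn 𝓘(ℝ, E) 𝓘(ℝ, E).tangent ∞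
      (fun y => (⟨y, X y⟩ : TangentBundle 𝓘(ℝ, E) M)) U) (z : M) {y : E}
    (hy : y ∈ (chartAt E z).target) (hyU : (chartAt E z).symm y ∈ U) :
    ContDiffAt ℝ ∞ (fun y => (mfderiv 𝓘(ℝ, E) 𝓘(ℝ, E) (chartAt E z) ((chartAt E z).symm y)
      (X ((chartAt E z).symm y)) : E)) y := by
  set x := (chartAt E z).symm y with hx
  have hxs : x ∈ (chartAt E z).source := (chartAt E z).map_target hy
  have h1 := ((trivializationAt E (TangentSpace 𝓘(ℝ, E)) z).contMDiffAt_section_iff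
    (IB := 𝓘(ℝ, E)) (n := ∞) (s := X) (x₀ := x) (by simpa using hxs)).1
      (hX.contMDiffAt (hU.mem_nhds hyU))
  have h2 : ContMDiffAt 𝓘(ℝ, E) 𝓘(ℝ, E) ∞ (fun y : E =>
      (trivializationAt E (TangentSpace 𝓘(ℝ, E)) z
        ⟨(chartAt E z).symm y, X ((chartAt E z).symm y)⟩).2) y :=
    h1.comp y (contMDiffAt_chartAt_symm z hy)
  refine h2.contDiffAt.congr_of_eventuallyEq ?_
  filter_upwards [(chartAt E z).open_target.mem_nhds hy] with y' hy'
  have hs : (chartAt E z).symm y' ∈ (chartAt E z).source := (chartAt E z).map_target hy'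
  have h3 : (trivializationAt E (TangentSpace 𝓘(ℝ, E)) z).continuousLinearMapAt ℝ
      ((chartAt E z).symm y') (X ((chartAt E z).symm y')) =
      (trivializationAt E (TangentSpace 𝓘(ℝ, E)) z
        ⟨(chartAt E z).symm y', X ((chartAt E z).symm y')⟩).2 := by
    rw [Bundle.Trivialization.continuousLinearMapAt_apply,
      Bundle.Trivialization.linearMapAt_apply, if_pos (by simpa using hs)]
  exact (congrArg (fun A : E →L[ℝ] E => A (X ((chartAt E z).symm y')))
    (continuousLinearMapAt_trivializationAt_eq z hs)).symm.trans h3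

end Charts

section Pullback

variable {E F : Type*} [NormedAddCommGroup E] [NormedSpace ℝ E] [NormedAddCommGroup F]
  [NormedSpace ℝ F]

/-- The exterior derivative commutes with pullbacks. -/
theorem extD_pullback {θ θ' : E → E →L[ℝ] F} {T : E → E} {y : E} (hθ : ContDiffAt ℝ ∞ θ (T y))
    (hT : ContDiffAt ℝ ∞ T y) (h : ∀ᶠ y' in 𝓝 y, θ' y' = (θ (T y')).comp (fderiv ℝ T y'))
    (v w : E) : extD θ' y v w = extD θ (T y) (fderiv ℝ T y v) (fderiv ℝ T y w) := by
  have h1 : HasFDerivAt (fun y' => θ (T y')) ((fderiv ℝ θ (T y)).comp (fderiv ℝ T y)) y :=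
    HasFDerivAt.comp y (hθ.differentiableAt (by simp)).hasFDerivAt
      (hT.differentiableAt (by simp)).hasFDerivAt
  have h2 : HasFDerivAt (fderiv ℝ T) (fderiv ℝ (fderiv ℝ T) y) y :=
    ((hT.fderiv_right (m := ∞) (by simp)).differentiableAt (by simp)).hasFDerivAt
  have h3 := h1.clm_comp h2
  have h4 : ∀ a b, fderiv ℝ θ' y a b = fderiv ℝ θ (T y) (fderiv ℝ T y a) (fderiv ℝ T y b) +
      θ (T y) (fderiv ℝ (fderiv ℝ T) y a b) := by
    intro a b
    rw [Filter.EventuallyEq.fderiv_eq (f₁ := θ')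
      (f := fun y' => (θ (T y')).comp (fderiv ℝ T y')) h, h3.fderiv]
    simp [add_comm]
  rw [extD_apply, extD_apply, h4, h4, fderiv_fderiv_symm hT v w]
  abel

end Pullback

/-! ### Transfer of the `k`-contact conditions to a fixed chart -/

section ChartDerivative

variable {E : Type*} [NormedAddCommGroup E] [NormedSpace ℝ E]
  {M : Type*} [TopologicalSpace M] [ChartedSpace E M]

/-- The derivative at `x` of the preferred chart around `z`. -/
def chartD (E : Type*) [NormedAddCommGroup E] [NormedSpace ℝ E] {M : Type*} [TopologicalSpace M]
    [ChartedSpace E M] (z x : M) : E →L[ℝ] E :=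
  mfderiv 𝓘(ℝ, E) 𝓘(ℝ, E) (chartAt E z) x

/-- The derivative at `y` of the inverse of the preferred chart around `z`. -/
def chartDSymm (z : M) (y : E) : E →L[ℝ] E :=
  mfderiv 𝓘(ℝ, E) 𝓘(ℝ, E) (chartAt E z).symm y

/-- The one-form `η`, with values in a fixed space of linear maps. -/
def OneForm.toFun {k : ℕ} (η : OneForm E M k) (x : M) : E →L[ℝ] (Fin k → ℝ) := η x

theorem OneForm.inChart_eq {k : ℕ} (η : OneForm E M k) (z : M) (y : E) :
    η.inChart z y = (η.toFun ((chartAt E z).symm y)).comp (chartDSymm z y) := rfl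

theorem OneForm.d_eq {k : ℕ} (η : OneForm E M k) (x : M) (v w : E) :
    η.d x v w = extD (η.inChart x) (chartAt E x x) (chartD E x x v) (chartD E x x w) := rfl

variable [IsManifold 𝓘(ℝ, E) ∞ M]

theorem chartDSymm_chartD (z : M) {x : M} (hx : x ∈ (chartAt E z).source) (v : E) :
    chartDSymm z (chartAt E z x) (chartD E z x v) = v :=
  congrArg (fun A : E →L[ℝ] E => A v) ((chartAt_mdifferentiable z).symm_comp_deriv hx)

theorem chartD_chartDSymm (z : M) {y : E} (hy : y ∈ (chartAt E z).target) (v : E) :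
    chartD E z ((chartAt E z).symm y) (chartDSymm z y v) = v :=
  congrArg (fun A : E →L[ℝ] E => A v) ((chartAt_mdifferentiable z).comp_symm_deriv hy)

/-- The derivative of the preferred chart around `z`, as an isomorphism. -/
def chartDEquiv (z : M) {x : M} (hx : x ∈ (chartAt E z).source) : E ≃ₗ[ℝ] E :=
  LinearEquiv.ofLinearMap (chartD E z x).toLinearMap (chartDSymm z (chartAt E z x)).toLinearMap
    (by
      ext v
      have h := chartD_chartDSymm z ((chartAt E z).map_source hx) v
      rwa [(chartAt E z).left_inv hx] at h)
    (by
      ext v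
      exact chartDSymm_chartD z hx v)

theorem OneForm.inChart_chartD {k : ℕ} (η : OneForm E M k) (z : M) {x : M}
    (hx : x ∈ (chartAt E z).source) (v : E) :
    η.inChart z (chartAt E z x) (chartD E z x v) = η x v := by
  rw [η.inChart_eq, ContinuousLinearMap.comp_apply, chartDSymm_chartD z hx,
    (chartAt E z).left_inv hx]
  rfl

theorem contDiffAt_transition (x z : M) {y : E} (hy : y ∈ (chartAt E z).target)
    (hx : (chartAt E z).symm y ∈ (chartAt E x).source) :
    ContDiffAt ℝ ∞ (fun y => chartAt E x ((chartAt E z).symm y)) y :=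
  ContMDiffAt.contDiffAt ((contMDiffAt_chartAt x hx).comp y (contMDiffAt_chartAt_symm z hy))

theorem fderiv_transition (x z : M) {y : E} (hy : y ∈ (chartAt E z).target)
    (hx : (chartAt E z).symm y ∈ (chartAt E x).source) :
    fderiv ℝ (fun y => chartAt E x ((chartAt E z).symm y)) y =
      (chartD E x ((chartAt E z).symm y)).comp (chartDSymm z y) := by
  rw [← mfderiv_eq_fderiv]
  exact mfderiv_comp y ((chartAt_mdifferentiable x).mdifferentiableAt hx)
    ((chartAt_mdifferentiable z).mdifferentiableAt_symm hy)

theorem OneForm.inChart_eq_pullback {k : ℕ} (η : OneForm E M k) (x z : M) {y : E}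
    (hy : y ∈ (chartAt E z).target) (hx : (chartAt E z).symm y ∈ (chartAt E x).source) :
    η.inChart z y = (η.inChart x (chartAt E x ((chartAt E z).symm y))).comp
      (fderiv ℝ (fun y => chartAt E x ((chartAt E z).symm y)) y) := by
  ext1 v
  rw [fderiv_transition x z hy hx, ContinuousLinearMap.comp_apply, ContinuousLinearMap.comp_apply,
    η.inChart_chartD x hx]
  rfl

/-- `OneForm.d` uses a chart that changes with the point. Naturality of the exterior derivative
under transition maps allows one fixed chart near `z`. -/
theorem OneForm.d_eq_extD {k : ℕ} {η : OneForm E M k} (hη : η.IsSmooth) (z : M) {x : M}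
    (hx : x ∈ (chartAt E z).source) (v w : E) :
    η.d x v w = extD (η.inChart z) (chartAt E z x) (chartD E z x v) (chartD E z x w) := by
  set y := chartAt E z x with hy
  have hyt : y ∈ (chartAt E z).target := (chartAt E z).map_source hx
  have hyx : (chartAt E z).symm y = x := (chartAt E z).left_inv hx
  have hys : (chartAt E z).symm y ∈ (chartAt E x).source := by
    rw [hyx]
    exact mem_chart_source E x
  have hev : ∀ᶠ y' in 𝓝 y, η.inChart z y' = (η.inChart x (chartAt E x ((chartAt E z).symm y'))).comp
      (fderiv ℝ (fun y => chartAt E x ((chartAt E z).symm y)) y') := by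
    filter_upwards [(chartAt E z).open_target.mem_nhds hyt,
      ((chartAt E z).continuousAt_symm hyt).preimage_mem_nhds
        ((chartAt E x).open_source.mem_nhds hys)] with y' h1 h2
    exact η.inChart_eq_pullback x z h1 h2
  rw [extD_pullback (hη.contDiffAt_inChart x ((chartAt E x).map_source hys))
    (contDiffAt_transition x z hyt hys) hev, fderiv_transition x z hyt hys, η.d_eq]
  simp only [ContinuousLinearMap.comp_apply]
  rw [hy, chartDSymm_chartD z hx, chartDSymm_chartD z hx, (chartAt E z).left_inv hx]

/-- The chart derivative is an isomorphism that carries `ker η` and `ker dη` to the corresponding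
kernels of the local expression. -/
theorem IsKContactForm.kContactAt [FiniteDimensional ℝ E] {k : ℕ} {η : OneForm E M k}
    (hη : IsKContactForm η) (z : M) {y : E} (hy : y ∈ (chartAt E z).target) :
    KContactAt (η.inChart z) y := by
  set x := (chartAt E z).symm y with hx
  have hxs : x ∈ (chartAt E z).source := (chartAt E z).map_target hy
  have hxy : chartAt E z x = y := (chartAt E z).right_inv hy
  let A := chartDEquiv z hxs
  have hker : ∀ v, η.inChart z y (A v) = η x v := fun v => by
    rw [← hxy]
    exact η.inChart_chartD z hxs v
  let D : E → E → Fin k → ℝ := fun v w => η.d x v w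
  have hd : ∀ v w, extD (η.inChart z) y (A v) (A w) = D v w := fun v w => by
    rw [← hxy]
    exact (OneForm.d_eq_extD hη.smooth z hxs v w).symm
  have hkerD : ∀ v, extD (η.inChart z) y (A v) = 0 ↔ ∀ w, D v w = 0 := by
    intro v
    refine ⟨fun h w => by rw [← hd, h]; rfl, fun h => ?_⟩
    ext1 w
    obtain ⟨w, rfl⟩ := A.surjective w
    rw [hd, h]
    rfl
  refine ⟨hη.smooth.contDiffAt_inChart z hy, ?_, ?_, fun v h1 h2 => ?_⟩
  · rw [← hη.corank_ker x]
    congr 1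
    have : LinearMap.ker (η.inChart z y).toLinearMap =
        Submodule.map A.toLinearMap (LinearMap.ker (η.toFun x).toLinearMap) := by
      ext v
      obtain ⟨v, rfl⟩ := A.surjective v
      rw [Submodule.mem_map_equiv]
      simp only [LinearEquiv.symm_apply_apply, LinearMap.mem_ker]
      exact Eq.congr_left (hker v)
    rw [this]
    exact LinearEquiv.finrank_map_eq A _
  · refine Eq.trans ?_ (hη.rank_kerD x)
    let K : Submodule ℝ E := η.kerD x
    have : LinearMap.ker (extD (η.inChart z) y).toLinearMap = Submodule.map A.toLinearMap K := by
      ext v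
      obtain ⟨v, rfl⟩ := A.surjective v
      rw [Submodule.mem_map_equiv]
      simp only [LinearEquiv.symm_apply_apply, LinearMap.mem_ker]
      exact hkerD v
    rw [this]
    exact LinearEquiv.finrank_map_eq A _
  · obtain ⟨v, rfl⟩ := A.surjective v
    rw [hker] at h1
    rw [hkerD] at h2
    have h3 : (v : E) ∈ (⊥ : Submodule ℝ E) := (hη.ker_inf_kerD x).le ⟨h1, h2⟩
    rw [(Submodule.mem_bot ℝ).1 h3, map_zero]

end ChartDerivative

/-! ### Transfer of the polarization to a chart -/

section Polarization

variable {E : Type*} [NormedAddCommGroup E] [NormedSpace ℝ E]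
  {M : Type*} [TopologicalSpace M] [ChartedSpace E M] [IsManifold 𝓘(ℝ, E) ∞ M]

/-- The derivative of a map between manifolds, as a map between the model spaces. -/
def modelDeriv {E' N : Type*} [NormedAddCommGroup E'] [NormedSpace ℝ E'] [TopologicalSpace N]
    [ChartedSpace E' N] (f : N → M) (u : N) : E' →L[ℝ] E :=
  mfderiv 𝓘(ℝ, E') 𝓘(ℝ, E) f u

/-- A map into `M`, read in the preferred chart around `z`. -/
theorem fderiv_chartAt_comp {G : Type*} [NormedAddCommGroup G] [NormedSpace ℝ G] (z : M)
    {f : G → M} {u : G} (hf : MDifferentiableAt 𝓘(ℝ, G) 𝓘(ℝ, E) f u)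
    (hu : f u ∈ (chartAt E z).source) :
    fderiv ℝ (fun u => chartAt E z (f u)) u = (chartD E z (f u)).comp (modelDeriv f u) := by
  rw [← mfderiv_eq_fderiv]
  exact mfderiv_comp u ((chartAt_mdifferentiable z).mdifferentiableAt hu) hf

/-- The local frame and the integral manifolds are pushed forward by the chart. The final
equivalence is what later recognises the polarization of `M` in the adapted charts of `E`. -/
theorem IsPolarization.exists_polarizedNear [FiniteDimensional ℝ E] {k n : ℕ} 
    {η : OneForm E M k} (hη : IsKContactForm η)
    {V : ∀ x : M, Submodule ℝ (TangentSpace 𝓘(ℝ, E) x)} (hV : IsPolarization n η V) (z : M) :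
    ∃ X : Fin (n * k) → E → E, PolarizedNear n (η.inChart z) X (chartAt E z z) ∧
      ∀ᶠ y in 𝓝 (chartAt E z z), y ∈ (chartAt E z).target ∧ ∀ v : E,
        v ∈ V ((chartAt E z).symm y) ↔ chartD E z ((chartAt E z).symm y) v ∈
          Submodule.span ℝ (Set.range fun a => X a y) := by
  obtain ⟨U, hU, hzU, X, hX, hXV⟩ := hV.subbundle z
  let XE : Fin (n * k) → M → E := fun a x => X a x
  let VE : M → Submodule ℝ E := fun x => V x
  have hindep : ∀ x ∈ U, LinearIndependent ℝ fun a => XE a x := fun x hx => (hXV x hx).1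
  have hspan : ∀ x ∈ U, Submodule.span ℝ (Set.range fun a => XE a x) = VE x := fun x hx =>
    (hXV x hx).2
  let Xc : Fin (n * k) → E → E := fun a y =>
    chartD E z ((chartAt E z).symm y) (XE a ((chartAt E z).symm y))
  have hz := mem_chart_target E z
  have hev : ∀ᶠ y in 𝓝 (chartAt E z z), y ∈ (chartAt E z).target ∧ (chartAt E z).symm y ∈ U := by
    refine Filter.Eventually.and ((chartAt E z).open_target.mem_nhds hz)
      (((chartAt E z).continuousAt_symm hz).preimage_mem_nhds (hU.mem_nhds ?_))
    rwa [(chartAt E z).left_inv (mem_chart_source E z)]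
  have hmap : ∀ x ∈ (chartAt E z).source, x ∈ U → (VE x).map (chartD E z x).toLinearMap =
      Submodule.span ℝ (Set.range fun a => Xc a (chartAt E z x)) := by
    intro x hx hxU
    rw [← hspan x hxU, Submodule.map_span, ← Set.range_comp]
    simp only [Xc, (chartAt E z).left_inv hx]
    rfl
  have hmem : ∀ x (hx : x ∈ (chartAt E z).source), x ∈ U → ∀ v : E, v ∈ VE x ↔ chartD E z x v ∈
      Submodule.span ℝ (Set.range fun a => Xc a (chartAt E z x)) := by
    intro x hx hxU v
    rw [← hmap x hx hxU]
    exact ((chartDEquiv z hx).injective.mem_set_image (s := (VE x : Set E))).symm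
  refine ⟨Xc, ⟨hV.finrank_eq, ?_, ?_, ?_, ?_, ?_⟩, ?_⟩
  · filter_upwards [hev] with y hy using hη.kContactAt z hy.1
  · filter_upwards [hev] with y hy a using contDiffAt_inChart_vectorField hU (hX a) z hy.1 hy.2
  · filter_upwards [hev] with y hy
    exact (hindep _ hy.2).map' (chartDEquiv z ((chartAt E z).map_target hy.1)).toLinearMap
      (LinearEquiv.ker _)
  · filter_upwards [hev] with y hy a
    have h1 := η.inChart_chartD z ((chartAt E z).map_target hy.1) (XE a ((chartAt E z).symm y))
    rw [(chartAt E z).right_inv hy.1] at h1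
    refine h1.trans (hV.le_ker _ ?_)
    have h2 : XE a ((chartAt E z).symm y) ∈ VE ((chartAt E z).symm y) := by
      rw [← hspan _ hy.2]
      exact Submodule.subset_span ⟨a, rfl⟩
    exact h2
  · filter_upwards [hev] with y hy
    obtain ⟨W, f, hW, h0, hf0, hf, hfV⟩ := hV.integrable ((chartAt E z).symm y)
    have hys : (chartAt E z).symm y ∈ (chartAt E z).source := (chartAt E z).map_target hy.1
    have hf' : ∀ u ∈ W, ContMDiffAt 𝓘(ℝ, Fin (n * k) → ℝ) 𝓘(ℝ, E) ∞ f u := fun u hu =>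
      hf.contMDiffAt (hW.mem_nhds hu)
    refine ⟨fun u => chartAt E z (f u), ?_, ?_, ?_⟩
    · exact ContMDiffAt.contDiffAt
        (ContMDiffAt.comp (0 : Fin (n * k) → ℝ) (contMDiffAt_chartAt z (by rwa [hf0])) (hf' 0 h0))
    · exact (congrArg (chartAt E z) hf0).trans ((chartAt E z).right_inv hy.1)
    · have hfU : ∀ᶠ u in 𝓝 (0 : Fin (n * k) → ℝ), f u ∈ (chartAt E z).source ∩ U := by
        refine (hf' 0 h0).continuousAt.preimage_mem_nhds
          (((chartAt E z).open_source.inter hU).mem_nhds ?_)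
        rw [hf0]
        exact ⟨hys, hy.2⟩
      filter_upwards [hfU, hW.mem_nhds h0] with u hu huW
      rw [← hmap _ hu.1 hu.2, fderiv_chartAt_comp z
        ((hf' u huW).mdifferentiableAt (by simp)) hu.1]
      have h1 : LinearMap.range (modelDeriv (E := E) (E' := Fin (n * k) → ℝ) f u).toLinearMap =
          VE (f u) := (hfV u huW).2
      rw [← h1, ← LinearMap.range_comp]
      rfl
  · filter_upwards [hev] with y hy
    refine ⟨hy.1, fun v => ?_⟩
    have h1 := hmem _ ((chartAt E z).map_target hy.1) hy.2 v
    rw [(chartAt E z).right_inv hy.1] at h1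
    exact h1

end Polarization

/-! ### Mixed coordinates, and charts of `M` and `L` -/

section MixedCoordinates

variable {k n : ℕ}

/-- The projection onto the mixed coordinates, as a continuous linear map. -/
def mixedCoordsL (k n s : ℕ) : DarbouxSpace k n →L[ℝ] MixedSpace k n s :=
  LinearMap.toContinuousLinearMap
    { toFun := mixedCoords s
      map_add' := fun _ _ => rfl
      map_smul' := fun _ _ => rfl }

theorem finrank_mixedSpace {s : ℕ} (hs : s ≤ n) :
    Module.finrank ℝ (MixedSpace k n s) = s + k * (n - s) := by
  have h1 : Fintype.card {i : Fin n // i.val < s} = s := by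
    rw [Fintype.card_subtype, Fin.card_filter_val_lt, min_eq_right hs]
  have h2 : Fintype.card {j : Fin n // s ≤ j.val} = n - s := by
    have h3 := Fintype.card_subtype_compl fun i : Fin n => i.val < s
    rw [h1, Fintype.card_fin] at h3
    rw [← h3]
    exact Fintype.card_congr (Equiv.subtypeEquivRight fun i => not_lt.symm)
  rw [Module.finrank_prod, Module.finrank_pi, Module.finrank_pi_fintype, h1]
  simp [h2, mul_comm]

end MixedCoordinates

section ManifoldCharts

variable {E : Type*} [NormedAddCommGroup E] [NormedSpace ℝ E]
  {M : Type*} [TopologicalSpace M] [ChartedSpace E M] [IsManifold 𝓘(ℝ, E) ∞ M] {k n : ℕ}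

theorem contMDiffAt_chartAt_trans {ψ : OpenPartialHomeomorph E (DarbouxSpace k n)}
    (hψ : ∀ y ∈ ψ.source, ContDiffAt ℝ ∞ ψ y) (z : M) {x : M}
    (hx : x ∈ ((chartAt E z).trans ψ).source) :
    ContMDiffAt 𝓘(ℝ, E) 𝓘(ℝ, DarbouxSpace k n) ∞ ((chartAt E z).trans ψ) x := by
  rw [OpenPartialHomeomorph.trans_source] at hx
  exact (hψ _ hx.2).contMDiffAt.comp x (contMDiffAt_chartAt z hx.1)

theorem mfderiv_chartAt_trans {ψ : OpenPartialHomeomorph E (DarbouxSpace k n)}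
    (hψ : ∀ y ∈ ψ.source, ContDiffAt ℝ ∞ ψ y) (z : M) {x : M}
    (hx : x ∈ ((chartAt E z).trans ψ).source) :
    (mfderiv 𝓘(ℝ, E) 𝓘(ℝ, DarbouxSpace k n) ((chartAt E z).trans ψ) x :
      E →L[ℝ] DarbouxSpace k n) = (fderiv ℝ ψ (chartAt E z x)).comp (chartD E z x) := by
  rw [OpenPartialHomeomorph.trans_source] at hx
  rw [← mfderiv_eq_fderiv]
  exact mfderiv_comp x ((hψ _ hx.2).contMDiffAt.mdifferentiableAt (by simp))
    ((chartAt_mdifferentiable z).mdifferentiableAt hx.1)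

theorem AdaptedChart.isDarbouxChart {η : OneForm E M k} {z : M} {V : E → Submodule ℝ E}
    {ψ : OpenPartialHomeomorph E (DarbouxSpace k n)} (hψ : AdaptedChart (η.inChart z) V ψ) :
    IsDarbouxChart η ((chartAt E z).trans ψ) := by
  refine ⟨fun x hx => (contMDiffAt_chartAt_trans hψ.smooth z hx).contMDiffWithinAt,
    fun y hy => ?_, fun x hx v α => ?_⟩
  · rw [OpenPartialHomeomorph.trans_target] at hy
    exact ((contMDiffAt_chartAt_symm z hy.2).comp y
      (hψ.smooth_symm y hy.1).contMDiffAt).contMDiffWithinAt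
  · have hx' := hx
    rw [OpenPartialHomeomorph.trans_source] at hx'
    rw [mfderiv_chartAt_trans hψ.smooth z hx]
    exact (congrFun (η.inChart_chartD z hx'.1 v) α).symm.trans
      (hψ.darboux _ hx'.2 (chartD E z x v) α)

theorem AdaptedChart.isSpannedByMomenta (hk : 2 ≤ k) {η : E → E →L[ℝ] (Fin k → ℝ)} {z : M}
    {V : ∀ x : M, Submodule ℝ (TangentSpace 𝓘(ℝ, E) x)} {V' : E → Submodule ℝ E}
    {ψ : OpenPartialHomeomorph E (DarbouxSpace k n)} (hψ : AdaptedChart η V' ψ)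
    (hV : ∀ y ∈ ψ.source, y ∈ (chartAt E z).target ∧ ∀ v : E,
      v ∈ V ((chartAt E z).symm y) ↔ chartD E z ((chartAt E z).symm y) v ∈ V' y) :
    IsSpannedByMomenta V ((chartAt E z).trans ψ) := by
  intro x hx v
  have hx' := hx
  rw [OpenPartialHomeomorph.trans_source] at hx'
  rw [mfderiv_chartAt_trans hψ.smooth z hx]
  have h1 := (hV _ hx'.2).2 v
  rw [(chartAt E z).left_inv hx'.1] at h1
  exact h1.trans (hψ.momenta hk _ hx'.2 (chartD E z x v))

variable {E' : Type*} [NormedAddCommGroup E'] [NormedSpace ℝ E'] [FiniteDimensional ℝ E']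
  {L : Type*} [TopologicalSpace L] [ChartedSpace E' L] [IsManifold 𝓘(ℝ, E') ∞ L]

/-- A smooth map with invertible derivative is a system of local coordinates. -/
theorem exists_coordinates {G : Type*} [NormedAddCommGroup G] [NormedSpace ℝ G]
    [FiniteDimensional ℝ G] (hfin : Module.finrank ℝ E' = Module.finrank ℝ G) {g : L → G} {z : L}
    (hg : ∀ᶠ y in 𝓝 z, ContMDiffAt 𝓘(ℝ, E') 𝓘(ℝ, G) ∞ g y)
    (hinj : Function.Injective (modelDeriv (E := G) (E' := E') g z)) {p : L → Prop}
    (hp : ∀ᶠ y in 𝓝 z, p y) :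
    ∃ e : OpenPartialHomeomorph L G, z ∈ e.source ∧ (∀ y ∈ e.source, p y) ∧
      ContMDiffOn 𝓘(ℝ, E') 𝓘(ℝ, G) ∞ e e.source ∧ ContMDiffOn 𝓘(ℝ, G) 𝓘(ℝ, E') ∞ e.symm e.target ∧
      ∀ y ∈ e.source, e y = g y := by
  set c := chartAt E' z with hc
  have hz : c z ∈ c.target := mem_chart_target E' z
  have hcz : c.symm (c z) = z := c.left_inv (mem_chart_source E' z)
  have htend : Filter.Tendsto c.symm (𝓝 (c z)) (𝓝 z) := by
    have := c.continuousAt_symm hz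
    rwa [ContinuousAt, hcz] at this
  have hev : ∀ᶠ u in 𝓝 (c z), u ∈ c.target ∧ p (c.symm u) ∧
      ContMDiffAt 𝓘(ℝ, E') 𝓘(ℝ, G) ∞ g (c.symm u) :=
    Filter.Eventually.and (c.open_target.mem_nhds hz) (htend.eventually (hp.and hg))
  have hsmooth : ∀ᶠ u in 𝓝 (c z), ContDiffAt ℝ ∞ (fun u => g (c.symm u)) u := by
    filter_upwards [hev] with u hu
    exact ContMDiffAt.contDiffAt (hu.2.2.comp u (contMDiffAt_chartAt_symm z hu.1))
  have hderiv : fderiv ℝ (fun u => g (c.symm u)) (c z) =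
      (modelDeriv (E := G) (E' := E') g z).comp (chartDSymm z (c z)) := by
    have h1 : fderiv ℝ (fun u => g (c.symm u)) (c z) =
        (modelDeriv (E := G) (E' := E') g (c.symm (c z))).comp (chartDSymm z (c z)) := by
      rw [← mfderiv_eq_fderiv]
      exact mfderiv_comp (c z) (hev.self_of_nhds.2.2.mdifferentiableAt (by simp))
        ((chartAt_mdifferentiable z).mdifferentiableAt_symm hz)
    rwa [hcz] at h1
  have hinj' : Function.Injective (fderiv ℝ (fun u => g (c.symm u)) (c z)) := by
    rw [hderiv]
    exact hinj.comp (chartDEquiv z (mem_chart_source E' z)).symm.injective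
  let A : E' ≃L[ℝ] G := (LinearEquiv.ofInjectiveOfFinrankEq
    (fderiv ℝ (fun u => g (c.symm u)) (c z)).toLinearMap hinj' hfin).toContinuousLinearEquiv
  have hA : (A : E' →L[ℝ] G) = fderiv ℝ (fun u => g (c.symm u)) (c z) := by
    ext v
    rfl
  obtain ⟨θ, hθ, hθz, hθs, hθt⟩ := exists_smooth_openPartialHomeomorph (f' := A) hsmooth
    (by rw [hA]; exact (hsmooth.self_of_nhds.differentiableAt (by simp)).hasFDerivAt) hev
  refine ⟨c.trans θ, ?_, fun y hy => ?_, fun y hy => ?_, fun y hy => ?_, fun y hy => ?_⟩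
  · rw [OpenPartialHomeomorph.trans_source]
    exact ⟨mem_chart_source E' z, hθz⟩
  · rw [OpenPartialHomeomorph.trans_source] at hy
    have := (hθs _ hy.2).2.2.1
    rwa [c.left_inv hy.1] at this
  · rw [OpenPartialHomeomorph.trans_source] at hy
    have h1 : ContDiffAt ℝ ∞ θ (c y) := by rw [hθ]; exact (hθs _ hy.2).1
    exact (h1.contMDiffAt.comp y (contMDiffAt_chartAt z hy.1)).contMDiffWithinAt
  · rw [OpenPartialHomeomorph.trans_target] at hy
    exact ((contMDiffAt_chartAt_symm z hy.2).comp y (hθt y hy.1).contMDiffAt).contMDiffWithinAt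
  · rw [OpenPartialHomeomorph.trans_source] at hy
    rw [OpenPartialHomeomorph.coe_trans, Function.comp_apply, hθ]
    exact congrArg g (c.left_inv hy.1)

end ManifoldCharts

/-! ### Local parametrization of Legendrian submanifolds -/

section LegendrianSubmanifolds

variable {E : Type*} [NormedAddCommGroup E] [NormedSpace ℝ E] [FiniteDimensional ℝ E]
  {M : Type*} [TopologicalSpace M] [ChartedSpace E M] [IsManifold 𝓘(ℝ, E) ∞ M] {k n : ℕ}
  {E' : Type*} [NormedAddCommGroup E'] [NormedSpace ℝ E'] [FiniteDimensional ℝ E']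
  {L : Type*} [TopologicalSpace L] [ChartedSpace E' L] [IsManifold 𝓘(ℝ, E') ∞ L]

/-- Around every point of a Legendrian submanifold there are adapted Darboux coordinates some of
which parametrize the submanifold. -/
theorem exists_legendrian_coordinates (hk : 1 ≤ k) {η : OneForm E M k} (hη : IsKContactForm η)
    {V : ∀ x : M, Submodule ℝ (TangentSpace 𝓘(ℝ, E) x)} (hV : IsPolarization n η V)
    {ι : L → M} (hι : IsLegendrianSubmanifold (E' := E') η ι) (z : L) :
    ∃ s ≤ n, Module.finrank ℝ E' = s + k * (n - s) ∧ (k = 1 → s = n) ∧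
      ∃ φ : OpenPartialHomeomorph M (DarbouxSpace k n),
        IsDarbouxChart η φ ∧ (2 ≤ k → IsSpannedByMomenta V φ) ∧
        ∃ e : OpenPartialHomeomorph L (MixedSpace k n s),
          z ∈ e.source ∧ Set.MapsTo ι e.source φ.source ∧
          ContMDiffOn 𝓘(ℝ, E') 𝓘(ℝ, MixedSpace k n s) ∞ e e.source ∧
          ContMDiffOn 𝓘(ℝ, MixedSpace k n s) 𝓘(ℝ, E') ∞ e.symm e.target ∧
          ∀ y ∈ e.source, e y = mixedCoords s (φ (ι y)) := by
  obtain ⟨X, hX, hXV⟩ := hV.exists_polarizedNear hη (ι z)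
  have hx := mem_chart_source E (ι z)
  let B : E →ₗ[ℝ] E := (chartDEquiv (ι z) hx).toLinearMap
  have hd : ∀ v w, extD (η.inChart (ι z)) (chartAt E (ι z) (ι z)) (B v) (B w) =
      η.d (ι z) v w := fun v w => rfl
  let R : Submodule ℝ E := LinearMap.range (modelDeriv (E := E) (E' := E') ι z).toLinearMap
  obtain ⟨hiso, F, hF, hFd⟩ := hι.legendrian z
  let F' : Submodule ℝ E := F
  have hRF : R ⊔ F' = ⊤ := hF.symm.sup_eq_top
  -- The tangent space of `L` and its isotropic complement are moved to `E` by the chart derivative;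
  -- `hXV` serves as the predicate `r`.
  obtain ⟨s, hsn, hs, hs1, ψ, hψx, hψ, hψV, hψS⟩ :=
    hX.exists_legendrian_chart hk hXV (R.map B) (F'.map B)
      (by
        rintro _ ⟨v, hv, rfl⟩
        exact (η.inChart_chartD (ι z) hx v).trans (hiso v hv).1)
      (by
        rintro _ ⟨v, hv, rfl⟩ _ ⟨w, hw, rfl⟩
        exact (hd v w).trans ((hiso v hv).2 w hw))
      (by
        rintro _ ⟨v, hv, rfl⟩ _ ⟨w, hw, rfl⟩
        exact (hd v w).trans (hFd v hv w hw))
      (by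
        rw [← Submodule.map_sup, hRF, Submodule.map_top]
        exact LinearEquiv.range _)
  have hfin : Module.finrank ℝ E' = s + k * (n - s) := by
    have h1 : Module.finrank ℝ (R.map B) = Module.finrank ℝ R :=
      LinearEquiv.finrank_map_eq (chartDEquiv (ι z) hx) R
    rw [← hs, h1]
    exact (LinearMap.finrank_range_of_inj (hι.immersion z)).symm
  set φ := (chartAt E (ι z)).trans ψ with hφ
  have hzφ : ι z ∈ φ.source := by
    rw [hφ, OpenPartialHomeomorph.trans_source]
    exact ⟨hx, hψx⟩
  have hφs : ∀ x ∈ φ.source, ContMDiffAt 𝓘(ℝ, E) 𝓘(ℝ, DarbouxSpace k n) ∞ φ x := fun x hx =>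
    contMDiffAt_chartAt_trans hψ.smooth (ι z) hx
  refine ⟨s, hsn, hfin, hs1, φ, hψ.isDarbouxChart, fun hk => hψ.isSpannedByMomenta hk hψV, ?_⟩
  have hev : ∀ᶠ y in 𝓝 z, ι y ∈ φ.source :=
    hι.smooth.continuous.continuousAt.preimage_mem_nhds (φ.open_source.mem_nhds hzφ)
  have hcomp : ∀ y, ι y ∈ φ.source →
      ContMDiffAt 𝓘(ℝ, E') 𝓘(ℝ, DarbouxSpace k n) ∞ (fun y => φ (ι y)) y := fun y hy =>
    (hφs _ hy).comp y (hι.smooth y)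
  have hderiv : modelDeriv (E := MixedSpace k n s) (E' := E') (fun y => mixedCoords s (φ (ι y))) z =
      (mixedCoordsL k n s).comp ((fderiv ℝ ψ (chartAt E (ι z) (ι z))).comp
        ((chartD E (ι z) (ι z)).comp (modelDeriv (E := E) (E' := E') ι z))) := by
    have h1 : modelDeriv (E := MixedSpace k n s) (E' := E') (fun y => mixedCoords s (φ (ι y))) z =
        (mixedCoordsL k n s).comp
          (modelDeriv (E := DarbouxSpace k n) (E' := E') (fun y => φ (ι y)) z) := by
      have := mfderiv_comp z (I := 𝓘(ℝ, E')) (g := mixedCoordsL k n s)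
        (mixedCoordsL k n s).mdifferentiableAt ((hcomp z hzφ).mdifferentiableAt (by simp))
      rw [ContinuousLinearMap.mfderiv_eq] at this
      exact this
    have h2 : modelDeriv (E := DarbouxSpace k n) (E' := E') (fun y => φ (ι y)) z =
        ((mfderiv 𝓘(ℝ, E) 𝓘(ℝ, DarbouxSpace k n) φ (ι z) : E →L[ℝ] DarbouxSpace k n)).comp
          (modelDeriv (E := E) (E' := E') ι z) :=
      mfderiv_comp z ((hφs _ hzφ).mdifferentiableAt (by simp))
        ((hι.smooth z).mdifferentiableAt (by simp))
    rw [h1, h2, mfderiv_chartAt_trans hψ.smooth (ι z) hzφ]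
    rfl
  -- The dimensions agree, so injectivity of the derivative at `z` is enough; it combines `hψS` with
  -- the immersion property.
  obtain ⟨e, hze, hes, he1, he2, he3⟩ := exists_coordinates
    (g := fun y => mixedCoords s (φ (ι y))) (hfin.trans (finrank_mixedSpace hsn).symm)
    (hev.mono fun y hy =>
      (mixedCoordsL k n s).contDiff.contMDiff.contMDiffAt.comp y (hcomp y hy))
    (by
      rw [hderiv, injective_iff_map_eq_zero]
      intro u hu
      have h1 := hψS (B (modelDeriv (E := E) (E' := E') ι z u)) ⟨_, ⟨u, rfl⟩, rfl⟩ hu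
      have h2 := (chartDEquiv (ι z) hx).map_eq_zero_iff.1 h1
      exact hι.immersion z (h2.trans (map_zero (modelDeriv (E := E) (E' := E') ι z)).symm))
    hev
  exact ⟨e, hze, hes, he1, he2, he3⟩

/-- If `k ≥ 2`, the dimension `s + k (n - s)` determines `s`. -/
theorem eq_of_add_mul_sub_eq (hk : 2 ≤ k) {s t : ℕ} (hs : s ≤ n) (ht : t ≤ n)
    (h : s + k * (n - s) = t + k * (n - t)) : s = t := by
  obtain ⟨a, rfl⟩ := Nat.exists_eq_add_of_le hs
  obtain ⟨b, hb⟩ := Nat.exists_eq_add_of_le ht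
  obtain ⟨m, rfl⟩ := Nat.exists_eq_add_of_le hk
  rw [Nat.add_sub_cancel_left, hb, Nat.add_sub_cancel_left] at h
  rcases lt_trichotomy a b with hab | hab | hab
  · have := Nat.mul_le_mul_left m hab.le
    nlinarith
  · omega
  · have := Nat.mul_le_mul_left m hab.le
    nlinarith

end LegendrianSubmanifolds

end KContact
end

theorem mainTheorem5
    {E : Type*} [NormedAddCommGroup E] [NormedSpace ℝ E] [FiniteDimensional ℝ E]
    {M : Type*} [TopologicalSpace M] [ChartedSpace E M] [IsManifold 𝓘(ℝ, E) ∞ M]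
    {k n : ℕ} (hk : 1 ≤ k) (η : KContact.OneForm E M k) (hη : KContact.IsKContactForm η)
    (V : ∀ x : M, Submodule ℝ (TangentSpace 𝓘(ℝ, E) x)) (hV : KContact.IsPolarization n η V)
    {E' : Type*} [NormedAddCommGroup E'] [NormedSpace ℝ E'] [FiniteDimensional ℝ E']
    {L : Type*} [TopologicalSpace L] [ChartedSpace E' L] [IsManifold 𝓘(ℝ, E') ∞ L]
    (ι : L → M) (hι : KContact.IsLegendrianSubmanifold (E' := E') η ι) :
    ∃ s : ℕ, s ≤ n ∧
      (∀ z : L, ∃ φ : OpenPartialHomeomorph M (KContact.DarbouxSpace k n),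
        KContact.IsDarbouxChart η φ ∧ (2 ≤ k → KContact.IsSpannedByMomenta V φ) ∧
        ∃ e : OpenPartialHomeomorph L (KContact.MixedSpace k n s),
          z ∈ e.source ∧ Set.MapsTo ι e.source φ.source ∧
          ContMDiffOn 𝓘(ℝ, E') 𝓘(ℝ, KContact.MixedSpace k n s) ∞ e e.source ∧
          ContMDiffOn 𝓘(ℝ, KContact.MixedSpace k n s) 𝓘(ℝ, E') ∞ e.symm e.target ∧
          ∀ y ∈ e.source, e y = KContact.mixedCoords s (φ (ι y))) ∧
      (Nonempty L → Module.finrank ℝ E' = s + k * (n - s)) := by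
  rcases isEmpty_or_nonempty L with hL | ⟨⟨z₀⟩⟩
  -- For empty `L` every `s ≤ n` works.
  · exact ⟨0, n.zero_le, fun z => isEmptyElim z, fun ⟨z⟩ => isEmptyElim z⟩
  obtain ⟨s, hsn, hs, hs1, -⟩ := KContact.exists_legendrian_coordinates hk hη hV hι z₀
  refine ⟨s, hsn, fun z => ?_, fun _ => hs⟩
  obtain ⟨t, htn, ht, ht1, h⟩ := KContact.exists_legendrian_coordinates hk hη hV hι z
  -- All of `L` is modelled on `E'`, so its dimension is the same at `z` and `z₀`, even for
  -- disconnected `L`. It determines `s` if `k ≥ 2`, and for `k = 1` both values are `n`.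
  have hst : t = s := by
    rcases hk.eq_or_lt with hk | hk
    · rw [hs1 hk.symm, ht1 hk.symm]
    · exact KContact.eq_of_add_mul_sub_eq hk htn hsn (ht.symm.trans hs)
  subst hst
  exact h
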